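/- Let $M\subset\mathbb R^m$, $N\subset\mathbb R^n$ be open, and let $J^\infty(M,N)$ be the infinite jet space with coordinates $x^i,u^j_\sigma$ ($u^j=u^j_0$) and the inverse limit topology. Let $\mathfrak F$ be the algebra of smooth functions of finitely many of these coordinates, $D_i=\partial_{x^i}+\sum_{j,\sigma}u^j_{\sigma+1_i}\partial_{u^j_\sigma}$, and for $G\in\mathfrak F^n$ let $V_G=\sum_{j,\sigma}D^\sigma(G^j)\partial_{u^j_\sigma}$; the bracket on $\mathfrak F^n$ is defined by $V_{[G,G']}=[V_G,V_{G'}]$. Let $F,G_1,\dots,G_h\in\mathfrak F^n$ satisfy the following. 1. $[G_i,G_j]=\sum_{k=1}^h\lambda_{i,j}^kG_k$ with real constants $\lambda_{i,j}^k$. 2. Each $G_i$ admits characteristics: for some $\eta_i^1,\dots,\eta_i^m\in\mathfrak F$ the vector field $\bar V_{G_i}=V_{G_i}-\sum_r\eta_i^rD_r$ has a local flow $\Phi^i$ on $J^\infty(M,N)$, whose components depend smoothly on the time and, locally, on finitely many coordinates. 3. The $\bar V_{G_i}$ admit a common filtration: there are subalgebras $\mathfrak G_0\subset\mathfrak G_1\subset\cdots$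 with union $\mathfrak F$ and $\bar V_{G_i}(\mathfrak G_k)\subset\mathfrak G_k$ for all $i,k$, such that $\mathfrak G_0$ is generated by finitely many elements under composition with smooth functions, and $\mathfrak G_{k+1}$ is generated in the same sense by $\mathfrak G_k$ and all $D_i(\mathfrak G_k)$. ($F$ need not admit characteristics.) Let $f$ be a smooth $N$-valued function on an open set $W\subset M\times\mathbb R$ with $M\times\{0\}\subset W$, such that $$\partial_{a^0}f(x,a^0)=F\big(x,f(x,a^0),\partial^\sigma f(x,a^0)\big)\qquad\text{for }(x,a^0)\in W,\ a^0\ge 0.$$ Let $x_0\in M$, let $p_0$ be the infinite jet of $f(\cdot,0)$ at $x_0$, and let $i_0,\dots,i_h\in\{1,\dots,n\}$ and multi-indices $\sigma_0,\dots,\sigma_h$ be such that the $(h+1)\times(h+1)$ matrix with rows $$\big(D^{\sigma_k}(F^{i_k})(p_0),\,D^{\sigma_k}(G_1^{i_k})(p_0),\dots,D^{\sigma_k}(G_h^{i_k})(p_0)\big),\qquad k=0,\dots,h,$$ is nonsingular. Write $\mathbf\Phi_{(b^1,\dots,b^h)}=\Phi^h_{b^h}\circ\cdots\circ\Phi^1_{b^1}$,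 and $\mathbf\Phi_{\mathbf b}^x(p)$ for the base point of $\mathbf\Phi_{\mathbf b}(p)$. Then near $p_0$ there are smooth functions $a^0,\dots,a^h$ of finitely many coordinates, vanishing at $p_0$, with $$u^{i_k}_{\sigma_k}\big(\mathbf\Phi_{(a^1(p),\dots,a^h(p))}(p)\big)-\partial^{\sigma_k}f^{i_k}\big(\mathbf\Phi^x_{(a^1(p),\dots,a^h(p))}(p),a^0(p)\big)=0,\qquad k=0,\dots,h.$$ For any such functions, after shrinking the neighbourhood of $p_0$, let $\mathcal K$ be the set of its points $p$ at which $$u^{i}_{\sigma}\big(\mathbf\Phi_{(a^1(p),\dots,a^h(p))}(p)\big)-\partial^{\sigma}f^{i}\big(\mathbf\Phi^x_{(a^1(p),\dots,a^h(p))}(p),a^0(p)\big)=0\quad\text{for all } i,\sigma.$$ Then $(x^1,\dots,x^m,a^0,\dots,a^h)$ are coordinates on $\mathcal K$, onto an open neighbourhood of $(x_0,0)$; $$D_i(a^j)|_{\mathcal K}=0\qquad(1\le i\le m,\ 0\le j\le h);$$ and for $1\le i\le h$ $$V_{G_i}|_{\mathcal K}=\sum_{l=0}^h\phi_i^l(a^1,\dots,a^h)\,\partial_{a^l}$$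 with smooth functions $\phi_i^l$ (which depend neither on $x$ nor on $a^0$) such that, for all $0\le l\le h$ and $1\le i,k\le h$, $$\phi_i^l=-\delta_i^l\quad\text{where }a^1=\dots=a^{i-1}=0,$$ $$\partial_{a^k}\phi_i^l=-\sum_{p=1}^h\lambda_{k,i}^p\,\phi_p^l-\sum_{r<k}\phi_i^r\,\partial_{a^r}\phi_k^l\quad\text{where }a^1=\dots=a^{k-1}=0 .$$ In particular both hold where in addition $a^0=0$. -/

import Mathlib

open Set Filter Topology
open scoped ContDiff

namespace JetSPDE

/-- Labels of the coordinates of the infinite jet space of maps from `ℝ^m` to `ℝ^n`: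
`Sum.inl i` is the label of `x^i` and `Sum.inr (j, s)` the label of `u^j_s`, where `s` is a
multi-index. The coordinate `u^j` is `u^j_0`. -/
abbrev Coord (m n : ℕ) : Type := Fin m ⊕ (Fin n × (Fin m → ℕ))

/-- The infinite jet space of maps from `ℝ^m` to `ℝ^n`, with the product topology, which is the
inverse limit topology of the finite order jet spaces. -/
abbrev Jet (m n : ℕ) : Type := Coord m n → ℝ

/-- The base point `x` of a jet. -/
def xPart {m n : ℕ} (p : Jet m n) : Fin m → ℝ := fun i => p (Sum.inl i)

/-- The infinite jet space `J^∞(M, N)`, for `M ⊆ ℝ^m` and `N ⊆ ℝ^n`. -/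
def jetSpace {m n : ℕ} (M : Set (Fin m → ℝ)) (N : Set (Fin n → ℝ)) : Set (Jet m n) :=
  {p | xPart p ∈ M ∧ (fun j => p (Sum.inr (j, 0))) ∈ N}

/-- The algebra `𝔉` of an open set `U` of jets: the smooth functions on `U` that depend on a
finite number of coordinates only (values outside of `U` are irrelevant). -/
def smoothFns {m n : ℕ} (U : Set (Jet m n)) : Set (Jet m n → ℝ) :=
  {F | ∃ (S : Finset (Coord m n)) (g : (S → ℝ) → ℝ),
    ContDiffOn ℝ ∞ g ((fun p : Jet m n => S.restrict p) '' U) ∧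
      ∀ p ∈ U, F p = g (S.restrict p)}

/-- The action `X(F)` of a vector field on a function. A vector field `X` is given by its
components `X p c`, and on functions of finitely many coordinates `X(F) = ∑ X^c ∂_c F`, which is
the derivative of `F` at `p` in the direction `X p`. -/
noncomputable def act {m n : ℕ} (X : Jet m n → Jet m n) (F : Jet m n → ℝ) : Jet m n → ℝ :=
  fun p => lineDeriv ℝ F p (X p)

/-- The vector field `D_i = ∂_{x^i} + ∑ u^j_{s + 1_i} ∂_{u^j_s}`. -/
def totalField {m n : ℕ} (i : Fin m) : Jet m n → Jet m n := fun p =>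
  Sum.elim (Pi.single i 1) (fun js => p (Sum.inr (js.1, js.2 + Pi.single i 1)))

/-- The iterated total derivative `D^s(F)`, for a multi-index `s`. -/
noncomputable def totalDeriv {m n : ℕ} (s : Fin m → ℕ) (F : Jet m n → ℝ) : Jet m n → ℝ :=
  (List.finRange m).foldr (fun i T => (act (totalField i))^[s i] T) F

/-- The evolution vector field `V_G = ∑ D^s(G^j) ∂_{u^j_s}`. -/
noncomputable def evolField {m n : ℕ} (G : Fin n → Jet m n → ℝ) : Jet m n → Jet m n := fun p =>
  Sum.elim 0 (fun js => totalDeriv js.2 (G js.1) p)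

/-- The bracket of `𝔉^n`, for which `V_[F, G] = [V_F, V_G]`: its components are the `u^j`
components of the commutator `[V_F, V_G]`. -/
noncomputable def bracket {m n : ℕ} (F G : Fin n → Jet m n → ℝ) : Fin n → Jet m n → ℝ :=
  fun j p => act (evolField F) (G j) p - act (evolField G) (F j) p

/-- The vector field `V_G - ∑ η^i D_i`. -/
noncomputable def charField {m n : ℕ} (G : Fin n → Jet m n → ℝ) (η : Fin m → Jet m n → ℝ) :
    Jet m n → Jet m n :=
  fun p => evolField G p - ∑ i, η i p • totalField i p

/-- Smoothness of a function of a real parameter and of a jet, on a set `D`: near each point of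
`D` it is a smooth function of the parameter and of finitely many coordinates of the jet. -/
def ParamSmoothOn {m n : ℕ} (D : Set (ℝ × Jet m n)) (F : ℝ × Jet m n → ℝ) : Prop :=
  ∀ z ∈ D, ∃ (S : Finset (Coord m n)) (O : Set (ℝ × (S → ℝ))) (g : ℝ × (S → ℝ) → ℝ),
    IsOpen O ∧ (z.1, S.restrict z.2) ∈ O ∧ ContDiffOn ℝ ∞ g O ∧
      ∀ w ∈ D, (w.1, S.restrict w.2) ∈ O → F w = g (w.1, S.restrict w.2)

/-- `Φ` is the (local) flow of the vector field `X` of the open set `Ω` of jets, with flow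
domain `D`. -/
structure IsLocalFlow {m n : ℕ} (Ω : Set (Jet m n)) (X : Jet m n → Jet m n)
    (D : Set (ℝ × Jet m n)) (Φ : ℝ → Jet m n → Jet m n) : Prop where
  isOpen : IsOpen D
  zero_mem : ∀ p ∈ Ω, ((0 : ℝ), p) ∈ D
  ordConnected : ∀ p, {t : ℝ | (t, p) ∈ D}.OrdConnected
  mapsTo : ∀ t p, (t, p) ∈ D → p ∈ Ω ∧ Φ t p ∈ Ω
  zero : ∀ p ∈ Ω, Φ 0 p = p
  smooth : ∀ c, ParamSmoothOn D (fun z => Φ z.1 z.2 c)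
  ode : ∀ t p, (t, p) ∈ D → ∀ c, HasDerivAt (fun s => Φ s p c) (X (Φ t p) c) t

/-- The functions on `Ω` obtained from finitely many elements of `A` by composition with a smooth
function. -/
def smoothGen {m n : ℕ} (Ω : Set (Jet m n)) (A : Set (Jet m n → ℝ)) : Set (Jet m n → ℝ) :=
  {F | ∃ (r : ℕ) (g : Fin r → Jet m n → ℝ) (O : Set (Fin r → ℝ)) (H : (Fin r → ℝ) → ℝ),
    (∀ α, g α ∈ A) ∧ IsOpen O ∧ ContDiffOn ℝ ∞ H O ∧
      ∀ p ∈ Ω, (fun α => g α p) ∈ O ∧ F p = H (fun α => g α p)}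

/-- The filtration `𝔊_0 ⊆ 𝔊_1 ⊆ …` that starts with the algebra generated by `A`; `𝔊_{k+1}` is
generated by `𝔊_k` and by all `D_i(𝔊_k)`. -/
noncomputable def filtration {m n : ℕ} (Ω : Set (Jet m n)) (A : Set (Jet m n → ℝ)) :
    ℕ → Set (Jet m n → ℝ)
  | 0 => smoothGen Ω A
  | k + 1 => smoothGen Ω
      (filtration Ω A k ∪ ⋃ i : Fin m, act (totalField i) '' filtration Ω A k)

/-- The vector fields `X_i` admit a common filtration: some filtration that starts with a
finitely generated algebra exhausts `𝔉`, and all its members are mapped to themselves by all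
`X_i`. -/
def HasCommonFiltration {m n h : ℕ} (Ω : Set (Jet m n)) (X : Fin h → Jet m n → Jet m n) : Prop :=
  ∃ A : Set (Jet m n → ℝ), A.Finite ∧ A ⊆ smoothFns Ω ∧
    (∀ F ∈ smoothFns Ω, ∃ k, F ∈ filtration Ω A k) ∧
    ∀ i k, ∀ F ∈ filtration Ω A k, act (X i) F ∈ filtration Ω A k

/-- The iterated partial derivative `∂^s(g)`, for a multi-index `s`. -/
noncomputable def partialDeriv {m : ℕ} (s : Fin m → ℕ) (g : (Fin m → ℝ) → ℝ) :
    (Fin m → ℝ) → ℝ :=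
  (List.finRange m).foldr
    (fun i T => (fun (k : (Fin m → ℝ) → ℝ) x => fderiv ℝ k x (Pi.single i 1))^[s i] T) g

/-- The infinite jet at `x` of the map `g`. -/
noncomputable def jetOf {m n : ℕ} (g : (Fin m → ℝ) → Fin n → ℝ) (x : Fin m → ℝ) : Jet m n :=
  Sum.elim x (fun js => partialDeriv js.2 (fun y => g y js.1) x)

/-- The composed flow `p ↦ Φ^h_{b^h}(… (Φ^1_{b^1}(p)) …)`. -/
def composedFlow {m n h : ℕ} (Φ : Fin h → ℝ → Jet m n → Jet m n) (b : Fin h → ℝ)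
    (p : Jet m n) : Jet m n :=
  Fin.foldl h (fun q i => Φ i (b i) q) p

/-- For a vector `b = (b^0, b^1, …, b^h)` the difference of the coordinate `u^j_s` of the jet
`p' = Φ_{(b^1, …, b^h)}(p)` and of `∂^s f^j(x(p'), b^0)`. -/
noncomputable def defect {m n h : ℕ} (Φ : Fin h → ℝ → Jet m n → Jet m n)
    (f : (Fin m → ℝ) → ℝ → Fin n → ℝ) (b : Fin (h + 1) → ℝ) (p : Jet m n)
    (j : Fin n) (s : Fin m → ℕ) : ℝ :=
  composedFlow Φ (Fin.tail b) p (Sum.inr (j, s)) -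
    partialDeriv s (fun y => f y (b 0) j) (xPart (composedFlow Φ (Fin.tail b) p))

/-- `a = (a^0, …, a^h)` are smooth functions on the open neighbourhood `U` of `p₀` that vanish at
`p₀` and are implicitly defined by the `h + 1` equations with the labels `(idx k, mi k)`. -/
structure IsParamSystem {m n h : ℕ} (Φ : Fin h → ℝ → Jet m n → Jet m n)
    (f : (Fin m → ℝ) → ℝ → Fin n → ℝ) (idx : Fin (h + 1) → Fin n)
    (mi : Fin (h + 1) → Fin m → ℕ) (p₀ : Jet m n)
    (U : Set (Jet m n)) (a : Jet m n → Fin (h + 1) → ℝ) : Prop where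
  isOpen : IsOpen U
  mem : p₀ ∈ U
  smooth : ∀ l, (fun p => a p l) ∈ smoothFns U
  base : a p₀ = 0
  eqns : ∀ p ∈ U, ∀ k, defect Φ f (a p) p (idx k) (mi k) = 0

/-- The manifold `𝒦` in `U`: the common zeros of all the functions
`Φ_{(a^1, …, a^h)}^*(u^j_s) - ∂^s f^j(Φ^x_{(a^1, …, a^h)}, a^0)`. -/
def manifoldK {m n h : ℕ} (Φ : Fin h → ℝ → Jet m n → Jet m n)
    (f : (Fin m → ℝ) → ℝ → Fin n → ℝ) (U : Set (Jet m n))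
    (a : Jet m n → Fin (h + 1) → ℝ) : Set (Jet m n) :=
  {p ∈ U | ∀ j s, defect Φ f (a p) p j s = 0}

/-- `(x, a)` are coordinates of the set `K` of jets, with values in the open set `C`: they map
`K` bijectively to `C`, and the inverse map `κ` is smooth. -/
structure IsCoordSystem {m n h : ℕ} (K : Set (Jet m n)) (a : Jet m n → Fin (h + 1) → ℝ)
    (C : Set ((Fin m → ℝ) × (Fin (h + 1) → ℝ)))
    (κ : (Fin m → ℝ) × (Fin (h + 1) → ℝ) → Jet m n) : Prop where
  isOpen : IsOpen C
  image_eq : κ '' C = K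
  left_inv : ∀ z ∈ C, xPart (κ z) = z.1 ∧ a (κ z) = z.2
  smooth : ∀ c, ContDiffOn ℝ ∞ (fun z => κ z c) C

end JetSPDE

/-!
Write `p = ψ(x, b) = Φ^1_{-b^1} ∘ … ∘ Φ^h_{-b^h}(jet of f(·, b^0) at x)`. All defects vanish at `p` for
the parameters `b`, and near `p₀` the manifold `𝒦` is the image of this map `ψ` (`paramMap`). So the
theorem follows from a computation of the derivatives of `ψ`.

Modulo the total derivatives `D_r`, the derivative of `ψ` in the directions of `x` vanishes, since jets
of maps are tangent to the `D_r` (`fderiv_jetFam`), and this is preserved by characteristic flows. The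
derivative in the direction of `b^i` is `-V_{G_i}` transported by the flows that are applied afterwards.
A characteristic flow transports, modulo the `D_r`, combinations of the `V_{G_k}` with constant
coefficients to such combinations (`vert_pushDeriv`), and the coefficients are subject to the
exponential of `ad(G_i)`, a matrix made of the `λ_{ij}^k`. Hence the directions of `(b^1, …, b^h)` and
the fields `V_{G_1}, …, V_{G_h}` are related by a matrix (`coeffOp`) that depends on `(b^1, …, b^h)`
only. It is the identity at `0`, and its inverse gives the coefficients `φ_i^l` (`genCoeff`); the
coefficient of `∂_{a^0}` is `0`. The differential equation of the exponential yields the recursion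
(`genCoeff_recursion`), where the antisymmetry of the `λ_{ij}^k` is a consequence of the linear
independence of the `G_i` that is part of the nondegeneracy condition (`lam_antisymm`).

The jet space is not a Banach space, so solutions of differential equations need not be unique, and a
vector that solves the variational equation of a flow is not automatically determined by its initial
value. This is where the filtration is needed: each `𝔊_k` is finitely generated
(`filtration_generators`) and invariant, so in terms of the generators of a sufficiently large `𝔊_k` the
variational equation is a linear equation of finite dimension (`transport_eq_zero`). It follows that the
flow preserves its vector field, that `Φ_{-t}` inverts `Φ_t`, and the transport of the `V_{G_k}`.

The functions `a` come from the implicit function theorem, in finitely many coordinates of the jet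
(`exists_paramSystem`): the derivative of the defining equations at `p₀` is the matrix of the
nondegeneracy condition, up to the sign of the first column. Its local uniqueness shows that on the
image of `ψ` any such `a` equals `b`. Since `ψ` may move the base point, the coordinates of `𝒦` are
obtained from the local inverse of `(x, b) ↦ (base point of ψ(x, b), b)` (`exists_chart`).
-/

namespace JetSPDE

/-! ### Cylindrically smooth maps -/

section Cyl

variable {E E' E'' : Type} [AddCommGroup E] [Module ℝ E] [TopologicalSpace E]
  [AddCommGroup E'] [Module ℝ E'] [TopologicalSpace E']
  [AddCommGroup E''] [Module ℝ E''] [TopologicalSpace E'']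
  {Y Y' : Type} [NormedAddCommGroup Y] [NormedSpace ℝ Y]
  [NormedAddCommGroup Y'] [NormedSpace ℝ Y']
  {I : Type}

/-- Smoothness near a point for maps of topological vector spaces such as the jet space: after
composition with a continuous linear map to a normed space, the map `Q` is near `p` a smooth
function of a continuous linear image of its argument in a normed space. For functions on the jet
space this is smooth dependence on finitely many coordinates, for maps of normed spaces it is
ordinary smoothness near `p`. -/
def CylAt (Q : E → E') (p : E) : Prop :=
  ContinuousAt Q p ∧ ∀ (V : Type) (_ : NormedAddCommGroup V) (_ : NormedSpace ℝ V)
    (L : E' →L[ℝ] V), ∃ (V₁ : Type) (_ : NormedAddCommGroup V₁) (_ : NormedSpace ℝ V₁)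
      (L₁ : E →L[ℝ] V₁) (g : V₁ → V),
      (∀ᶠ y in 𝓝 (L₁ p), ContDiffAt ℝ ∞ g y) ∧ ∀ᶠ q in 𝓝 p, L (Q q) = g (L₁ q)

theorem CylAt.continuousAt {Q : E → E'} {p : E} (h : CylAt Q p) : ContinuousAt Q p := h.1

theorem CylAt.comp {R : E' → E''} {Q : E → E'} {p : E} (hR : CylAt R (Q p)) (hQ : CylAt Q p) :
    CylAt (fun q => R (Q q)) p := by
  refine ⟨ContinuousAt.comp (f := Q) hR.1 hQ.1, fun V i1 i2 L => ?_⟩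
  obtain ⟨V₁, _, _, L₁, g, hg, hLg⟩ := hR.2 V i1 i2 L
  obtain ⟨V₂, _, _, L₂, g₂, hg₂, hLg₂⟩ := hQ.2 V₁ _ _ L₁
  refine ⟨V₂, _, _, L₂, g ∘ g₂, ?_, ?_⟩
  · have h1 := hLg₂.self_of_nhds
    rw [h1] at hg
    have h2 := hg₂.self_of_nhds.continuousAt.eventually hg
    filter_upwards [hg₂, h2] with y hy hy'
    exact hy'.comp y hy
  · filter_upwards [hQ.1.eventually hLg, hLg₂] with q hq hq'
    rw [hq, hq', Function.comp]

theorem CylAt.congr {Q R : E → E'} {p : E} (hQ : CylAt Q p) (h : R =ᶠ[𝓝 p] Q) : CylAt R p := by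
  refine ⟨hQ.1.congr h.symm, fun V i1 i2 L => ?_⟩
  obtain ⟨V₁, _, _, L₁, g, hg, hLg⟩ := hQ.2 V i1 i2 L
  refine ⟨V₁, _, _, L₁, g, hg, ?_⟩
  filter_upwards [hLg, h] with q hq hq'
  rw [hq', hq]

theorem cylAt_clm (T : E →L[ℝ] E') (p : E) : CylAt (fun q => T q) p :=
  ⟨T.continuous.continuousAt, fun _ _ _ L =>
    ⟨_, _, _, L.comp T, id, Eventually.of_forall fun _ => contDiffAt_id,
      Eventually.of_forall fun _ => rfl⟩⟩

theorem cylAt_id (p : E) : CylAt (fun q : E => q) p := cylAt_clm (.id ℝ E) p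

theorem cylAt_const (c : E') (p : E) : CylAt (fun _ : E => c) p :=
  ⟨continuousAt_const, fun _ _ _ L =>
    ⟨ℝ, _, _, 0, fun _ => L c, Eventually.of_forall fun _ => contDiffAt_const,
      Eventually.of_forall fun _ => rfl⟩⟩

theorem cylAt_of_contDiffAt {f : Y → Y'} {y : Y} (h : ∀ᶠ z in 𝓝 y, ContDiffAt ℝ ∞ f z) :
    CylAt f y :=
  ⟨h.self_of_nhds.continuousAt, fun _ _ _ L =>
    ⟨Y, _, _, .id ℝ Y, fun z => L (f z), by
      filter_upwards [h] with z hz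
      exact L.contDiff.contDiffAt.comp z hz, Eventually.of_forall fun _ => rfl⟩⟩

theorem cylAt_of_contDiff {f : Y → Y'} {y : Y} (h : ContDiff ℝ ∞ f) : CylAt f y :=
  cylAt_of_contDiffAt (Eventually.of_forall fun _ => h.contDiffAt)

theorem CylAt.exists_rep {F : E → Y} {p : E} (h : CylAt F p) :
    ∃ (V₁ : Type) (_ : NormedAddCommGroup V₁) (_ : NormedSpace ℝ V₁) (L₁ : E →L[ℝ] V₁)
      (g : V₁ → Y), (∀ᶠ y in 𝓝 (L₁ p), ContDiffAt ℝ ∞ g y) ∧ ∀ᶠ q in 𝓝 p, F q = g (L₁ q) :=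
  h.2 Y _ _ (.id ℝ Y)

theorem cylAt_of_rep {F : E → Y} {p : E} {V : Type} [NormedAddCommGroup V] [NormedSpace ℝ V]
    (L : E →L[ℝ] V) {g : V → Y} (hg : ∀ᶠ y in 𝓝 (L p), ContDiffAt ℝ ∞ g y)
    (h : ∀ᶠ q in 𝓝 p, F q = g (L q)) : CylAt F p :=
  ((cylAt_of_contDiffAt hg).comp (cylAt_clm L p)).congr h

theorem CylAt.eventually {F : E → Y} {p : E} (h : CylAt F p) : ∀ᶠ q in 𝓝 p, CylAt F q := by
  obtain ⟨V₁, _, _, L₁, g, hg, hLg⟩ := h.exists_rep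
  filter_upwards [L₁.continuous.continuousAt.eventually hg.eventually_nhds,
    hLg.eventually_nhds] with q h1 h2
  exact cylAt_of_rep L₁ h1 h2

theorem CylAt.contDiffAt {f : Y → Y'} {y : Y} (h : CylAt f y) : ContDiffAt ℝ ∞ f y := by
  obtain ⟨V₁, _, _, L₁, g, hg, hLg⟩ := h.exists_rep
  exact (hg.self_of_nhds.comp y L₁.contDiff.contDiffAt).congr_of_eventuallyEq hLg

theorem CylAt.prodMk {Q : E → E'} {R : E → E''} {p : E} (hQ : CylAt Q p) (hR : CylAt R p) :
    CylAt (fun q => (Q q, R q)) p := by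
  refine ⟨hQ.1.prodMk hR.1, fun V i1 i2 L => ?_⟩
  obtain ⟨V₁, _, _, L₁, g, hg, hLg⟩ := hQ.2 V i1 i2 (L.comp (.inl ℝ E' E''))
  obtain ⟨V₂, _, _, L₂, g₂, hg₂, hLg₂⟩ := hR.2 V _ _ (L.comp (.inr ℝ E' E''))
  refine ⟨V₁ × V₂, _, _, L₁.prod L₂, fun y => g y.1 + g₂ y.2, ?_, ?_⟩
  · have := (hg.prod_inl_nhds (L₂ p)).and (hg₂.prod_inr_nhds (L₁ p))
    filter_upwards [this] with y hy
    exact (hy.1.comp y contDiffAt_fst).add (hy.2.comp y contDiffAt_snd)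
  · filter_upwards [hLg, hLg₂] with q hq hq'
    simp only [ContinuousLinearMap.comp_apply, ContinuousLinearMap.inl_apply,
      ContinuousLinearMap.inr_apply] at hq hq'
    simp only [ContinuousLinearMap.prod_apply, ← hq, ← hq', ← map_add, Prod.mk_add_mk, add_zero,
      zero_add]

/-- A continuous linear map from a product of lines to a normed space depends on finitely many
coordinates only. -/
theorem exists_finset_clm [DecidableEq I] (L : (I → ℝ) →L[ℝ] Y) :
    ∃ S : Finset I, ∀ v, L v = ∑ c ∈ S, v c • L (Pi.single c 1) := by
  have h1 : L ⁻¹' Metric.ball 0 1 ∈ 𝓝 (0 : I → ℝ) :=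
    L.continuous.continuousAt.preimage_mem_nhds (by simpa using Metric.ball_mem_nhds (0 : Y) one_pos)
  rw [nhds_pi, Filter.mem_pi] at h1
  obtain ⟨S, hS, t, ht, hsub⟩ := h1
  have key : ∀ v : I → ℝ, (∀ c ∈ S, v c = 0) → L v = 0 := by
    intro v hv
    by_contra hne
    have hm : (‖L v‖⁻¹ • v) ∈ L ⁻¹' Metric.ball 0 1 := by
      apply hsub
      intro c hc
      simp only [Pi.smul_apply, hv c hc, smul_zero]
      exact mem_of_mem_nhds (ht c)
    simp only [mem_preimage, map_smul, mem_ball_zero_iff, norm_smul, norm_inv, norm_norm] at hm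
    rw [inv_mul_cancel₀ (norm_ne_zero_iff.2 hne)] at hm
    exact lt_irrefl _ hm
  refine ⟨hS.toFinset, fun v => ?_⟩
  have h2 := key (v - ∑ c ∈ hS.toFinset, v c • Pi.single c (1 : ℝ)) (by
    intro d hd
    simp [Finset.sum_apply, Pi.single_apply, hd])
  rw [map_sub, sub_eq_zero] at h2
  rw [h2, map_sum]
  simp

theorem cylAt_pi {Q : E → I → ℝ} {p : E} (h : ∀ c, CylAt (fun q => Q q c) p) : CylAt Q p := by
  classical
  refine ⟨continuousAt_pi.2 fun c => (h c).1, fun V i1 i2 L => ?_⟩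
  obtain ⟨S, hS⟩ := exists_finset_clm L
  choose W j1 j2 K g hg hK using fun c => (h c).exists_rep
  refine ⟨∀ c : S, W c, inferInstance, inferInstance, ContinuousLinearMap.pi fun c : S => K c,
    fun y => ∑ c : S, g c (y c) • L (Pi.single (c : I) 1), ?_, ?_⟩
  · have : ∀ᶠ y : ∀ c : S, W c in 𝓝 (ContinuousLinearMap.pi (fun c : S => K c) p),
        ∀ c : S, ContDiffAt ℝ ∞ (g c) (y c) := by
      rw [eventually_all]
      intro c
      exact (continuous_apply c).continuousAt.eventually (hg c)
    filter_upwards [this] with y hy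
    refine ContDiffAt.sum fun c _ => ?_
    exact ((hy c).comp y (ContinuousLinearMap.proj (R := ℝ) (φ := fun c : S => W c) c).contDiff.contDiffAt).smul contDiffAt_const
  · have : ∀ᶠ q in 𝓝 p, ∀ c : S, Q q c = g c (K c q) := by
      rw [eventually_all]
      exact fun c => hK c
    filter_upwards [this] with q hq
    rw [hS, ← Finset.sum_coe_sort]
    exact Finset.sum_congr rfl fun c _ => by rw [hq c]; rfl

theorem CylAt.apply {Q : E → I → ℝ} {p : E} (h : CylAt Q p) (c : I) :
    CylAt (fun q => Q q c) p :=
  (cylAt_clm (ContinuousLinearMap.proj (R := ℝ) (φ := fun _ : I => ℝ) c) _).comp h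

theorem cylAt_coord (c : I) (p : I → ℝ) : CylAt (fun q : I → ℝ => q c) p := (cylAt_id p).apply c

theorem CylAt.fst {Q : E → E' × E''} {p : E} (h : CylAt Q p) : CylAt (fun q => (Q q).1) p :=
  (cylAt_clm (.fst ℝ E' E'') _).comp h

theorem CylAt.snd {Q : E → E' × E''} {p : E} (h : CylAt Q p) : CylAt (fun q => (Q q).2) p :=
  (cylAt_clm (.snd ℝ E' E'') _).comp h

theorem CylAt.add {F H : E → Y} {p : E} (hF : CylAt F p) (hH : CylAt H p) :
    CylAt (fun q => F q + H q) p :=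
  (cylAt_of_contDiff (f := fun z : Y × Y => z.1 + z.2) (by fun_prop)).comp (hF.prodMk hH)

theorem CylAt.sub {F H : E → Y} {p : E} (hF : CylAt F p) (hH : CylAt H p) :
    CylAt (fun q => F q - H q) p :=
  (cylAt_of_contDiff (f := fun z : Y × Y => z.1 - z.2) (by fun_prop)).comp (hF.prodMk hH)

theorem CylAt.neg {F : E → Y} {p : E} (hF : CylAt F p) : CylAt (fun q => -F q) p :=
  (cylAt_of_contDiff (f := fun z : Y => -z) (by fun_prop)).comp hF

theorem CylAt.mul {F H : E → ℝ} {p : E} (hF : CylAt F p) (hH : CylAt H p) :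
    CylAt (fun q => F q * H q) p :=
  (cylAt_of_contDiff (f := fun z : ℝ × ℝ => z.1 * z.2) (by fun_prop)).comp (hF.prodMk hH)

theorem CylAt.sum {ι : Type} (s : Finset ι) {F : ι → E → ℝ} {p : E}
    (h : ∀ i ∈ s, CylAt (F i) p) : CylAt (fun q => ∑ i ∈ s, F i q) p := by
  classical
  induction s using Finset.induction_on with
  | empty => simpa using cylAt_const (0 : ℝ) p
  | insert a s ha ih =>
    simp only [Finset.sum_insert ha]
    exact (h a (by simp)).add (ih fun i hi => h i (by simp [hi]))

/-! ### Directional derivatives of cylindrically smooth functions -/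

section
variable [IsTopologicalAddGroup E] [ContinuousSMul ℝ E]

theorem eventually_line {P : E → Prop} {p : E} (h : ∀ᶠ q in 𝓝 p, P q) (v : E) :
    ∀ᶠ t in 𝓝 (0 : ℝ), P (p + t • v) := by
  have : ContinuousAt (fun t : ℝ => p + t • v) 0 := by fun_prop
  apply this.eventually
  simpa using h

theorem lineDeriv_congr {F H : E → Y} {p : E} (h : F =ᶠ[𝓝 p] H) (v : E) :
    lineDeriv ℝ F p v = lineDeriv ℝ H p v :=
  Filter.EventuallyEq.deriv_eq (eventually_line h v)

theorem hasLineDerivAt_of_rep {F : E → Y} {p : E} {V : Type} [NormedAddCommGroup V]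
    [NormedSpace ℝ V] (L : E →L[ℝ] V) {g : V → Y} (hg : ContDiffAt ℝ ∞ g (L p))
    (h : ∀ᶠ q in 𝓝 p, F q = g (L q)) (v : E) :
    HasLineDerivAt ℝ F (fderiv ℝ g (L p) (L v)) p v := by
  have h1 : HasDerivAt (fun t : ℝ => L p + t • L v) (L v) 0 := by
    simpa using ((hasDerivAt_id (0 : ℝ)).smul_const (L v)).const_add (L p)
  have h2 : HasFDerivAt g (fderiv ℝ g (L p)) (L p + (0 : ℝ) • L v) := by
    simpa using (hg.differentiableAt (by simp)).hasFDerivAt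
  have h3 := h2.comp_hasDerivAt (0 : ℝ) h1
  refine h3.congr_of_eventuallyEq ?_
  filter_upwards [eventually_line h v] with t ht
  simp [ht]

theorem CylAt.exists_clm {F : E → Y} {p : E} (h : CylAt F p) :
    ∃ A : E →L[ℝ] Y, ∀ v, HasLineDerivAt ℝ F (A v) p v := by
  obtain ⟨V₁, _, _, L₁, g, hg, hLg⟩ := h.exists_rep
  exact ⟨(fderiv ℝ g (L₁ p)).comp L₁, fun v => hasLineDerivAt_of_rep L₁ hg.self_of_nhds hLg v⟩

theorem CylAt.lineDeriv_clm {F : E → Y} {p : E} (h : CylAt F p) :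
    ∃ A : E →L[ℝ] Y, ∀ v, lineDeriv ℝ F p v = A v := by
  obtain ⟨A, hA⟩ := h.exists_clm
  exact ⟨A, fun v => (hA v).lineDeriv⟩

theorem CylAt.lineDeriv_sub {F : E → Y} {p : E} (h : CylAt F p) (v w : E) :
    lineDeriv ℝ F p (v - w) = lineDeriv ℝ F p v - lineDeriv ℝ F p w := by
  obtain ⟨A, hA⟩ := h.lineDeriv_clm
  simp [hA]

theorem CylAt.lineDeriv_smul {F : E → Y} {p : E} (h : CylAt F p) (a : ℝ) (v : E) :
    lineDeriv ℝ F p (a • v) = a • lineDeriv ℝ F p v := by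
  obtain ⟨A, hA⟩ := h.lineDeriv_clm
  simp [hA]

theorem CylAt.lineDeriv_sum {ι : Type} (s : Finset ι) {F : E → Y} {p : E} (h : CylAt F p)
    (v : ι → E) :
    lineDeriv ℝ F p (∑ i ∈ s, v i) = ∑ i ∈ s, lineDeriv ℝ F p (v i) := by
  obtain ⟨A, hA⟩ := h.lineDeriv_clm
  simp [hA]

theorem CylAt.lineDeriv_zero {F : E → Y} {p : E} (h : CylAt F p) : lineDeriv ℝ F p 0 = 0 := by
  obtain ⟨A, hA⟩ := h.lineDeriv_clm
  simp [hA]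

/-- The tangent map of a cylindrically smooth function is cylindrically smooth. -/
theorem CylAt.tangent {F : E → Y} {p : E} (h : CylAt F p) (v : E) :
    CylAt (fun z : E × E => lineDeriv ℝ F z.1 z.2) (p, v) := by
  obtain ⟨V₁, _, _, L₁, g, hg, hLg⟩ := h.exists_rep
  refine cylAt_of_rep (L₁.prodMap L₁) (g := fun z => fderiv ℝ g z.1 z.2) ?_ ?_
  · filter_upwards [hg.prod_inl_nhds (L₁ v)] with z hz
    exact ((hz.fderiv_right (m := ∞) (by simp)).comp z contDiffAt_fst).clm_apply contDiffAt_snd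
  · have h1 : ∀ᶠ q in 𝓝 p, ∀ w, lineDeriv ℝ F q w = fderiv ℝ g (L₁ q) (L₁ w) := by
      filter_upwards [L₁.continuous.continuousAt.eventually hg, hLg.eventually_nhds] with q h1 h2 w
      exact (hasLineDerivAt_of_rep L₁ h1 h2 w).lineDeriv
    filter_upwards [h1.prod_inl_nhds v] with z hz
    exact hz _

end

theorem hasDerivAt_clm_comp (L : (I → ℝ) →L[ℝ] Y) {q : ℝ → I → ℝ} {v : I → ℝ} {s : ℝ}
    (hq : ∀ c, HasDerivAt (fun s => q s c) (v c) s) :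
    HasDerivAt (fun s => L (q s)) (L v) s := by
  classical
  obtain ⟨S, hS⟩ := exists_finset_clm L
  rw [hS v, funext fun s => hS (q s)]
  exact HasDerivAt.fun_sum fun c _ => (hq c).smul_const _

/-- The chain rule along a path in a product of lines that is differentiable componentwise. -/
theorem CylAt.hasDerivAt_comp {F : (I → ℝ) → Y} {q : ℝ → I → ℝ} {v : I → ℝ} {s : ℝ}
    (hF : CylAt F (q s)) (hq : ∀ c, HasDerivAt (fun s => q s c) (v c) s) :
    HasDerivAt (fun s => F (q s)) (lineDeriv ℝ F (q s) v) s := by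
  obtain ⟨V₁, _, _, L₁, g, hg, hLg⟩ := hF.exists_rep
  have hc : ContinuousAt q s := continuousAt_pi.2 fun c => (hq c).continuousAt
  rw [(hasLineDerivAt_of_rep L₁ hg.self_of_nhds hLg v).lineDeriv]
  exact ((hg.self_of_nhds.differentiableAt (by simp)).hasFDerivAt.comp_hasDerivAt s
    (hasDerivAt_clm_comp L₁ hq)).congr_of_eventuallyEq (hc.eventually hLg)

theorem hasDerivAt_line (p v : I → ℝ) (c : I) (t : ℝ) :
    HasDerivAt (fun t : ℝ => (p + t • v) c) (v c) t := by
  simpa using ((hasDerivAt_id t).mul_const (v c)).const_add (p c)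

theorem CylAt.hasLineDerivAt {F : (I → ℝ) → Y} {p : I → ℝ} (h : CylAt F p) (v : I → ℝ) :
    HasLineDerivAt ℝ F (lineDeriv ℝ F p v) p v := by
  obtain ⟨A, hA⟩ := h.exists_clm
  rw [(hA v).lineDeriv]
  exact hA v

/-- The commutator of two vector fields acts as a vector field, the components of which are the
commutators of the components. -/
theorem CylAt.commutator {F : (I → ℝ) → ℝ} {X Z : (I → ℝ) → I → ℝ} {p : I → ℝ}
    (hF : CylAt F p) (hX : CylAt X p) (hZ : CylAt Z p) :
    lineDeriv ℝ (fun q => lineDeriv ℝ F q (Z q)) p (X p) -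
      lineDeriv ℝ (fun q => lineDeriv ℝ F q (X q)) p (Z p) =
    lineDeriv ℝ F p (fun c => lineDeriv ℝ (fun q => Z q c) p (X p) -
      lineDeriv ℝ (fun q => X q c) p (Z p)) := by
  obtain ⟨V₁, _, _, L, g, hg, hLg⟩ := hF.exists_rep
  have h1 : ∀ᶠ q in 𝓝 p, ∀ w, lineDeriv ℝ F q w = fderiv ℝ g (L q) (L w) := by
    filter_upwards [L.continuous.continuousAt.eventually hg, hLg.eventually_nhds] with q h1 h2 w
    exact (hasLineDerivAt_of_rep L h1 h2 w).lineDeriv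
  have key : ∀ (X Z : (I → ℝ) → I → ℝ), CylAt Z p →
      lineDeriv ℝ (fun q => lineDeriv ℝ F q (Z q)) p (X p) =
        fderiv ℝ (fderiv ℝ g) (L p) (L (X p)) (L (Z p)) +
          fderiv ℝ g (L p) (L fun c => lineDeriv ℝ (fun q => Z q c) p (X p)) := by
    intro X Z hZ
    have hl : HasDerivAt (fun t : ℝ => L (p + t • X p)) (L (X p)) 0 :=
      hasDerivAt_clm_comp L (hasDerivAt_line p (X p) · 0)
    have h2 : HasDerivAt (fun t : ℝ => L (Z (p + t • X p)))
        (L fun c => lineDeriv ℝ (fun q => Z q c) p (X p)) 0 :=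
      hasDerivAt_clm_comp L fun c => (hZ.apply c).hasLineDerivAt (X p)
    have hg2 : DifferentiableAt ℝ (fderiv ℝ g) (L (p + (0 : ℝ) • X p)) := by
      simpa using ((hg.self_of_nhds.fderiv_right (m := ∞) (by simp)).differentiableAt (by simp))
    have h3 : HasDerivAt (fun t : ℝ => fderiv ℝ g (L (p + t • X p)))
        (fderiv ℝ (fderiv ℝ g) (L p) (L (X p))) 0 := by
      have := hg2.hasFDerivAt.comp_hasDerivAt (0 : ℝ) hl
      rwa [zero_smul, add_zero] at this
    have h4 := h3.clm_apply h2
    rw [zero_smul, add_zero] at h4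
    refine (HasDerivAt.congr_of_eventuallyEq h4 ?_).deriv
    filter_upwards [eventually_line h1 (X p)] with t ht
    rw [ht]
  have hsymm : IsSymmSndFDerivAt ℝ g (L p) :=
    hg.self_of_nhds.isSymmSndFDerivAt (by
      rw [minSmoothness_of_isRCLikeNormedField]
      exact WithTop.coe_le_coe.2 (le_top : (2 : ℕ∞) ≤ ⊤))
  rw [key X Z hZ, key Z X hX, h1.self_of_nhds, hsymm.eq (L (X p)) (L (Z p))]
  rw [add_sub_add_left_eq_sub, ← map_sub, ← map_sub]
  rfl

end Cyl

/-! ### Iterated operators with a multi-index -/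

section MultiIter

variable {m : ℕ} {A B α β : Type}

/-- The composition of the powers `(T i)^(s i)`, taken over the entries `i` of a list. -/
def listIter (T : Fin m → A → A) (l : List (Fin m)) (s : Fin m → ℕ) (a : A) : A :=
  l.foldr (fun i b => (T i)^[s i] b) a

/-- The composition of the powers `(T i)^(s i)`. The operators `D^s` and `∂^s` are of this kind. -/
def multiIter (T : Fin m → A → A) (s : Fin m → ℕ) (a : A) : A :=
  listIter T (List.finRange m) s a

theorem iterate_mem {T : A → A} {S : Set A} (h : ∀ a ∈ S, T a ∈ S) (k : ℕ) {a : A} (ha : a ∈ S) :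
    T^[k] a ∈ S := by
  induction k with
  | zero => exact ha
  | succ k ih => rw [Function.iterate_succ_apply']; exact h _ ih

theorem listIter_mem {T : Fin m → A → A} {S : Set A} (h : ∀ i, ∀ a ∈ S, T i a ∈ S)
    (l : List (Fin m)) (s : Fin m → ℕ) {a : A} (ha : a ∈ S) : listIter T l s a ∈ S := by
  induction l with
  | nil => exact ha
  | cons i l ih => exact iterate_mem (h i) _ ih

theorem multiIter_mem {T : Fin m → A → A} {S : Set A} (h : ∀ i, ∀ a ∈ S, T i a ∈ S)
    (s : Fin m → ℕ) {a : A} (ha : a ∈ S) : multiIter T s a ∈ S :=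
  listIter_mem h _ s ha

theorem multiIter_zero (T : Fin m → A → A) (a : A) : multiIter T 0 a = a := by
  unfold multiIter
  induction List.finRange m with
  | nil => rfl
  | cons i l ih => exact ih

theorem iterate_congr {T : (α → ℝ) → α → ℝ} {U : Set α}
    (h : ∀ F H, EqOn F H U → EqOn (T F) (T H) U) (k : ℕ) {F H : α → ℝ} (hFH : EqOn F H U) :
    EqOn (T^[k] F) (T^[k] H) U := by
  induction k with
  | zero => exact hFH
  | succ k ih => rw [Function.iterate_succ_apply', Function.iterate_succ_apply']; exact h _ _ ih

theorem multiIter_congr {T : Fin m → (α → ℝ) → α → ℝ} {U : Set α}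
    (h : ∀ i F H, EqOn F H U → EqOn (T i F) (T i H) U) (s : Fin m → ℕ) {F H : α → ℝ}
    (hFH : EqOn F H U) : EqOn (multiIter T s F) (multiIter T s H) U := by
  unfold multiIter
  induction List.finRange m with
  | nil => exact hFH
  | cons i l ih => exact iterate_congr (h i) _ ih

theorem iterate_intertwine {T : A → A} {T' : (β → ℝ) → β → ℝ} {U : Set β} {S : Set A}
    (hmem : ∀ a ∈ S, T a ∈ S) (hcongr : ∀ F H, EqOn F H U → EqOn (T' F) (T' H) U)
    (R : A → β → ℝ) (hR : ∀ a ∈ S, EqOn (R (T a)) (T' (R a)) U) (k : ℕ) {a : A} (ha : a ∈ S) :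
    EqOn (R (T^[k] a)) (T'^[k] (R a)) U := by
  induction k with
  | zero => exact fun _ _ => rfl
  | succ k ih =>
    rw [Function.iterate_succ_apply', Function.iterate_succ_apply']
    exact (hR _ (iterate_mem hmem k ha)).trans (hcongr _ _ ih)

/-- An operator that intertwines `T i` and `T' i` for all `i` intertwines their iterates. -/
theorem multiIter_intertwine {T : Fin m → A → A} {T' : Fin m → (β → ℝ) → β → ℝ} {U : Set β}
    {S : Set A} (hmem : ∀ i, ∀ a ∈ S, T i a ∈ S)
    (hcongr : ∀ i F H, EqOn F H U → EqOn (T' i F) (T' i H) U)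
    (R : A → β → ℝ) (hR : ∀ i, ∀ a ∈ S, EqOn (R (T i a)) (T' i (R a)) U) (s : Fin m → ℕ)
    {a : A} (ha : a ∈ S) : EqOn (R (multiIter T s a)) (multiIter T' s (R a)) U := by
  unfold multiIter
  induction List.finRange m with
  | nil => exact fun _ _ => rfl
  | cons i l ih =>
    exact (iterate_intertwine (hmem i) (hcongr i) R (hR i) (s i) (listIter_mem hmem l s ha)).trans
      (iterate_congr (hcongr i) _ ih)

theorem listIter_single_of_notMem (T : Fin m → A → A) {l : List (Fin m)} {i : Fin m} (hi : i ∉ l)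
    (s : Fin m → ℕ) (a : A) : listIter T l (s + Pi.single i 1) a = listIter T l s a := by
  induction l with
  | nil => rfl
  | cons j l ih =>
    simp only [List.mem_cons, not_or] at hi
    have hj : (s + Pi.single i 1 : Fin m → ℕ) j = s j := by simp [Ne.symm hi.1]
    change (T j)^[_] (listIter T l _ a) = (T j)^[_] (listIter T l s a)
    rw [hj, ih hi.2]

/-- For operators that commute on a class `S` of functions, an additional application of `T i`
raises the multi-index. -/
theorem multiIter_succ {T : Fin m → (α → ℝ) → α → ℝ} {U : Set α} {S : Set (α → ℝ)}
    (hmem : ∀ i, ∀ a ∈ S, T i a ∈ S)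
    (hcongr : ∀ i F H, EqOn F H U → EqOn (T i F) (T i H) U)
    (hcomm : ∀ i j, ∀ F ∈ S, EqOn (T i (T j F)) (T j (T i F)) U) (i : Fin m) (s : Fin m → ℕ)
    {F : α → ℝ} (hF : F ∈ S) :
    EqOn (T i (multiIter T s F)) (multiIter T (s + Pi.single i 1) F) U := by
  have key : ∀ l : List (Fin m), l.Nodup → i ∈ l →
      EqOn (T i (listIter T l s F)) (listIter T l (s + Pi.single i 1) F) U := by
    intro l
    induction l with
    | nil => simp
    | cons j l ih =>
      intro hl hi
      rw [List.nodup_cons] at hl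
      change EqOn (T i ((T j)^[_] (listIter T l s F))) ((T j)^[_] (listIter T l _ F)) U
      rcases eq_or_ne i j with rfl | hij
      · rw [listIter_single_of_notMem T hl.1, Pi.add_apply, Pi.single_eq_same,
          Function.iterate_succ_apply']
        exact fun _ _ => rfl
      · have hj : (s + Pi.single i 1 : Fin m → ℕ) j = s j := by simp [Ne.symm hij]
        rw [hj]
        refine (iterate_intertwine (hmem j) (hcongr j) (T i) (hcomm i j) (s j)
          (listIter_mem hmem l s hF)).trans (iterate_congr (hcongr j) _ (ih hl.2 ?_))
        simpa [hij] using hi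
  exact key _ (List.nodup_finRange m) (List.mem_finRange i)

end MultiIter

/-! ### Vector fields on the jet space -/

section Fields

variable {m n : ℕ} {Ω : Set (Jet m n)}

/-- The functions that are smooth functions of finitely many coordinates near each point of `Ω`. -/
def LocSmooth (Ω : Set (Jet m n)) : Set (Jet m n → ℝ) := {F | ∀ p ∈ Ω, CylAt F p}

theorem smoothFns_subset (hΩ : IsOpen Ω) : smoothFns Ω ⊆ LocSmooth Ω := by
  classical
  rintro F ⟨S, g, hg, hF⟩ p hp
  have himg : ∀ q ∈ Ω, (fun p : Jet m n => S.restrict p) '' Ω ∈ 𝓝 (S.restrict q) := by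
    intro q hq
    -- modify `q` on the coordinates of `S` only
    let e : (S → ℝ) → Jet m n := fun y c => if h : c ∈ S then y ⟨c, h⟩ else q c
    have he : Continuous e := by
      refine continuous_pi fun c => ?_
      by_cases h : c ∈ S
      · simpa [e, h] using continuous_apply _
      · simpa [e, h] using continuous_const
    have heq : e (S.restrict q) = q := by
      funext c
      by_cases h : c ∈ S <;> simp [e, h]
    have : e ⁻¹' Ω ∈ 𝓝 (S.restrict q) :=
      he.continuousAt.preimage_mem_nhds (by rw [heq]; exact hΩ.mem_nhds hq)
    refine mem_of_superset this fun y hy => ⟨e y, hy, ?_⟩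
    funext c
    simp [e]
  let L : Jet m n →L[ℝ] (S → ℝ) := ContinuousLinearMap.pi fun c : S => .proj (c : Coord m n)
  refine cylAt_of_rep L (g := g) ?_ ?_
  · have h1 := himg p hp
    have h2 : (fun p : Jet m n => S.restrict p) '' Ω ∈ 𝓝 (L p) := h1
    rw [← eventually_mem_nhds_iff] at h2
    filter_upwards [h2] with y hy
    exact hg.contDiffAt hy
  · filter_upwards [hΩ.mem_nhds hp] with q hq
    exact hF q hq

theorem coord_mem_smoothFns (c : Coord m n) : (fun p : Jet m n => p c) ∈ smoothFns Ω :=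
  ⟨{c}, fun y => y ⟨c, by simp⟩, (contDiff_apply ℝ ℝ _).contDiffOn, fun _ _ => rfl⟩

theorem coord_mem_locSmooth (c : Coord m n) : (fun p : Jet m n => p c) ∈ LocSmooth Ω :=
  fun p _ => cylAt_coord c p

theorem CylAt.act {F : Jet m n → ℝ} {X : Jet m n → Jet m n} {p : Jet m n} (hF : CylAt F p)
    (hX : CylAt X p) : CylAt (act X F) p :=
  CylAt.comp (Q := fun q => (q, X q)) (hF.tangent (X p)) ((cylAt_id p).prodMk hX)

theorem act_congr (hΩ : IsOpen Ω) (X : Jet m n → Jet m n) {F H : Jet m n → ℝ} (h : EqOn F H Ω) :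
    EqOn (act X F) (act X H) Ω := fun p hp =>
  lineDeriv_congr (by filter_upwards [hΩ.mem_nhds hp] with q hq using h hq) _

theorem lineDeriv_coord (c : Coord m n) (p v : Jet m n) :
    lineDeriv ℝ (fun q : Jet m n => q c) p v = v c :=
  (hasDerivAt_line p v c 0).deriv

theorem act_coord (X : Jet m n → Jet m n) (c : Coord m n) : act X (fun q => q c) = fun q => X q c :=
  funext fun p => lineDeriv_coord c p _

theorem act_const (X : Jet m n → Jet m n) (a : ℝ) (p : Jet m n) : act X (fun _ => a) p = 0 := by
  simp [act, lineDeriv]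

theorem act_mul (X : Jet m n → Jet m n) {F H : Jet m n → ℝ} {p : Jet m n} (hF : CylAt F p)
    (hH : CylAt H p) : act X (fun q => F q * H q) p = act X F p * H p + F p * act X H p := by
  have := (HasDerivAt.fun_mul (hF.hasLineDerivAt (X p)) (hH.hasLineDerivAt (X p))).deriv
  rwa [zero_smul, add_zero] at this

theorem act_sub (X : Jet m n → Jet m n) {F H : Jet m n → ℝ} {p : Jet m n} (hF : CylAt F p)
    (hH : CylAt H p) : act X (fun q => F q - H q) p = act X F p - act X H p :=
  (HasDerivAt.sub (hF.hasLineDerivAt (X p)) (hH.hasLineDerivAt (X p))).deriv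

theorem act_sum {ι : Type} (s : Finset ι) (X : Jet m n → Jet m n) {F : ι → Jet m n → ℝ}
    {p : Jet m n} (hF : ∀ i ∈ s, CylAt (F i) p) :
    act X (fun q => ∑ i ∈ s, F i q) p = ∑ i ∈ s, act X (F i) p :=
  (HasDerivAt.fun_sum fun i hi => (hF i hi).hasLineDerivAt (X p)).deriv

theorem act_const_mul (X : Jet m n → Jet m n) (a : ℝ) {F : Jet m n → ℝ} {p : Jet m n}
    (hF : CylAt F p) : act X (fun q => a * F q) p = a * act X F p := by
  rw [act_mul X (cylAt_const a p) hF, act_const]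
  ring

theorem act_commutator {F : Jet m n → ℝ} {X Z : Jet m n → Jet m n} {p : Jet m n}
    (hF : CylAt F p) (hX : CylAt X p) (hZ : CylAt Z p) :
    act X (act Z F) p - act Z (act X F) p =
      lineDeriv ℝ F p (fun c => act X (fun q => Z q c) p - act Z (fun q => X q c) p) :=
  hF.commutator hX hZ

theorem cylAt_totalField (i : Fin m) (p : Jet m n) : CylAt (totalField i) p := by
  refine cylAt_pi fun c => ?_
  rcases c with r | ⟨j, s⟩
  · exact cylAt_const _ p
  · exact cylAt_coord _ p

theorem totalField_act_mem (i : Fin m) {F : Jet m n → ℝ} (hF : F ∈ LocSmooth Ω) :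
    act (totalField i) F ∈ LocSmooth Ω :=
  fun p hp => (hF p hp).act (cylAt_totalField i p)

theorem totalField_comm (i j : Fin m) {F : Jet m n → ℝ} {p : Jet m n} (hF : CylAt F p) :
    act (totalField i) (act (totalField j) F) p = act (totalField j) (act (totalField i) F) p := by
  rw [← sub_eq_zero, act_commutator hF (cylAt_totalField i p) (cylAt_totalField j p)]
  convert hF.lineDeriv_zero using 2
  funext c
  rcases c with r | ⟨k, s⟩
  · simp [totalField, act_const]
  · simp only [totalField, Sum.elim_inr, act_coord, Pi.zero_apply]
    rw [add_right_comm, sub_self]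

theorem totalDeriv_mem (s : Fin m → ℕ) {F : Jet m n → ℝ} (hF : F ∈ LocSmooth Ω) :
    totalDeriv s F ∈ LocSmooth Ω :=
  multiIter_mem (T := fun i => act (totalField i)) (fun _ _ h => totalField_act_mem _ h) s hF

theorem totalDeriv_congr (hΩ : IsOpen Ω) (s : Fin m → ℕ) {F H : Jet m n → ℝ} (h : EqOn F H Ω) :
    EqOn (totalDeriv s F) (totalDeriv s H) Ω :=
  multiIter_congr (T := fun i => act (totalField i)) (fun _ _ _ => act_congr hΩ _) s h

theorem totalDeriv_succ (hΩ : IsOpen Ω) (i : Fin m) (s : Fin m → ℕ) {F : Jet m n → ℝ}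
    (hF : F ∈ LocSmooth Ω) :
    EqOn (act (totalField i) (totalDeriv s F)) (totalDeriv (s + Pi.single i 1) F) Ω :=
  multiIter_succ (T := fun i => act (totalField i)) (fun _ _ h => totalField_act_mem _ h)
    (fun _ _ _ => act_congr hΩ _) (fun i j _ h p hp => totalField_comm i j (h p hp)) i s hF

theorem totalDeriv_sum (hΩ : IsOpen Ω) {ι : Type} [Fintype ι] (a : ι → ℝ) (s : Fin m → ℕ)
    {F : ι → Jet m n → ℝ} (hF : ∀ k, F k ∈ LocSmooth Ω) :
    EqOn (totalDeriv s (fun p => ∑ k, a k * F k p)) (fun p => ∑ k, a k * totalDeriv s (F k) p)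
      Ω := by
  let T : Fin m → (ι → Jet m n → ℝ) → ι → Jet m n → ℝ := fun i H k => act (totalField i) (H k)
  have h1 := multiIter_intertwine (T := T) (T' := fun i => act (totalField i)) (U := Ω)
    (S := {H | ∀ k, H k ∈ LocSmooth Ω}) (fun i H h k => totalField_act_mem i (h k))
    (fun _ _ _ => act_congr hΩ _) (fun H p => ∑ k, a k * H k p) (fun i H h p hp => by
      simp only [T]
      rw [act_sum _ _ fun k _ => (cylAt_const (a k) p).mul (h k p hp)]
      exact Finset.sum_congr rfl fun k _ => (act_const_mul _ _ (h k p hp)).symm) s hF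
  have h2 : ∀ k, multiIter T s F k = totalDeriv s (F k) := fun k => by
    have := multiIter_intertwine (T := T) (T' := fun i => act (totalField i)) (U := univ)
      (S := univ) (fun i H h => trivial) (fun i H H' h => by
        rw [eqOn_univ] at h; rw [h]; exact fun _ _ => rfl) (fun H => H k)
      (fun i H _ p _ => rfl) s (a := F) trivial
    exact funext fun p => this (mem_univ p)
  intro p hp
  refine (h1 hp).symm.trans ?_
  exact Finset.sum_congr rfl fun k _ => by rw [h2]

theorem cylAt_evolField {G : Fin n → Jet m n → ℝ} (hG : ∀ j, G j ∈ LocSmooth Ω) {p : Jet m n}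
    (hp : p ∈ Ω) : CylAt (evolField G) p := by
  refine cylAt_pi fun c => ?_
  rcases c with r | ⟨j, s⟩
  · exact cylAt_const _ p
  · exact totalDeriv_mem s (hG j) p hp

/-- Evolution fields commute with the total derivatives. -/
theorem evolField_comm_totalField (hΩ : IsOpen Ω) {G : Fin n → Jet m n → ℝ}
    (hG : ∀ j, G j ∈ LocSmooth Ω) (i : Fin m) {F : Jet m n → ℝ} (hF : F ∈ LocSmooth Ω) :
    EqOn (act (evolField G) (act (totalField i) F)) (act (totalField i) (act (evolField G) F))
      Ω := by
  intro p hp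
  rw [← sub_eq_zero, act_commutator (hF p hp) (cylAt_evolField hG hp) (cylAt_totalField i p)]
  convert (hF p hp).lineDeriv_zero using 2
  funext c
  rcases c with r | ⟨j, s⟩
  · simp [totalField, evolField, act_const]
  · simp only [totalField, evolField, Sum.elim_inr, act_coord, Pi.zero_apply]
    rw [sub_eq_zero]
    exact (totalDeriv_succ hΩ i s (hG j) hp).symm

theorem evolField_act_mem {G : Fin n → Jet m n → ℝ} (hG : ∀ j, G j ∈ LocSmooth Ω)
    {F : Jet m n → ℝ} (hF : F ∈ LocSmooth Ω) : act (evolField G) F ∈ LocSmooth Ω :=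
  fun p hp => (hF p hp).act (cylAt_evolField hG hp)

theorem evolField_totalDeriv (hΩ : IsOpen Ω) {G : Fin n → Jet m n → ℝ}
    (hG : ∀ j, G j ∈ LocSmooth Ω) (s : Fin m → ℕ) {F : Jet m n → ℝ} (hF : F ∈ LocSmooth Ω) :
    EqOn (act (evolField G) (totalDeriv s F)) (totalDeriv s (act (evolField G) F)) Ω :=
  multiIter_intertwine (T := fun i => act (totalField i)) (T' := fun i => act (totalField i))
    (fun _ _ h => totalField_act_mem _ h) (fun _ _ _ => act_congr hΩ _) (act (evolField G))
    (fun _ _ h => evolField_comm_totalField hΩ hG _ h) s hF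

/-- The relations `[G_i, G_j] = ∑ λ_{ij}^k G_k` hold for the evolution fields, too. -/
theorem evolField_commutator (hΩ : IsOpen Ω) {h : ℕ} {G : Fin h → Fin n → Jet m n → ℝ}
    (hG : ∀ i j, G i j ∈ LocSmooth Ω) {lam : Fin h → Fin h → Fin h → ℝ}
    (hLie : ∀ i j α, ∀ p ∈ Ω, bracket (G i) (G j) α p = ∑ k, lam i j k * G k α p)
    (i j : Fin h) {F : Jet m n → ℝ} {p : Jet m n} (hp : p ∈ Ω) (hF : CylAt F p) :
    act (evolField (G i)) (act (evolField (G j)) F) p -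
      act (evolField (G j)) (act (evolField (G i)) F) p =
      ∑ k, lam i j k * act (evolField (G k)) F p := by
  rw [act_commutator hF (cylAt_evolField (hG i) hp) (cylAt_evolField (hG j) hp)]
  -- `D^s` commutes with both fields, so the `u^α_s` component of the commutator is `D^s` of the
  -- `u^α` component, that is, of the bracket
  have : (fun c => act (evolField (G i)) (fun q => evolField (G j) q c) p -
      act (evolField (G j)) (fun q => evolField (G i) q c) p) =
      ∑ k, lam i j k • evolField (G k) p := by
    funext c
    rcases c with r | ⟨α, s⟩
    · simp [evolField, act_const, Finset.sum_apply]
    · simp only [evolField, Sum.elim_inr, Finset.sum_apply, Pi.smul_apply, smul_eq_mul]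
      have e1 := totalDeriv_sum hΩ (ι := Fin 2) ![1, -1] s
        (F := ![act (evolField (G i)) (G j α), act (evolField (G j)) (G i α)]) (by
          intro k
          fin_cases k
          · exact evolField_act_mem (hG i) (hG j α)
          · exact evolField_act_mem (hG j) (hG i α)) hp
      simp only [Fin.sum_univ_two, Matrix.cons_val_zero, Matrix.cons_val_one, one_mul, neg_mul,
        ← sub_eq_add_neg] at e1
      have e2 := totalDeriv_congr hΩ s (F := bracket (G i) (G j) α)
        (H := fun p => ∑ k, lam i j k * G k α p) (hLie i j α) hp
      rw [totalDeriv_sum hΩ (lam i j) s (fun k => hG k α) hp] at e2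
      refine Eq.trans ?_ e2
      exact (congrArg₂ _ (evolField_totalDeriv hΩ (hG i) s (hG j α) hp)
        (evolField_totalDeriv hΩ (hG j) s (hG i α) hp)).trans e1.symm
  rw [this, hF.lineDeriv_sum]
  exact Finset.sum_congr rfl fun k _ => by rw [hF.lineDeriv_smul]; rfl

/-! ### Characteristic fields -/

theorem act_charField {G : Fin n → Jet m n → ℝ} {η : Fin m → Jet m n → ℝ} {F : Jet m n → ℝ}
    {p : Jet m n} (hF : CylAt F p) :
    act (charField G η) F p = act (evolField G) F p - ∑ i, η i p * act (totalField i) F p := by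
  simp only [act, charField]
  rw [hF.lineDeriv_sub, hF.lineDeriv_sum]
  simp only [hF.lineDeriv_smul, smul_eq_mul]

theorem cylAt_charField {G : Fin n → Jet m n → ℝ} {η : Fin m → Jet m n → ℝ}
    (hG : ∀ j, G j ∈ LocSmooth Ω) (hη : ∀ r, η r ∈ LocSmooth Ω) {p : Jet m n} (hp : p ∈ Ω) :
    CylAt (charField G η) p := by
  refine cylAt_pi fun c => ?_
  simp only [charField, Pi.sub_apply, Finset.sum_apply, Pi.smul_apply, smul_eq_mul]
  exact ((cylAt_evolField hG hp).apply c).sub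
    (CylAt.sum _ fun i _ => (hη i p hp).mul ((cylAt_totalField i p).apply c))

theorem charField_act_mem {G : Fin n → Jet m n → ℝ} {η : Fin m → Jet m n → ℝ}
    (hG : ∀ j, G j ∈ LocSmooth Ω) (hη : ∀ r, η r ∈ LocSmooth Ω) {F : Jet m n → ℝ}
    (hF : F ∈ LocSmooth Ω) : act (charField G η) F ∈ LocSmooth Ω :=
  fun p hp => (hF p hp).act (cylAt_charField hG hη hp)

/-- The product rule for the action of a vector field `Z` on `V_G(F) - ∑ η^s D_s(F)`. -/
theorem act_act_charField (hΩ : IsOpen Ω) {G : Fin n → Jet m n → ℝ} {η : Fin m → Jet m n → ℝ}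
    (hG : ∀ j, G j ∈ LocSmooth Ω) (hη : ∀ r, η r ∈ LocSmooth Ω) {F : Jet m n → ℝ}
    (hF : F ∈ LocSmooth Ω) (Z : Jet m n → Jet m n) {p : Jet m n} (hp : p ∈ Ω) :
    act Z (act (charField G η) F) p = act Z (act (evolField G) F) p -
      ∑ s, (act Z (η s) p * act (totalField s) F p +
        η s p * act Z (act (totalField s) F) p) := by
  have hD : ∀ s ∈ Finset.univ, CylAt (fun q => η s q * act (totalField s) F q) p := fun s _ =>
    (hη s p hp).mul (totalField_act_mem s hF p hp)
  rw [act_congr hΩ Z (fun q hq => act_charField (hF q hq)) hp,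
    act_sub Z (evolField_act_mem hG hF p hp) (CylAt.sum _ hD), act_sum _ _ hD]
  congr 1
  exact Finset.sum_congr rfl fun s _ => act_mul Z (hη s p hp) (totalField_act_mem s hF p hp)

/-- `[V_G - ∑ η^s D_s, D_r] = ∑ D_r(η^s) D_s`. -/
theorem charField_totalField (hΩ : IsOpen Ω) {G : Fin n → Jet m n → ℝ} {η : Fin m → Jet m n → ℝ}
    (hG : ∀ j, G j ∈ LocSmooth Ω) (hη : ∀ r, η r ∈ LocSmooth Ω) {F : Jet m n → ℝ}
    (hF : F ∈ LocSmooth Ω) (r : Fin m) {p : Jet m n} (hp : p ∈ Ω) :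
    act (charField G η) (act (totalField r) F) p =
      act (totalField r) (act (charField G η) F) p +
        ∑ s, act (totalField r) (η s) p * act (totalField s) F p := by
  rw [act_act_charField hΩ hG hη hF _ hp, act_charField (totalField_act_mem r hF p hp),
    evolField_comm_totalField hΩ hG r hF hp, Finset.sum_add_distrib]
  simp only [fun s => totalField_comm s r (hF p hp)]
  ring

/-- `[V_{G_i} - ∑ η^s D_s, V_{G_j}] = ∑ λ_{ij}^k V_{G_k} + ∑ V_{G_j}(η^s) D_s`. -/
theorem charField_evolField (hΩ : IsOpen Ω) {h : ℕ} {G : Fin h → Fin n → Jet m n → ℝ}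
    (hG : ∀ i j, G i j ∈ LocSmooth Ω) {lam : Fin h → Fin h → Fin h → ℝ}
    (hLie : ∀ i j α, ∀ p ∈ Ω, bracket (G i) (G j) α p = ∑ k, lam i j k * G k α p)
    {η : Fin m → Jet m n → ℝ} (hη : ∀ r, η r ∈ LocSmooth Ω)
    (i j : Fin h) {F : Jet m n → ℝ} (hF : F ∈ LocSmooth Ω) {p : Jet m n} (hp : p ∈ Ω) :
    act (charField (G i) η) (act (evolField (G j)) F) p =
      act (evolField (G j)) (act (charField (G i) η) F) p +
        (∑ k, lam i j k * act (evolField (G k)) F p) +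
        ∑ s, act (evolField (G j)) (η s) p * act (totalField s) F p := by
  rw [act_act_charField hΩ (hG i) hη hF _ hp, act_charField (evolField_act_mem (hG j) hF p hp),
    Finset.sum_add_distrib, ← evolField_commutator hΩ hG hLie i j hp (hF p hp)]
  simp only [fun s => evolField_comm_totalField hΩ (hG j) s hF hp]
  ring

end Fields

/-! ### Jets of families of maps -/

section Jets

variable {m n : ℕ} {W : Set ((Fin m → ℝ) × ℝ)}

/-- The partial derivative in the direction `i` of the space variable. -/
noncomputable def xDeriv (i : Fin m) (k : (Fin m → ℝ) × ℝ → ℝ) : (Fin m → ℝ) × ℝ → ℝ :=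
  fun z => fderiv ℝ (fun y => k (y, z.2)) z.1 (Pi.single i 1)

/-- The partial derivative with respect to the time variable. -/
noncomputable def tDeriv (k : (Fin m → ℝ) × ℝ → ℝ) : (Fin m → ℝ) × ℝ → ℝ :=
  fun z => fderiv ℝ k z (0, 1)

theorem slice_eventually (hW : IsOpen W) {z : (Fin m → ℝ) × ℝ} (hz : z ∈ W) :
    ∀ᶠ y in 𝓝 z.1, (y, z.2) ∈ W :=
  (show ContinuousAt (fun y : Fin m → ℝ => (y, z.2)) z.1 by fun_prop).eventually (hW.mem_nhds hz)

theorem xDeriv_congr_slice (i : Fin m) {F H : (Fin m → ℝ) × ℝ → ℝ} {z : (Fin m → ℝ) × ℝ}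
    (h : ∀ᶠ y in 𝓝 z.1, F (y, z.2) = H (y, z.2)) : xDeriv i F z = xDeriv i H z := by
  unfold xDeriv
  rw [Filter.EventuallyEq.fderiv_eq h]

theorem xDeriv_congr (hW : IsOpen W) (i : Fin m) {F H : (Fin m → ℝ) × ℝ → ℝ} (h : EqOn F H W) :
    EqOn (xDeriv i F) (xDeriv i H) W := fun z hz =>
  xDeriv_congr_slice i (by filter_upwards [slice_eventually hW hz] with y hy using h hy)

theorem fderiv_apply_congr (hW : IsOpen W) (v : (Fin m → ℝ) × ℝ) {F H : (Fin m → ℝ) × ℝ → ℝ}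
    (h : EqOn F H W) : EqOn (fun z => fderiv ℝ F z v) (fun z => fderiv ℝ H z v) W := by
  intro z hz
  have : F =ᶠ[𝓝 z] H := by filter_upwards [hW.mem_nhds hz] with y hy using h hy
  simp only [this.fderiv_eq]

theorem hasFDerivAt_of_contDiffOn (hW : IsOpen W) {k : (Fin m → ℝ) × ℝ → ℝ}
    (hk : ContDiffOn ℝ ∞ k W) {z : (Fin m → ℝ) × ℝ} (hz : z ∈ W) :
    HasFDerivAt k (fderiv ℝ k z) z :=
  ((hk.contDiffAt (hW.mem_nhds hz)).differentiableAt (by simp)).hasFDerivAt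

theorem xDeriv_eq (hW : IsOpen W) (i : Fin m) {k : (Fin m → ℝ) × ℝ → ℝ}
    (hk : ContDiffOn ℝ ∞ k W) :
    EqOn (xDeriv i k) (fun z => fderiv ℝ k z (Pi.single i 1, 0)) W := by
  intro z hz
  have h1 : HasFDerivAt (fun y : Fin m → ℝ => (y, z.2)) (.inl ℝ (Fin m → ℝ) ℝ) z.1 :=
    hasFDerivAt_prodMk_left z.1 z.2
  have h2 := (hasFDerivAt_of_contDiffOn hW hk hz).comp (f := fun y : Fin m → ℝ => (y, z.2)) z.1 h1
  have h3 := h2.fderiv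
  unfold xDeriv
  rw [Function.comp_def] at h3
  rw [h3]
  simp

theorem fderiv_apply_mem (hW : IsOpen W) (v : (Fin m → ℝ) × ℝ) {k : (Fin m → ℝ) × ℝ → ℝ}
    (hk : ContDiffOn ℝ ∞ k W) : ContDiffOn ℝ ∞ (fun z => fderiv ℝ k z v) W :=
  (hk.fderiv_of_isOpen hW (by simp)).clm_apply contDiffOn_const

theorem xDeriv_mem (hW : IsOpen W) (i : Fin m) {k : (Fin m → ℝ) × ℝ → ℝ}
    (hk : ContDiffOn ℝ ∞ k W) : ContDiffOn ℝ ∞ (xDeriv i k) W :=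
  (fderiv_apply_mem hW _ hk).congr (xDeriv_eq hW i hk)

theorem fderiv_apply_comm (hW : IsOpen W) (v w : (Fin m → ℝ) × ℝ) {k : (Fin m → ℝ) × ℝ → ℝ}
    (hk : ContDiffOn ℝ ∞ k W) :
    EqOn (fun z => fderiv ℝ (fun z => fderiv ℝ k z w) z v)
      (fun z => fderiv ℝ (fun z => fderiv ℝ k z v) z w) W := by
  intro z hz
  have hd : DifferentiableAt ℝ (fderiv ℝ k) z :=
    ((hk.fderiv_of_isOpen hW (m := ∞) (by simp)).contDiffAt (hW.mem_nhds hz)).differentiableAt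
      (by simp)
  have hs : IsSymmSndFDerivAt ℝ k z := (hk.contDiffAt (hW.mem_nhds hz)).isSymmSndFDerivAt (by
    rw [minSmoothness_of_isRCLikeNormedField]
    exact WithTop.coe_le_coe.2 (le_top : (2 : ℕ∞) ≤ ⊤))
  have key : ∀ w v, fderiv ℝ (fun z => fderiv ℝ k z w) z v = fderiv ℝ (fderiv ℝ k) z v w := by
    intro w v
    have := (hd.hasFDerivAt.clm_apply (hasFDerivAt_const w z)).fderiv
    rw [this]
    simp
  simp only [key]
  exact hs.eq v w

theorem xDeriv_comm_fderiv (hW : IsOpen W) (v : (Fin m → ℝ) × ℝ) (i : Fin m)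
    {k : (Fin m → ℝ) × ℝ → ℝ} (hk : ContDiffOn ℝ ∞ k W) :
    EqOn (fun z => fderiv ℝ (xDeriv i k) z v) (xDeriv i (fun z => fderiv ℝ k z v)) W :=
  ((fderiv_apply_congr hW v (xDeriv_eq hW i hk)).trans (fderiv_apply_comm hW v _ hk)).trans
    (xDeriv_eq hW i (fderiv_apply_mem hW v hk)).symm

theorem xDeriv_comm (hW : IsOpen W) (i j : Fin m) {k : (Fin m → ℝ) × ℝ → ℝ}
    (hk : ContDiffOn ℝ ∞ k W) : EqOn (xDeriv i (xDeriv j k)) (xDeriv j (xDeriv i k)) W :=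
  (xDeriv_eq hW i (xDeriv_mem hW j hk)).trans ((xDeriv_comm_fderiv hW _ j hk).trans
    (xDeriv_congr hW j (xDeriv_eq hW i hk).symm))

theorem multi_xDeriv_mem (hW : IsOpen W) (s : Fin m → ℕ) {k : (Fin m → ℝ) × ℝ → ℝ}
    (hk : ContDiffOn ℝ ∞ k W) : ContDiffOn ℝ ∞ (multiIter xDeriv s k) W :=
  multiIter_mem (S := {k | ContDiffOn ℝ ∞ k W}) (fun i _ h => xDeriv_mem hW i h) s hk

theorem multi_xDeriv_succ (hW : IsOpen W) (i : Fin m) (s : Fin m → ℕ)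
    {k : (Fin m → ℝ) × ℝ → ℝ} (hk : ContDiffOn ℝ ∞ k W) :
    EqOn (xDeriv i (multiIter xDeriv s k)) (multiIter xDeriv (s + Pi.single i 1) k) W :=
  multiIter_succ (S := {k | ContDiffOn ℝ ∞ k W}) (fun i _ h => xDeriv_mem hW i h)
    (fun i _ _ => xDeriv_congr hW i) (fun i j _ h => xDeriv_comm hW i j h) i s hk

theorem multi_xDeriv_tDeriv (hW : IsOpen W) (s : Fin m → ℕ) {k : (Fin m → ℝ) × ℝ → ℝ}
    (hk : ContDiffOn ℝ ∞ k W) :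
    EqOn (tDeriv (multiIter xDeriv s k)) (multiIter xDeriv s (tDeriv k)) W :=
  multiIter_intertwine (S := {k | ContDiffOn ℝ ∞ k W}) (fun i _ h => xDeriv_mem hW i h)
    (fun i _ _ => xDeriv_congr hW i) tDeriv (fun i _ h => xDeriv_comm_fderiv hW _ i h) s hk

theorem partialDeriv_slice (s : Fin m → ℕ) (k : (Fin m → ℝ) × ℝ → ℝ) (x : Fin m → ℝ) (t : ℝ) :
    partialDeriv s (fun y => k (y, t)) x = multiIter xDeriv s k (x, t) :=
  (multiIter_intertwine (T := xDeriv) (U := univ) (S := univ)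
    (T' := fun i (k : (Fin m → ℝ) → ℝ) x => fderiv ℝ k x (Pi.single i 1)) (fun _ _ _ => trivial)
    (fun i F H h => by rw [eqOn_univ] at h; rw [h]; exact fun _ _ => rfl)
    (fun k y => k (y, t)) (fun _ _ _ _ _ => rfl) s (a := k) trivial (mem_univ x)).symm

variable {f : (Fin m → ℝ) → ℝ → Fin n → ℝ}

/-- The jet of `f(·, t)` at `x`, as a function of `(x, t)`. -/
noncomputable def jetFam (f : (Fin m → ℝ) → ℝ → Fin n → ℝ) (z : (Fin m → ℝ) × ℝ) : Jet m n :=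
  jetOf (fun y => f y z.2) z.1

theorem jetFam_inl (z : (Fin m → ℝ) × ℝ) (i : Fin m) : jetFam f z (Sum.inl i) = z.1 i := rfl

theorem jetFam_inr (z : (Fin m → ℝ) × ℝ) (j : Fin n) (s : Fin m → ℕ) :
    jetFam f z (Sum.inr (j, s)) = multiIter xDeriv s (fun z => f z.1 z.2 j) z :=
  partialDeriv_slice s (fun z => f z.1 z.2 j) z.1 z.2

theorem jetFam_mem {M : Set (Fin m → ℝ)} {N : Set (Fin n → ℝ)}
    (hWMN : ∀ x t, (x, t) ∈ W → x ∈ M ∧ f x t ∈ N) {z : (Fin m → ℝ) × ℝ} (hz : z ∈ W) :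
    jetFam f z ∈ jetSpace M N := by
  refine ⟨(hWMN z.1 z.2 hz).1, ?_⟩
  have : (fun j => jetFam f z (Sum.inr (j, 0))) = f z.1 z.2 := by
    funext j
    rw [jetFam_inr, multiIter_zero]
  rw [this]
  exact (hWMN z.1 z.2 hz).2

theorem contDiffOn_component (hf : ContDiffOn ℝ ∞ (fun z : (Fin m → ℝ) × ℝ => f z.1 z.2) W)
    (j : Fin n) : ContDiffOn ℝ ∞ (fun z : (Fin m → ℝ) × ℝ => f z.1 z.2 j) W :=
  (contDiffOn_pi.1 hf) j

theorem contDiffOn_jetFam (hW : IsOpen W)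
    (hf : ContDiffOn ℝ ∞ (fun z : (Fin m → ℝ) × ℝ => f z.1 z.2) W) (c : Coord m n) :
    ContDiffOn ℝ ∞ (fun z => jetFam f z c) W := by
  rcases c with i | ⟨j, s⟩
  · simp only [jetFam_inl]
    fun_prop
  · simp only [jetFam_inr]
    exact multi_xDeriv_mem hW s (contDiffOn_component hf j)

theorem cylAt_jetFam (hW : IsOpen W)
    (hf : ContDiffOn ℝ ∞ (fun z : (Fin m → ℝ) × ℝ => f z.1 z.2) W) {z : (Fin m → ℝ) × ℝ}
    (hz : z ∈ W) : CylAt (jetFam f) z := by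
  refine cylAt_pi fun c => cylAt_of_contDiffAt ?_
  filter_upwards [hW.mem_nhds hz] with y hy
  exact (contDiffOn_jetFam hW hf c).contDiffAt (hW.mem_nhds hy)

/-- The jets of a map are tangent to the total derivatives. -/
theorem fderiv_jetFam (hW : IsOpen W)
    (hf : ContDiffOn ℝ ∞ (fun z : (Fin m → ℝ) × ℝ => f z.1 z.2) W) {z : (Fin m → ℝ) × ℝ}
    (hz : z ∈ W) (i : Fin m) (c : Coord m n) :
    fderiv ℝ (fun z => jetFam f z c) z (Pi.single i 1, 0) = totalField i (jetFam f z) c := by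
  refine (xDeriv_eq hW i (contDiffOn_jetFam hW hf c) hz).symm.trans ?_
  rcases c with r | ⟨j, s⟩
  · simp only [jetFam_inl, totalField, Sum.elim_inl, xDeriv]
    have : HasFDerivAt (fun y : Fin m → ℝ => y r)
        (ContinuousLinearMap.proj (R := ℝ) (φ := fun _ : Fin m => ℝ) r) z.1 :=
      hasFDerivAt_apply r z.1
    rw [this.fderiv]
    rfl
  · simp only [jetFam_inr, totalField, Sum.elim_inr]
    exact multi_xDeriv_succ hW i s (contDiffOn_component hf j) hz

theorem fderiv_jetFam_base (hW : IsOpen W)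
    (hf : ContDiffOn ℝ ∞ (fun z : (Fin m → ℝ) × ℝ => f z.1 z.2) W) {z : (Fin m → ℝ) × ℝ}
    (hz : z ∈ W) (w : Fin m → ℝ) (c : Coord m n) :
    fderiv ℝ (fun z => jetFam f z c) z (w, 0) = (∑ i, w i • totalField i (jetFam f z)) c := by
  have h1 : ((w, 0) : (Fin m → ℝ) × ℝ) = ∑ i, w i • (Pi.single i 1, 0) := by
    refine Prod.ext ?_ ?_
    · rw [Prod.fst_sum]
      funext j
      simp [Finset.sum_apply, Pi.single_apply]
    · rw [Prod.snd_sum]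
      simp
  rw [h1, map_sum, Finset.sum_apply]
  refine Finset.sum_congr rfl fun i _ => ?_
  rw [map_smul, fderiv_jetFam hW hf hz i c]
  rfl

theorem xDeriv_comp_jetFam {Ω : Set (Jet m n)} (hW : IsOpen W)
    (hf : ContDiffOn ℝ ∞ (fun z : (Fin m → ℝ) × ℝ => f z.1 z.2) W)
    (hΩ : ∀ z ∈ W, jetFam f z ∈ Ω) (i : Fin m) {F : Jet m n → ℝ} (hF : F ∈ LocSmooth Ω) :
    EqOn (fun z => act (totalField i) F (jetFam f z)) (xDeriv i fun z => F (jetFam f z)) W := by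
  intro z hz
  have hFj : ContDiffOn ℝ ∞ (fun z => F (jetFam f z)) W := fun y hy =>
    (((hF _ (hΩ y hy)).comp (cylAt_jetFam hW hf hy)).contDiffAt).contDiffWithinAt
  refine Eq.trans ?_ (xDeriv_eq hW i hFj hz).symm
  have hl : HasDerivAt (fun t : ℝ => z + t • ((Pi.single i 1, 0) : (Fin m → ℝ) × ℝ))
      (Pi.single i 1, 0) 0 := by
    simpa using ((hasDerivAt_id (0 : ℝ)).smul_const ((Pi.single i 1, 0) : (Fin m → ℝ) × ℝ)).const_add z
  have hz0 : z + (0 : ℝ) • ((Pi.single i 1, 0) : (Fin m → ℝ) × ℝ) = z := by simp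
  have h1 : ∀ c, HasDerivAt (fun t : ℝ => jetFam f (z + t • (Pi.single i 1, 0)) c)
      (totalField i (jetFam f z) c) 0 := by
    intro c
    rw [← fderiv_jetFam hW hf hz i c]
    refine HasFDerivAt.comp_hasDerivAt (l := fun z => jetFam f z c) (0 : ℝ) ?_ hl
    rw [hz0]
    exact hasFDerivAt_of_contDiffOn hW (contDiffOn_jetFam hW hf c) hz
  have h2 := CylAt.hasDerivAt_comp (F := F) (by rw [hz0]; exact hF _ (hΩ z hz)) h1
  have h3 : HasDerivAt (fun t : ℝ => F (jetFam f (z + t • (Pi.single i 1, 0))))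
      (fderiv ℝ (fun z => F (jetFam f z)) z (Pi.single i 1, 0)) 0 := by
    refine HasFDerivAt.comp_hasDerivAt (l := fun z => F (jetFam f z)) (0 : ℝ) ?_ hl
    rw [hz0]
    exact hasFDerivAt_of_contDiffOn hW hFj hz
  rw [hz0] at h2
  exact h2.unique h3

/-- The total derivatives of a function become partial derivatives on the jets of a map. -/
theorem totalDeriv_jetFam {Ω : Set (Jet m n)} (hW : IsOpen W)
    (hf : ContDiffOn ℝ ∞ (fun z : (Fin m → ℝ) × ℝ => f z.1 z.2) W)
    (hΩ : ∀ z ∈ W, jetFam f z ∈ Ω) (s : Fin m → ℕ) {F : Jet m n → ℝ} (hF : F ∈ LocSmooth Ω) :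
    EqOn (fun z => totalDeriv s F (jetFam f z)) (multiIter xDeriv s fun z => F (jetFam f z)) W :=
  multiIter_intertwine (T := fun i => act (totalField i)) (fun i _ h => totalField_act_mem i h)
    (fun i _ _ => xDeriv_congr hW i) (fun F z => F (jetFam f z))
    (fun i _ h => xDeriv_comp_jetFam hW hf hΩ i h) s hF

/-- The time derivatives at time `0` of the coordinates of the jets of a solution of the evolution
equation of `F` are the components of `V_F`. -/
theorem tDeriv_jetFam {Ω : Set (Jet m n)} (hW : IsOpen W)
    (hf : ContDiffOn ℝ ∞ (fun z : (Fin m → ℝ) × ℝ => f z.1 z.2) W)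
    (hΩ : ∀ z ∈ W, jetFam f z ∈ Ω) {F : Fin n → Jet m n → ℝ} (hF : ∀ j, F j ∈ LocSmooth Ω)
    (hevol : ∀ x t, (x, t) ∈ W → 0 ≤ t → ∀ j,
      HasDerivAt (fun s => f x s j) (F j (jetOf (fun y => f y t) x)) t)
    {x : Fin m → ℝ} (hx : (x, (0 : ℝ)) ∈ W) (j : Fin n) (s : Fin m → ℕ) :
    fderiv ℝ (fun z => jetFam f z (Sum.inr (j, s))) (x, 0) (0, 1) =
      totalDeriv s (F j) (jetFam f (x, 0)) := by
  have hfj := contDiffOn_component hf j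
  simp only [jetFam_inr]
  refine (multi_xDeriv_tDeriv hW s hfj hx).trans ?_
  -- the equation holds at time `0`, and only there and later: so the two sides agree on the slice
  -- `t = 0`, which suffices, since the remaining derivatives are taken in the space directions
  have h1 : EqOn (multiIter xDeriv s (tDeriv fun z : (Fin m → ℝ) × ℝ => f z.1 z.2 j))
      (multiIter xDeriv s fun z => F j (jetFam f z)) {z | z ∈ W ∧ z.2 = 0} := by
    refine multiIter_congr (fun i F H h => ?_) s ?_
    · intro z hz
      refine xDeriv_congr_slice i ?_
      filter_upwards [slice_eventually hW hz.1] with y hy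
      exact h ⟨hy, hz.2⟩
    · rintro ⟨y, t⟩ ⟨hy, rfl⟩
      have h2 := hevol y 0 hy le_rfl j
      have h3 : HasDerivAt (fun s : ℝ => (y, s)) ((0, 1) : (Fin m → ℝ) × ℝ) 0 :=
        (hasDerivAt_const _ _).prodMk (hasDerivAt_id _)
      exact (HasFDerivAt.comp_hasDerivAt (l := fun z : (Fin m → ℝ) × ℝ => f z.1 z.2 j) (0 : ℝ)
        (hasFDerivAt_of_contDiffOn hW hfj hy) h3).unique h2
  rw [h1 ⟨hx, rfl⟩]
  exact (totalDeriv_jetFam hW hf hΩ s (hF j) hx).symm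

end Jets

/-! ### Linear ordinary differential equations -/

/-- Linear differential equations with initial value `0` at the time `0` have the solution `0` only.
The interval may extend to negative times: the substitution `τ = σ τ₀` with `0 ≤ σ ≤ 1` reduces this
to the case of an interval to the right of `0`. -/
theorem linear_ode_eq_zero {ι : Type} [Fintype ι] {Y : ℝ → ι → ℝ} {A : ℝ → ι → ι → ℝ} {T : ℝ}
    (hA : ∀ α β, ContinuousOn (fun τ => A τ α β) (uIcc 0 T))
    (hY : ∀ τ ∈ uIcc 0 T, ∀ α, HasDerivAt (fun τ => Y τ α) (∑ β, A τ α β * Y τ β) τ)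
    (h0 : Y 0 = 0) : ∀ τ ∈ uIcc 0 T, Y τ = 0 := by
  intro τ₀ hτ₀
  have hmem : ∀ σ ∈ Icc (0 : ℝ) 1, σ * τ₀ ∈ uIcc 0 T := by
    intro σ hσ
    have := (convex_uIcc (0 : ℝ) T) left_mem_uIcc hτ₀ (sub_nonneg.2 hσ.2) hσ.1 (by ring)
    simpa using this
  have hc : ContinuousOn (fun τ => ∑ α, ∑ β, |A τ α β|) (uIcc 0 T) :=
    continuousOn_finsetSum _ fun α _ => continuousOn_finsetSum _ fun β _ => (hA α β).abs
  obtain ⟨C, hC⟩ := isCompact_uIcc.exists_bound_of_continuousOn hc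
  have hder : ∀ σ ∈ Icc (0 : ℝ) 1, HasDerivAt (fun σ => Y (σ * τ₀))
      (τ₀ • fun α => ∑ β, A (σ * τ₀) α β * Y (σ * τ₀) β) σ := by
    intro σ hσ
    rw [hasDerivAt_pi]
    intro α
    exact HasDerivAt.scomp (g₁ := fun τ => Y τ α) σ (hY _ (hmem σ hσ) α) (hasDerivAt_mul_const τ₀)
  have := eq_zero_of_abs_deriv_le_mul_abs_self_of_eq_zero_right (K := |τ₀| * C)
    (f := fun σ => Y (σ * τ₀)) (fun σ hσ => (hder σ hσ).continuousAt.continuousWithinAt)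
    (fun σ hσ => (hder σ (Ico_subset_Icc_self hσ)).hasDerivWithinAt) (by simpa using h0)
    (fun σ hσ => by
      have hσ' := hmem σ (Ico_subset_Icc_self hσ)
      have hC' := hC _ hσ'
      rw [Real.norm_of_nonneg (by positivity)] at hC'
      have hC0 : 0 ≤ C := le_trans (by positivity) hC'
      rw [norm_smul, Real.norm_eq_abs, mul_assoc]
      refine mul_le_mul_of_nonneg_left ?_ (abs_nonneg _)
      rw [pi_norm_le_iff_of_nonneg (by positivity)]
      intro α
      calc ‖∑ β, A (σ * τ₀) α β * Y (σ * τ₀) β‖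
          ≤ ∑ β, |A (σ * τ₀) α β| * ‖Y (σ * τ₀)‖ := by
            refine norm_sum_le_of_le _ fun β _ => ?_
            rw [norm_mul, Real.norm_eq_abs]
            exact mul_le_mul_of_nonneg_left (norm_le_pi_norm _ β) (abs_nonneg _)
        _ = (∑ β, |A (σ * τ₀) α β|) * ‖Y (σ * τ₀)‖ := (Finset.sum_mul ..).symm
        _ ≤ C * ‖Y (σ * τ₀)‖ := by
            refine mul_le_mul_of_nonneg_right (le_trans ?_ hC') (norm_nonneg _)
            exact Finset.single_le_sum (f := fun α => ∑ β, |A (σ * τ₀) α β|)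
              (fun _ _ => by positivity) (Finset.mem_univ α)) 1 (by simp)
  simpa using this

/-! ### Finite generation of the filtration -/

section Filtration

variable {m n : ℕ} {Ω : Set (Jet m n)} {A : Set (Jet m n → ℝ)}

/-- `F` is on `Ω` a smooth function of the finite family `g`. -/
def GeneratedBy (Ω : Set (Jet m n)) {ι : Type} [Fintype ι] (g : ι → Jet m n → ℝ)
    (F : Jet m n → ℝ) : Prop :=
  ∃ (O : Set (ι → ℝ)) (H : (ι → ℝ) → ℝ), IsOpen O ∧ ContDiffOn ℝ ∞ H O ∧
    ∀ p ∈ Ω, (fun α => g α p) ∈ O ∧ F p = H (fun α => g α p)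

theorem subset_smoothGen : A ⊆ smoothGen Ω A := fun F hF =>
  ⟨1, fun _ => F, univ, fun y => y 0, fun _ => hF, isOpen_univ,
    (contDiff_apply ℝ ℝ _).contDiffOn, fun _ _ => ⟨trivial, rfl⟩⟩

theorem filtration_mono : Monotone (filtration Ω A) :=
  monotone_nat_of_le_succ fun _ => subset_union_left.trans subset_smoothGen

theorem generatedBy_of_smoothGen {ι : Type} [Fintype ι] {g : ι → Jet m n → ℝ}
    (h : ∀ F ∈ A, GeneratedBy Ω g F) {F : Jet m n → ℝ} (hF : F ∈ smoothGen Ω A) :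
    GeneratedBy Ω g F := by
  obtain ⟨r, g₀, O₀, H₀, hg₀, hO₀, hH₀, hF⟩ := hF
  choose O H hO hH hgH using fun i => h _ (hg₀ i)
  have hOi : IsOpen (⋂ i, O i) := isOpen_iInter_of_finite hO
  have hHi : ContDiffOn ℝ ∞ (fun y i => H i y) (⋂ i, O i) :=
    contDiffOn_pi.2 fun i => (hH i).mono (iInter_subset _ i)
  refine ⟨(⋂ i, O i) ∩ (fun y i => H i y) ⁻¹' O₀, fun y => H₀ fun i => H i y,
    hHi.continuousOn.isOpen_inter_preimage hOi hO₀,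
    hH₀.comp (hHi.mono inter_subset_left) fun y hy => hy.2, fun p hp => ?_⟩
  have h1 : (fun i => H i fun α => g α p) = fun i => g₀ i p :=
    funext fun i => ((hgH i p hp).2).symm
  refine ⟨⟨mem_iInter.2 fun i => (hgH i p hp).1, ?_⟩, ?_⟩
  · simp only [mem_preimage, h1]
    exact (hF p hp).1
  · simp only [h1]
    exact (hF p hp).2

/-- The differential of a function that is a smooth function of a finite family is a combination
of the differentials of the family. -/
theorem lineDeriv_of_generated (hΩ : IsOpen Ω) {ι : Type} [Fintype ι] [DecidableEq ι]
    {g : ι → Jet m n → ℝ}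
    (hg : ∀ α, g α ∈ LocSmooth Ω) {F : Jet m n → ℝ} {O : Set (ι → ℝ)} {H : (ι → ℝ) → ℝ}
    (hO : IsOpen O) (hH : ContDiffOn ℝ ∞ H O)
    (hF : ∀ p ∈ Ω, (fun α => g α p) ∈ O ∧ F p = H (fun α => g α p)) {p : Jet m n} (hp : p ∈ Ω)
    (v : Jet m n) :
    lineDeriv ℝ F p v =
      ∑ α, fderiv ℝ H (fun α => g α p) (Pi.single α 1) * lineDeriv ℝ (g α) p v := by
  have h1 : HasDerivAt (fun (t : ℝ) α => g α (p + t • v)) (fun α => lineDeriv ℝ (g α) p v) 0 :=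
    hasDerivAt_pi.2 fun α => (hg α p hp).hasLineDerivAt v
  have h2 : HasFDerivAt H (fderiv ℝ H (fun α => g α p)) (fun α => g α (p + (0 : ℝ) • v)) := by
    rw [zero_smul, add_zero]
    exact ((hH.contDiffAt (hO.mem_nhds (hF p hp).1)).differentiableAt (by simp)).hasFDerivAt
  have h3 := (h2.comp_hasDerivAt (0 : ℝ) h1).congr_of_eventuallyEq
    (f₁ := fun t : ℝ => F (p + t • v)) (by
      filter_upwards [eventually_line (hΩ.mem_nhds hp) v] with t ht
      exact (hF _ ht).2)
  refine h3.deriv.trans ?_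
  conv_lhs => rw [pi_eq_sum_univ' (fun α => lineDeriv ℝ (g α) p v)]
  rw [map_sum]
  refine Finset.sum_congr rfl fun α _ => ?_
  rw [map_smul, smul_eq_mul, mul_comm]

/-- All members of the filtration are finitely generated: if `𝔊_k` is generated by the functions
`g_α`, then `𝔊_{k+1}` is generated by the functions `g_α` and `D_i(g_α)`. -/
theorem filtration_generators (hΩ : IsOpen Ω) (hfin : A.Finite) (hA : A ⊆ LocSmooth Ω) (k : ℕ) :
    ∃ (ι : Type) (_ : Fintype ι) (g : ι → Jet m n → ℝ), (∀ α, g α ∈ filtration Ω A k) ∧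
      (∀ α, g α ∈ LocSmooth Ω) ∧ ∀ F ∈ filtration Ω A k, GeneratedBy Ω g F := by
  classical
  induction k with
  | zero =>
    refine ⟨A, hfin.fintype, Subtype.val, fun α => subset_smoothGen α.2, fun α => hA α.2, ?_⟩
    let _ := hfin.fintype
    intro F hF
    refine generatedBy_of_smoothGen (fun F hF => ?_) hF
    exact ⟨univ, fun y => y ⟨F, hF⟩, isOpen_univ, (contDiff_apply ℝ ℝ _).contDiffOn,
      fun _ _ => ⟨trivial, rfl⟩⟩
  | succ k ih =>
    obtain ⟨ι, _, g, hgk, hgs, hgen⟩ := ih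
    refine ⟨ι ⊕ (Fin m × ι), inferInstance,
      Sum.elim g fun iα => act (totalField iα.1) (g iα.2), ?_, ?_, ?_⟩
    · rintro (α | ⟨i, α⟩)
      · exact subset_smoothGen (Or.inl (hgk α))
      · exact subset_smoothGen (Or.inr (mem_iUnion.2 ⟨i, mem_image_of_mem _ (hgk α)⟩))
    · rintro (α | ⟨i, α⟩)
      · exact hgs α
      · exact totalField_act_mem i (hgs α)
    · intro F hF
      have hinl : ContDiff ℝ ∞ fun (y : ι ⊕ (Fin m × ι) → ℝ) α => y (Sum.inl α) := by fun_prop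
      refine generatedBy_of_smoothGen (fun F hF => ?_) hF
      rcases hF with hF | hF
      · obtain ⟨O, H, hO, hH, hFH⟩ := hgen F hF
        exact ⟨(fun y α => y (Sum.inl α)) ⁻¹' O, fun y => H fun α => y (Sum.inl α),
          hO.preimage hinl.continuous, hH.comp hinl.contDiffOn fun y hy => hy,
          fun p hp => hFH p hp⟩
      · obtain ⟨i, F, hF', rfl⟩ := mem_iUnion.1 hF
        obtain ⟨O, H, hO, hH, hFH⟩ := hgen F hF'
        refine ⟨(fun y α => y (Sum.inl α)) ⁻¹' O, fun y => ∑ α,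
          fderiv ℝ H (fun α => y (Sum.inl α)) (Pi.single α 1) * y (Sum.inr (i, α)),
          hO.preimage hinl.continuous, ?_, fun p hp => ⟨(hFH p hp).1, ?_⟩⟩
        · refine ContDiffOn.sum fun α _ => ContDiffOn.mul ?_ (contDiff_apply ℝ ℝ _).contDiffOn
          exact (((hH.fderiv_of_isOpen hO (m := ∞) (by simp)).clm_apply contDiffOn_const)).comp
            hinl.contDiffOn fun y hy => hy
        · exact lineDeriv_of_generated hΩ hgs hO hH hFH hp _

/-! ### Uniqueness of transported vectors -/

/-- Uniqueness of the solutions of the variational equation along a path, for vector fields `X i`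
with an invariant filtration: in terms of the generators of a member of the filtration that is
large enough, the variational equation is a linear differential equation of finite dimension. -/
theorem transport_eq_zero (hΩ : IsOpen Ω) {h : ℕ} {X : Fin h → Jet m n → Jet m n}
    (hX : HasCommonFiltration Ω X) (i : Fin h)
    {η : Fin m → Jet m n → ℝ} (hη : ∀ r, η r ∈ smoothFns Ω) {p y : ℝ → Jet m n} {T : ℝ}
    (hp : ∀ τ ∈ uIcc 0 T, p τ ∈ Ω) (hpc : ∀ τ ∈ uIcc 0 T, ContinuousAt p τ) (hy0 : y 0 = 0)
    (hder : ∀ F ∈ LocSmooth Ω, ∀ τ ∈ uIcc 0 T, HasDerivAt (fun τ => lineDeriv ℝ F (p τ) (y τ))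
      (lineDeriv ℝ (act (X i) F) (p τ) (y τ) +
        ∑ s, lineDeriv ℝ (η s) (p τ) (y τ) * act (totalField s) F (p τ)) τ) :
    ∀ τ ∈ uIcc 0 T, y τ = 0 := by
  obtain ⟨A, hfin, hA, hexh, hX⟩ := hX
  replace hX := hX i
  replace hA := hA.trans (smoothFns_subset hΩ)
  classical
  intro τ hτ
  funext c
  obtain ⟨k₀, hk₀⟩ := hexh _ (coord_mem_smoothFns c)
  choose kη hkη using fun r => hexh _ (hη r)
  -- a member of the filtration that contains the given coordinate and all `η_r`
  set k := k₀ + ∑ r, kη r with hk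
  have hck : (fun p : Jet m n => p c) ∈ filtration Ω A k := filtration_mono (by omega) hk₀
  have hηk : ∀ r, η r ∈ filtration Ω A k := fun r => by
    have := Finset.single_le_sum (f := kη) (fun _ _ => Nat.zero_le _) (Finset.mem_univ r)
    exact filtration_mono (by omega) (hkη r)
  obtain ⟨ι, _, g, hgk, hgs, hgen⟩ := filtration_generators hΩ hfin hA k
  choose O H hO hH hgH using fun α => hgen _ (hX k _ (hgk α))
  choose P K hP hK hgK using fun r => hgen _ (hηk r)
  obtain ⟨Q, J, hQ, hJ, hgJ⟩ := hgen _ hck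
  have hcont : ∀ {O : Set (ι → ℝ)} {H : (ι → ℝ) → ℝ}, IsOpen O → ContDiffOn ℝ ∞ H O →
      (∀ p ∈ Ω, (fun α => g α p) ∈ O) → ∀ β, ContinuousOn
        (fun τ => fderiv ℝ H (fun α => g α (p τ)) (Pi.single β 1)) (uIcc 0 T) := by
    intro O H hO hH hg β τ hτ
    have h1 : ContinuousAt (fun y => fderiv ℝ H y (Pi.single β 1)) (fun α => g α (p τ)) :=
      ((hH.fderiv_of_isOpen hO (m := ∞) (by simp)).clm_apply
        contDiffOn_const).continuousOn.continuousAt (hO.mem_nhds (hg _ (hp τ hτ)))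
    have h2 : ContinuousAt (fun τ α => g α (p τ)) τ := continuousAt_pi.2 fun α =>
      ContinuousAt.comp (f := p) (hgs α _ (hp τ hτ)).continuousAt (hpc τ hτ)
    exact (ContinuousAt.comp (f := fun τ α => g α (p τ)) h1 h2).continuousWithinAt
  have hY := linear_ode_eq_zero (T := T) (Y := fun τ α => lineDeriv ℝ (g α) (p τ) (y τ))
    (A := fun τ α β => fderiv ℝ (H α) (fun α => g α (p τ)) (Pi.single β 1) +
      ∑ s, fderiv ℝ (K s) (fun α => g α (p τ)) (Pi.single β 1) * act (totalField s) (g α) (p τ))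
    (fun α β => ((hcont (hO α) (hH α) (fun p hp => (hgH α p hp).1) β).add
      (continuousOn_finsetSum _ fun s _ => ContinuousOn.mul
        (hcont (hP s) (hK s) (fun p hp => (hgK s p hp).1) β) fun τ hτ =>
          (ContinuousAt.comp (f := p) (totalField_act_mem s (hgs α) _ (hp τ hτ)).continuousAt
            (hpc τ hτ)).continuousWithinAt)))
    (fun τ hτ α => by
      convert hder (g α) (hgs α) τ hτ using 1
      rw [lineDeriv_of_generated hΩ hgs (hO α) (hH α) (hgH α) (hp τ hτ)]
      simp only [fun s => lineDeriv_of_generated hΩ hgs (hP s) (hK s) (hgK s) (hp τ hτ) (y τ),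
        add_mul, Finset.sum_add_distrib, Finset.sum_mul]
      congr 1
      rw [Finset.sum_comm]
      exact Finset.sum_congr rfl fun s _ => Finset.sum_congr rfl fun β _ => by ring)
    (by
      funext α
      rw [hy0]
      exact (hgs α _ (hp 0 left_mem_uIcc)).lineDeriv_zero) τ hτ
  have h1 := lineDeriv_of_generated hΩ hgs hQ hJ hgJ (hp τ hτ) (y τ)
  rw [lineDeriv_coord] at h1
  rw [h1]
  exact Finset.sum_eq_zero fun α _ => by rw [show lineDeriv ℝ (g α) (p τ) (y τ) = 0 from
    congrFun hY α, mul_zero]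

end Filtration

/-! ### Flows -/

section Slices

variable {Y : Type} [NormedAddCommGroup Y] [NormedSpace ℝ Y] {g : ℝ × ℝ → Y} {r s : ℝ}

theorem hasDerivAt_slice_fst (hg : DifferentiableAt ℝ g (r, s)) :
    HasDerivAt (fun r => g (r, s)) (fderiv ℝ g (r, s) (1, 0)) r :=
  HasFDerivAt.comp_hasDerivAt (l := g) r hg.hasFDerivAt
    ((hasDerivAt_id r).prodMk (hasDerivAt_const r s))

theorem hasDerivAt_slice_snd (hg : DifferentiableAt ℝ g (r, s)) :
    HasDerivAt (fun s => g (r, s)) (fderiv ℝ g (r, s) (0, 1)) s :=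
  HasFDerivAt.comp_hasDerivAt (l := g) s hg.hasFDerivAt
    ((hasDerivAt_const s r).prodMk (hasDerivAt_id s))

end Slices

section Flow

variable {m n : ℕ} {Ω : Set (Jet m n)} {X : Jet m n → Jet m n} {D : Set (ℝ × Jet m n)}
  {Φ : ℝ → Jet m n → Jet m n}

theorem IsLocalFlow.cylAt (hΦ : IsLocalFlow Ω X D Φ) {z : ℝ × Jet m n} (hz : z ∈ D) :
    CylAt (fun z : ℝ × Jet m n => Φ z.1 z.2) z := by
  refine cylAt_pi fun c => ?_
  obtain ⟨S, O, g, hO, hzO, hg, hF⟩ := hΦ.smooth c z hz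
  let R : Jet m n →L[ℝ] (S → ℝ) := ContinuousLinearMap.pi fun c : S => .proj (c : Coord m n)
  let L : ℝ × Jet m n →L[ℝ] ℝ × (S → ℝ) := (ContinuousLinearMap.id ℝ ℝ).prodMap R
  have hLz : O ∈ 𝓝 (L z) := hO.mem_nhds hzO
  refine cylAt_of_rep L (g := g) ?_ ?_
  · filter_upwards [hLz] with y hy using hg.contDiffAt (hO.mem_nhds hy)
  · filter_upwards [hΦ.isOpen.mem_nhds hz, L.continuous.continuousAt.preimage_mem_nhds hLz]
      with w hw hw'
    exact hF w hw hw'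

theorem IsLocalFlow.mem_of_mem_uIcc (hΦ : IsLocalFlow Ω X D Φ) {T : ℝ} {p : Jet m n}
    (hp : (T, p) ∈ D) {τ : ℝ} (hτ : τ ∈ uIcc 0 T) : (τ, p) ∈ D :=
  (hΦ.ordConnected p).uIcc_subset (hΦ.zero_mem p (hΦ.mapsTo T p hp).1) hp hτ

theorem IsLocalFlow.hasDerivAt_comp (hΦ : IsLocalFlow Ω X D Φ) {F : Jet m n → ℝ}
    (hF : F ∈ LocSmooth Ω) {t : ℝ} {p : Jet m n} (hp : (t, p) ∈ D) :
    HasDerivAt (fun t => F (Φ t p)) (act X F (Φ t p)) t :=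
  (hF _ (hΦ.mapsTo t p hp).2).hasDerivAt_comp (hΦ.ode t p hp)

theorem IsLocalFlow.cylAt_path (hΦ : IsLocalFlow Ω X D Φ) {t : ℝ} {q : ℝ → Jet m n} {s : ℝ}
    (hq : CylAt q s) (hp : (t, q s) ∈ D) : CylAt (fun s => Φ t (q s)) s :=
  CylAt.comp (Q := fun s => (t, q s)) (R := fun z : ℝ × Jet m n => Φ z.1 z.2) (hΦ.cylAt hp)
    ((cylAt_const t s).prodMk hq)

/-- The tangent vector at the parameter `0` of the image under `Φ_t` of the path `q`. -/
noncomputable def pushDeriv (Φ : ℝ → Jet m n → Jet m n) (q : ℝ → Jet m n) (t : ℝ) : Jet m n :=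
  fun c => deriv (fun s => Φ t (q s) c) 0

theorem IsLocalFlow.hasDerivAt_push (hΦ : IsLocalFlow Ω X D Φ) {t : ℝ} {q : ℝ → Jet m n}
    (hq : CylAt q 0) (hp : (t, q 0) ∈ D) (c : Coord m n) :
    HasDerivAt (fun s => Φ t (q s) c) (pushDeriv Φ q t c) 0 :=
  (((hΦ.cylAt_path hq hp).apply c).contDiffAt.differentiableAt (by simp)).hasDerivAt

theorem IsLocalFlow.pushDeriv_zero (hΩ : IsOpen Ω) (hΦ : IsLocalFlow Ω X D Φ) {q : ℝ → Jet m n}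
    (hq : CylAt q 0) {v : Jet m n} (hv : ∀ c, HasDerivAt (fun s => q s c) (v c) 0)
    (hp : q 0 ∈ Ω) : pushDeriv Φ q 0 = v := by
  funext c
  refine HasDerivAt.deriv ((hv c).congr_of_eventuallyEq ?_)
  filter_upwards [hq.continuousAt.eventually (hΩ.mem_nhds hp)] with s hs
  rw [hΦ.zero _ hs]

/-- The variational equation: the derivatives of the flow with respect to initial values satisfy
the linearized differential equation. -/
theorem IsLocalFlow.variation (hΦ : IsLocalFlow Ω X D Φ) (hX : ∀ p ∈ Ω, CylAt X p)
    {t : ℝ} {q : ℝ → Jet m n} (hq : CylAt q 0) (hp : (t, q 0) ∈ D) {F : Jet m n → ℝ}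
    (hF : F ∈ LocSmooth Ω) :
    HasDerivAt (fun t => lineDeriv ℝ F (Φ t (q 0)) (pushDeriv Φ q t))
      (lineDeriv ℝ (act X F) (Φ t (q 0)) (pushDeriv Φ q t)) t := by
  have hcl : CylAt (fun z : ℝ × ℝ => (z.1, q z.2)) (t, 0) :=
    (cylAt_id _).fst.prodMk (CylAt.comp (R := q) (Q := fun z : ℝ × ℝ => z.2) hq (cylAt_id _).snd)
  set g : ℝ × ℝ → ℝ := fun z => F (Φ z.1 (q z.2)) with hg
  have hDnear : ∀ᶠ z : ℝ × ℝ in 𝓝 (t, 0), (z.1, q z.2) ∈ D :=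
    hcl.continuousAt.eventually (hΦ.isOpen.mem_nhds hp)
  have hgc : CylAt g (t, 0) := by
    have h1 := CylAt.comp (Q := fun z : ℝ × ℝ => (z.1, q z.2))
      (R := fun z : ℝ × Jet m n => Φ z.1 z.2) (p := (t, 0)) (hΦ.cylAt hp) hcl
    exact CylAt.comp (R := F) (hF _ (hΦ.mapsTo _ _ hp).2) h1
  have hgs : ∀ᶠ z in 𝓝 ((t, 0) : ℝ × ℝ), ContDiffAt ℝ ∞ g z := by
    filter_upwards [hgc.eventually] with z hz using hz.contDiffAt
  -- the partial derivatives of `g`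
  have hg1 : ∀ᶠ z in 𝓝 ((t, 0) : ℝ × ℝ), fderiv ℝ g z (1, 0) = act X F (Φ z.1 (q z.2)) := by
    filter_upwards [hgs, hDnear] with z hz hzD
    exact (hasDerivAt_slice_fst (hz.differentiableAt (by simp))).unique
      (hΦ.hasDerivAt_comp hF hzD)
  have hg2 : ∀ᶠ r in 𝓝 t, fderiv ℝ g (r, 0) (0, 1) =
      lineDeriv ℝ F (Φ r (q 0)) (pushDeriv Φ q r) := by
    have hcr : ContinuousAt (fun r : ℝ => (r, (0 : ℝ))) t := by fun_prop
    filter_upwards [hcr.eventually hgs, hcr.eventually hDnear] with r hr hrD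
    exact (hasDerivAt_slice_snd (hr.differentiableAt (by simp))).unique
      ((hF _ (hΦ.mapsTo _ _ hrD).2).hasDerivAt_comp (q := fun s => Φ r (q s)) (s := 0)
        (hΦ.hasDerivAt_push hq hrD))
  have hd : DifferentiableAt ℝ (fderiv ℝ g) (t, 0) :=
    (hgs.self_of_nhds.fderiv_right (m := ∞) (by simp)).differentiableAt (by simp)
  have hsymm : IsSymmSndFDerivAt ℝ g (t, 0) := hgs.self_of_nhds.isSymmSndFDerivAt (by
    rw [minSmoothness_of_isRCLikeNormedField]
    exact WithTop.coe_le_coe.2 (le_top : (2 : ℕ∞) ≤ ⊤))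
  have h1 : HasDerivAt (fun r : ℝ => fderiv ℝ g (r, 0) (0, 1))
      (fderiv ℝ (fderiv ℝ g) (t, 0) (1, 0) (0, 1)) t := by
    have := (hasDerivAt_slice_fst hd).clm_apply (hasDerivAt_const t ((0, 1) : ℝ × ℝ))
    rwa [map_zero, add_zero] at this
  have h2 : HasDerivAt (fun s : ℝ => fderiv ℝ g (t, s) (1, 0))
      (fderiv ℝ (fderiv ℝ g) (t, 0) (0, 1) (1, 0)) 0 := by
    have := (hasDerivAt_slice_snd hd).clm_apply (hasDerivAt_const (0 : ℝ) ((1, 0) : ℝ × ℝ))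
    rwa [map_zero, add_zero] at this
  have hXF : CylAt (act X F) (Φ t (q 0)) :=
    (hF _ (hΦ.mapsTo _ _ hp).2).act (hX _ (hΦ.mapsTo _ _ hp).2)
  have h3 := hXF.hasDerivAt_comp (q := fun s => Φ t (q s)) (s := 0) (hΦ.hasDerivAt_push hq hp)
  have hcs : ContinuousAt (fun s : ℝ => (t, s)) 0 := by fun_prop
  have h4 := h2.unique (h3.congr_of_eventuallyEq (hcs.eventually hg1))
  rw [hsymm.eq, h4] at h1
  exact h1.congr_of_eventuallyEq (by filter_upwards [hg2] with r hr using hr.symm)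

theorem IsLocalFlow.continuousAt_orbit (hΦ : IsLocalFlow Ω X D Φ) {t : ℝ} {p : Jet m n}
    (hp : (t, p) ∈ D) : ContinuousAt (fun t => Φ t p) t :=
  continuousAt_pi.2 fun c => (hΦ.ode t p hp c).continuousAt

variable {h : ℕ} {Xs : Fin h → Jet m n → Jet m n}

/-- The flow preserves its vector field: both sides solve the variational equation along the orbit,
and have the same initial value. -/
theorem IsLocalFlow.pushDeriv_self (hΩ : IsOpen Ω) (hXs : HasCommonFiltration Ω Xs) {i : Fin h}
    (hΦ : IsLocalFlow Ω (Xs i) D Φ) (hX : ∀ p ∈ Ω, CylAt (Xs i) p)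
    {t : ℝ} {q : ℝ → Jet m n} (hq : CylAt q 0) (hp : (t, q 0) ∈ D)
    (hv : ∀ c, HasDerivAt (fun s => q s c) (Xs i (q 0) c) 0) :
    pushDeriv Φ q t = Xs i (Φ t (q 0)) := by
  have hD : ∀ τ ∈ uIcc 0 t, (τ, q 0) ∈ D := fun τ hτ => hΦ.mem_of_mem_uIcc hp hτ
  have hmem : ∀ τ ∈ uIcc 0 t, Φ τ (q 0) ∈ Ω := fun τ hτ => (hΦ.mapsTo _ _ (hD τ hτ)).2
  rw [← sub_eq_zero]
  refine transport_eq_zero hΩ hXs i (η := fun _ _ => 0) (p := fun τ => Φ τ (q 0))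
    (y := fun τ => pushDeriv Φ q τ - Xs i (Φ τ (q 0))) (T := t)
    (fun r => ⟨∅, fun _ => 0, contDiffOn_const, fun _ _ => rfl⟩) hmem
    (fun τ hτ => hΦ.continuousAt_orbit (hD τ hτ)) ?_ (fun F hF τ hτ => ?_) t right_mem_uIcc
  · have h0 : q 0 ∈ Ω := (hΦ.mapsTo _ _ hp).1
    simp only [hΦ.pushDeriv_zero hΩ hq hv h0, hΦ.zero _ h0, sub_self]
  · have hXF : act (Xs i) F ∈ LocSmooth Ω := fun p hp => (hF p hp).act (hX p hp)
    have h1 := (hΦ.variation hX hq (hD τ hτ) hF).sub (hΦ.hasDerivAt_comp hXF (hD τ hτ))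
    have h0 : ∀ p v : Jet m n, lineDeriv ℝ (fun _ : Jet m n => (0 : ℝ)) p v = 0 := by
      intro p v; simp [lineDeriv]
    simp only [h0, zero_mul, Finset.sum_const_zero, add_zero]
    rw [(hXF _ (hmem τ hτ)).lineDeriv_sub]
    refine h1.congr_of_eventuallyEq ?_
    have hcD : ContinuousAt (fun τ => (τ, q 0)) τ := by fun_prop
    filter_upwards [hcD.eventually (hΦ.isOpen.mem_nhds (hD τ hτ))] with r hr
    exact (hF _ (hΦ.mapsTo _ _ hr).2).lineDeriv_sub _ _

/-- The derivative of `τ ↦ Φ_{-τ}(Φ_τ(p))` vanishes because the flow preserves its vector field. In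
infinite dimensions, where solutions of differential equations need not be unique, this replaces the
usual argument for the group property. -/
theorem IsLocalFlow.flow_neg_flow (hΩ : IsOpen Ω) (hXs : HasCommonFiltration Ω Xs) {i : Fin h}
    (hΦ : IsLocalFlow Ω (Xs i) D Φ) (hX : ∀ p ∈ Ω, CylAt (Xs i) p) {T : ℝ} {p : Jet m n}
    (hp : (T, p) ∈ D) (hback : ∀ τ ∈ uIcc 0 T, (-τ, Φ τ p) ∈ D) : Φ (-T) (Φ T p) = p := by
  funext c
  have hpΩ := (hΦ.mapsTo _ _ hp).1
  have key := linear_ode_eq_zero (ι := Unit) (T := T) (Y := fun τ _ => Φ (-τ) (Φ τ p) c - p c)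
    (A := fun _ _ _ => 0) (fun _ _ => continuousOn_const) (fun τ hτ _ => by
      have hD := hΦ.mem_of_mem_uIcc hp hτ
      have hq : CylAt (fun s => Φ (τ + s) p) 0 :=
        CylAt.comp (Q := fun s : ℝ => (τ + s, p)) (R := fun z : ℝ × Jet m n => Φ z.1 z.2)
          (p := 0) (hΦ.cylAt (by simpa using hD))
          ((cylAt_of_contDiff (by fun_prop)).prodMk (cylAt_const p 0))
      have hv : ∀ c, HasDerivAt (fun s => Φ (τ + s) p c) (Xs i (Φ (τ + 0) p) c) 0 := by
        intro c
        have := hΦ.ode (τ + 0) p (by simpa using hD) c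
        exact this.comp_const_add τ 0
      have hb : (-τ, Φ (τ + 0) p) ∈ D := by simpa using hback τ hτ
      have h1 := hΦ.pushDeriv_self hΩ hXs hX hq hb hv
      -- the two partial derivatives of `(r, s) ↦ Φ_{-r}(Φ_s(p))` cancel on the diagonal
      have hc : CylAt (fun z : ℝ × ℝ => Φ (-τ - z.1) (Φ (τ + z.2) p)) (0, 0) := by
        refine CylAt.comp (Q := fun z : ℝ × ℝ => (-τ - z.1, Φ (τ + z.2) p))
          (R := fun z : ℝ × Jet m n => Φ z.1 z.2) (p := (0, 0))
          (hΦ.cylAt (by simpa using hb)) ((cylAt_of_contDiff (by fun_prop)).prodMk ?_)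
        exact CylAt.comp (R := fun s => Φ (τ + s) p) (Q := fun z : ℝ × ℝ => z.2) hq
          (cylAt_id _).snd
      have hd := (hc.apply c).contDiffAt.differentiableAt (by simp)
      set B := fderiv ℝ (fun z : ℝ × ℝ => Φ (-τ - z.1) (Φ (τ + z.2) p) c) (0, 0) with hB
      have e1 : B (1, 0) = -Xs i (Φ (-τ) (Φ τ p)) c := by
        have ho := hΦ.ode (-τ - 0) (Φ (τ + 0) p) (by simpa using hb) c
        have h2 := (hasDerivAt_slice_fst hd).unique (ho.comp_const_sub (-τ) 0)
        rwa [sub_zero, add_zero] at h2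
      have e2 : B (0, 1) = Xs i (Φ (-τ) (Φ τ p)) c := by
        have ho := hΦ.hasDerivAt_push hq hb c
        have h2 := hasDerivAt_slice_snd hd
        simp only [sub_zero] at h2
        rw [h2.unique ho, h1, add_zero]
      have hl : HasDerivAt (fun r : ℝ => (r - τ, r - τ)) ((1, 1) : ℝ × ℝ) τ :=
        ((hasDerivAt_id _).sub_const _).prodMk ((hasDerivAt_id _).sub_const _)
      have hd' : HasFDerivAt (fun z : ℝ × ℝ => Φ (-τ - z.1) (Φ (τ + z.2) p) c) B
          (τ - τ, τ - τ) := by simpa using hd.hasFDerivAt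
      have h3 := (hd'.comp_hasDerivAt τ hl).sub_const (p c)
      have e3 : B (1, 1) = 0 := by
        have : ((1, 1) : ℝ × ℝ) = (1, 0) + (0, 1) := by simp
        rw [this, map_add, e1, e2, neg_add_cancel]
      simp only [zero_mul, Finset.sum_const_zero]
      rw [e3] at h3
      refine h3.congr_of_eventuallyEq (Eventually.of_forall fun r => ?_)
      have e4 : -τ - (r - τ) = -r := by ring
      simp [e4]) (by
      funext
      simp [hΦ.zero _ hpΩ]) T right_mem_uIcc
  exact sub_eq_zero.1 (congrFun key ())

/-- Near time `0` the flow in negative time is inverse to the flow. -/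
theorem IsLocalFlow.eventually_flow_neg_flow (hΩ : IsOpen Ω) (hXs : HasCommonFiltration Ω Xs)
    {i : Fin h} (hΦ : IsLocalFlow Ω (Xs i) D Φ) (hX : ∀ p ∈ Ω, CylAt (Xs i) p) {p₀ : Jet m n}
    (hp₀ : p₀ ∈ Ω) : ∀ᶠ z : ℝ × Jet m n in 𝓝 (0, p₀), Φ (-z.1) (Φ z.1 z.2) = z.2 := by
  have h0 := hΦ.zero_mem p₀ hp₀
  have hc : ContinuousAt (fun z : ℝ × Jet m n => (-z.1, Φ z.1 z.2)) (0, p₀) :=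
    continuousAt_fst.neg.prodMk (hΦ.cylAt h0).continuousAt
  have h1 : ∀ᶠ z : ℝ × Jet m n in 𝓝 (0, p₀), z ∈ D ∧ (-z.1, Φ z.1 z.2) ∈ D := by
    refine Eventually.and (hΦ.isOpen.mem_nhds h0) (hc.eventually (hΦ.isOpen.mem_nhds ?_))
    simpa [hΦ.zero p₀ hp₀] using h0
  rw [nhds_prod_eq, eventually_prod_iff] at h1
  obtain ⟨P, hP, Q, hQ, hPQ⟩ := h1
  obtain ⟨ε, hε, hball⟩ := Metric.eventually_nhds_iff_ball.1 hP
  rw [nhds_prod_eq]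
  filter_upwards [prod_mem_prod (Metric.ball_mem_nhds 0 hε) hQ] with z hz
  refine hΦ.flow_neg_flow hΩ hXs hX (hPQ (hball _ hz.1) hz.2).1 fun τ hτ => ?_
  refine (hPQ (hball τ ?_) hz.2).2
  exact (convex_ball (0 : ℝ) ε).ordConnected.uIcc_subset (Metric.mem_ball_self hε) hz.1 hτ

end Flow

/-! ### Transport of vectors modulo the total derivatives -/

section Vertical

variable {m n h : ℕ} {Ω : Set (Jet m n)}

/-- The vertical part of a tangent vector `v` of the jet space at `p`: the difference of `v` and of
the combination of the total derivatives that has the same projection to the base. -/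
noncomputable def vert (p v : Jet m n) : Jet m n := v - ∑ r, v (Sum.inl r) • totalField r p

theorem lineDeriv_vert {F : Jet m n → ℝ} {p : Jet m n} (hF : CylAt F p) (v : Jet m n) :
    lineDeriv ℝ F p (vert p v) =
      lineDeriv ℝ F p v - ∑ r, v (Sum.inl r) * act (totalField r) F p := by
  simp only [vert, hF.lineDeriv_sub, hF.lineDeriv_sum, hF.lineDeriv_smul, smul_eq_mul]
  rfl

theorem charField_inl (G : Fin n → Jet m n → ℝ) (η : Fin m → Jet m n → ℝ) (p : Jet m n)
    (r : Fin m) : charField G η p (Sum.inl r) = -η r p := by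
  simp [charField, evolField, totalField, Finset.sum_apply, Pi.single_apply]

theorem vert_charField (G : Fin n → Jet m n → ℝ) (η : Fin m → Jet m n → ℝ) (p : Jet m n) :
    vert p (charField G η p) = evolField G p := by
  simp only [vert, charField_inl]
  simp [charField]

theorem vert_add (p v w : Jet m n) : vert p (v + w) = vert p v + vert p w := by
  simp only [vert, Pi.add_apply, add_smul, Finset.sum_add_distrib]
  abel

theorem vert_smul (p : Jet m n) (a : ℝ) (v : Jet m n) : vert p (a • v) = a • vert p v := by
  simp only [vert, Pi.smul_apply, smul_sub, smul_eq_mul, mul_smul, Finset.smul_sum]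

/-- The algebra behind `vert_pushDeriv`: in the derivative of `y = v - ∑ v^r D_r - ∑ c^k V_{G_k}`,
applied to a function `F`, the terms with `λ` cancel against the derivatives `c'` of the coefficients,
and the remaining ones combine to `y` acting on `X(F)` and on the functions `η^s`. Here `e`, `De` and
`Ve` stand for the derivatives of `η^s` in the directions `v`, `D_r` and `V_{G_k}`, and `w` for the
base components of `v`. -/
theorem transport_identity {c c' VF VX : Fin h → ℝ} {e Df w DX : Fin m → ℝ}
    {De : Fin m → Fin m → ℝ} {Ve : Fin h → Fin m → ℝ} {l : Fin h → Fin h → ℝ} (a : ℝ)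
    (hc' : ∀ k, c' k = -∑ p, c p * l p k) :
    a - (∑ r, (-e r * Df r + w r * (DX r + ∑ s, De r s * Df s))) -
        (∑ k, (c' k * VF k + c k * (VX k + (∑ p, l k p * VF p) + ∑ s, Ve k s * Df s))) =
      (a - (∑ r, w r * DX r) - ∑ k, c k * VX k) +
        ∑ s, (e s - (∑ r, w r * De r s) - ∑ k, c k * Ve k s) * Df s := by
  have h1 : ∑ r, w r * ∑ s, De r s * Df s = ∑ s, (∑ r, w r * De r s) * Df s := by
    simp only [Finset.mul_sum, Finset.sum_mul]
    rw [Finset.sum_comm]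
    simp only [mul_assoc]
  have h2 : ∑ k, c k * ∑ s, Ve k s * Df s = ∑ s, (∑ k, c k * Ve k s) * Df s := by
    simp only [Finset.mul_sum, Finset.sum_mul]
    rw [Finset.sum_comm]
    simp only [mul_assoc]
  have h3 : ∑ k, c k * ∑ p, l k p * VF p = -∑ k, c' k * VF k := by
    simp only [hc', Finset.mul_sum, Finset.sum_mul, neg_mul, Finset.sum_neg_distrib, neg_neg]
    rw [Finset.sum_comm]
    simp only [mul_assoc]
  simp only [mul_add, sub_mul, Finset.sum_add_distrib, Finset.sum_sub_distrib, h1, h2, h3, neg_mul,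
    Finset.sum_neg_distrib]
  ring

variable {G : Fin h → Fin n → Jet m n → ℝ} {lam : Fin h → Fin h → Fin h → ℝ}
  {η : Fin h → Fin m → Jet m n → ℝ} {D : Set (ℝ × Jet m n)} {Φ : ℝ → Jet m n → Jet m n}

/-- A characteristic flow transports combinations of the fields `V_{G_k}`, modulo the total
derivatives, to combinations of these fields. The coefficients solve the linear differential
equation that is given by the constants `λ_{ij}^k`. -/
theorem vert_pushDeriv (hΩ : IsOpen Ω) (hG : ∀ i j, G i j ∈ LocSmooth Ω)
    (hLie : ∀ i j α, ∀ p ∈ Ω, bracket (G i) (G j) α p = ∑ k, lam i j k * G k α p)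
    (hη : ∀ i r, η i r ∈ smoothFns Ω)
    (hXs : HasCommonFiltration Ω fun i => charField (G i) (η i)) {i : Fin h}
    (hΦ : IsLocalFlow Ω (charField (G i) (η i)) D Φ) {t : ℝ} {q : ℝ → Jet m n} (hq : CylAt q 0)
    (hp : (t, q 0) ∈ D) {v : Jet m n} (hv : ∀ c, HasDerivAt (fun s => q s c) (v c) 0)
    {c : ℝ → Fin h → ℝ} (hc : ∀ τ k, HasDerivAt (fun τ => c τ k) (-∑ l, c τ l * lam i l k) τ)
    (hv0 : vert (q 0) v = ∑ k, c 0 k • evolField (G k) (q 0)) :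
    vert (Φ t (q 0)) (pushDeriv Φ q t) = ∑ k, c t k • evolField (G k) (Φ t (q 0)) := by
  have hη' : ∀ r, η i r ∈ LocSmooth Ω := fun r => smoothFns_subset hΩ (hη i r)
  have hD : ∀ τ ∈ uIcc 0 t, (τ, q 0) ∈ D := fun τ hτ => hΦ.mem_of_mem_uIcc hp hτ
  have hmem : ∀ τ ∈ uIcc 0 t, Φ τ (q 0) ∈ Ω := fun τ hτ => (hΦ.mapsTo _ _ (hD τ hτ)).2
  have hX : ∀ p ∈ Ω, CylAt (charField (G i) (η i)) p := fun p hp => cylAt_charField (hG i) hη' hp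
  -- the action of the difference of the two sides on functions
  have hy : ∀ τ, (τ, q 0) ∈ D → ∀ F ∈ LocSmooth Ω, lineDeriv ℝ F (Φ τ (q 0))
      (vert (Φ τ (q 0)) (pushDeriv Φ q τ) - ∑ k, c τ k • evolField (G k) (Φ τ (q 0))) =
      lineDeriv ℝ F (Φ τ (q 0)) (pushDeriv Φ q τ) -
        (∑ r, pushDeriv Φ q τ (Sum.inl r) * act (totalField r) F (Φ τ (q 0))) -
        ∑ k, c τ k * act (evolField (G k)) F (Φ τ (q 0)) := by
    intro τ hτ F hF
    have hFp := hF _ (hΦ.mapsTo _ _ hτ).2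
    rw [hFp.lineDeriv_sub, lineDeriv_vert hFp, hFp.lineDeriv_sum]
    simp only [hFp.lineDeriv_smul, smul_eq_mul]
    rfl
  rw [← sub_eq_zero]
  refine transport_eq_zero hΩ hXs i (hη i) (p := fun τ => Φ τ (q 0))
    (y := fun τ => vert (Φ τ (q 0)) (pushDeriv Φ q τ) -
      ∑ k, c τ k • evolField (G k) (Φ τ (q 0))) (T := t) hmem
    (fun τ hτ => hΦ.continuousAt_orbit (hD τ hτ)) ?_ (fun F hF τ hτ => ?_) t right_mem_uIcc
  · have h0 : q 0 ∈ Ω := (hΦ.mapsTo _ _ hp).1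
    simp only [hΦ.pushDeriv_zero hΩ hq hv h0, hΦ.zero _ h0, hv0, sub_self]
  · have hcD : ContinuousAt (fun τ => (τ, q 0)) τ := by fun_prop
    have hXF := charField_act_mem (hG i) hη' hF
    simp only [hy τ (hD τ hτ) _ hXF, fun s => hy τ (hD τ hτ) _ (hη' s)]
    have h1 := hΦ.variation hX hq (hD τ hτ) hF
    have h2 : ∀ r, HasDerivAt (fun τ => pushDeriv Φ q τ (Sum.inl r))
        (-lineDeriv ℝ (η i r) (Φ τ (q 0)) (pushDeriv Φ q τ)) τ := by
      intro r
      have := hΦ.variation hX hq (hD τ hτ) (coord_mem_locSmooth (Sum.inl r))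
      simp only [lineDeriv_coord, act_coord, charField_inl] at this
      convert this using 1
      exact (((hη' r _ (hmem τ hτ)).hasLineDerivAt _).fun_neg.deriv).symm
    have h3 := fun r => hΦ.hasDerivAt_comp (totalField_act_mem r hF) (hD τ hτ)
    have h4 := fun k => hΦ.hasDerivAt_comp (evolField_act_mem (hG k) hF) (hD τ hτ)
    have h5 := (h1.sub (HasDerivAt.fun_sum fun r (_ : r ∈ Finset.univ) => (h2 r).mul (h3 r))).sub
      (HasDerivAt.fun_sum fun k (_ : k ∈ Finset.univ) => (hc τ k).mul (h4 k))
    simp only [fun r => charField_totalField hΩ (hG i) hη' hF r (hmem τ hτ),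
      fun k => charField_evolField hΩ hG hLie hη' i k hF (hmem τ hτ)] at h5
    rw [transport_identity _ fun k => rfl] at h5
    refine h5.congr_of_eventuallyEq ?_
    filter_upwards [hcD.eventually (hΦ.isOpen.mem_nhds (hD τ hτ))] with r hr
    rw [hy r hr F hF]
    rfl

end Vertical

/-! ### The coefficients of the generators on the solution manifold -/

section Coefficients

variable {h : ℕ} (lam : Fin h → Fin h → Fin h → ℝ)

/-- The linear map `e_k ↦ ∑ λ_{ik}^p e_p`, that is, `ad(G_i)` in terms of the generators. -/
noncomputable def adOp (i : Fin h) : (Fin h → ℝ) →L[ℝ] (Fin h → ℝ) :=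
  LinearMap.toContinuousLinearMap (Matrix.vecMulLinear (Matrix.of (lam i)))

theorem adOp_apply (i : Fin h) (c : Fin h → ℝ) (p : Fin h) :
    adOp lam i c p = ∑ k, c k * lam i k p := rfl

/-- The exponential of `t ad(G_i)`. -/
noncomputable def adExp (i : Fin h) (t : ℝ) : (Fin h → ℝ) →L[ℝ] (Fin h → ℝ) :=
  NormedSpace.exp (t • adOp lam i)

theorem adExp_zero (i : Fin h) : adExp lam i 0 = 1 := by
  rw [adExp, zero_smul, NormedSpace.exp_zero]

theorem hasDerivAt_adExp (i : Fin h) (t : ℝ) :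
    HasDerivAt (adExp lam i) (adOp lam i * adExp lam i t) t :=
  hasDerivAt_exp_smul_const' (adOp lam i) t

theorem contDiff_adExp (i : Fin h) : ContDiff ℝ ∞ (adExp lam i) := by
  have h1 : ContDiff ℝ ∞ (NormedSpace.exp : ((Fin h → ℝ) →L[ℝ] (Fin h → ℝ)) → _) :=
    AnalyticOnNhd.contDiff fun x _ => NormedSpace.exp_analytic (𝕂 := ℝ) x
  exact h1.comp (contDiff_id.smul contDiff_const)

/-- The coefficients of the derivative of `Φ^1_{-b^1} ∘ … ∘ Φ^h_{-b^h}` in the direction `-ε` of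
the parameters `b`, in terms of the generators and modulo the total derivatives. The list consists
of the indices of the flows. -/
noncomputable def paramOp (b : Fin h → ℝ) (l : List (Fin h)) : (Fin h → ℝ) →L[ℝ] (Fin h → ℝ) :=
  l.foldr (fun i M => adExp lam i (b i) * M +
    (ContinuousLinearMap.proj (R := ℝ) (φ := fun _ : Fin h => ℝ) i).smulRight (Pi.single i 1)) 0

theorem paramOp_cons (b : Fin h → ℝ) (i : Fin h) (l : List (Fin h)) (ε : Fin h → ℝ) :
    paramOp lam b (i :: l) ε = adExp lam i (b i) (paramOp lam b l ε) + ε i • Pi.single i 1 := rfl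

theorem contDiff_paramOp (l : List (Fin h)) : ContDiff ℝ ∞ fun b => paramOp lam b l := by
  induction l with
  | nil => exact contDiff_const
  | cons i l ih =>
    exact (((contDiff_adExp lam i).comp (contDiff_apply ℝ ℝ i)).mul ih).add contDiff_const

theorem paramOp_congr {b b' : Fin h → ℝ} {l : List (Fin h)} (hb : ∀ i ∈ l, b i = b' i) :
    paramOp lam b l = paramOp lam b' l := by
  induction l with
  | nil => rfl
  | cons i l ih =>
    ext1 ε
    rw [paramOp_cons, paramOp_cons, ih fun j hj => hb j (List.mem_cons_of_mem _ hj),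
      hb i List.mem_cons_self]

theorem paramOp_single_of_notMem (b : Fin h → ℝ) {l : List (Fin h)} {i : Fin h} (hi : i ∉ l) :
    paramOp lam b l (Pi.single i 1) = 0 := by
  induction l with
  | nil => rfl
  | cons j l ih =>
    rw [List.mem_cons, not_or] at hi
    rw [paramOp_cons, ih hi.2, map_zero, Pi.single_eq_of_ne (Ne.symm hi.1), zero_smul, add_zero]

theorem paramOp_single {b : Fin h → ℝ} {l : List (Fin h)} (hl : l.Pairwise (· < ·)) {i : Fin h}
    (hi : i ∈ l) (hb : ∀ j < i, b j = 0) :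
    paramOp lam b l (Pi.single i 1) = Pi.single i 1 := by
  induction l with
  | nil => simp at hi
  | cons j l ih =>
    rw [List.pairwise_cons] at hl
    rw [paramOp_cons]
    rcases eq_or_ne i j with rfl | hij
    · rw [paramOp_single_of_notMem lam b fun hm => lt_irrefl _ (hl.1 _ hm), map_zero,
        Pi.single_eq_same, one_smul, zero_add]
    · have hil : i ∈ l := by simpa [hij] using hi
      rw [ih hl.2 hil, hb j (hl.1 i hil), adExp_zero, Pi.single_eq_of_ne (Ne.symm hij), zero_smul,
        add_zero]
      rfl

/-- The derivative with respect to `b^k`, at the points where the preceding parameters vanish. -/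
theorem hasDerivAt_paramOp {b : Fin h → ℝ} {l : List (Fin h)} (hl : l.Pairwise (· < ·)) {k : Fin h}
    (hk : k ∈ l) (hb : ∀ j < k, b j = 0) (ε : Fin h → ℝ) :
    HasDerivAt (fun t : ℝ => paramOp lam (b + t • Pi.single k 1) l ε)
      (adOp lam k (paramOp lam b l ε - fun r => if r ∈ l ∧ r ≤ k then ε r else 0)) 0 := by
  induction l with
  | nil => simp at hk
  | cons i l ih =>
    rw [List.pairwise_cons] at hl
    rcases eq_or_ne k i with rfl | hki
    · have hkl : k ∉ l := fun hm => lt_irrefl _ (hl.1 _ hm)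
      have h1 : ∀ t : ℝ, paramOp lam (b + t • Pi.single k 1) (k :: l) ε =
          adExp lam k (b k + t) (paramOp lam b l ε) + ε k • Pi.single k 1 := by
        intro t
        rw [paramOp_cons, paramOp_congr lam (b := b + t • Pi.single k 1) (b' := b)]
        · simp
        · intro i hi
          have : i ≠ k := fun h => hkl (h ▸ hi)
          simp [this]
      have h2 : (fun r => if r ∈ k :: l ∧ r ≤ k then ε r else 0) = ε k • Pi.single k (1 : ℝ) := by
        funext r
        by_cases hr : r = k
        · subst hr; simp
        · have : ¬(r ∈ l ∧ r ≤ k) := fun hh => absurd (hl.1 r hh.1) (not_lt.2 hh.2)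
          simp only [List.mem_cons, hr, false_or, this, if_false, Pi.smul_apply,
            Pi.single_eq_of_ne hr, smul_zero]
      rw [h2, paramOp_cons, add_sub_cancel_right, funext h1]
      have h3 : HasDerivAt (fun t => adExp lam k (b k + t)) (adOp lam k * adExp lam k (b k)) 0 := by
        have := hasDerivAt_adExp lam k (b k + 0)
        rw [add_zero] at this
        exact HasDerivAt.comp_const_add (f := adExp lam k) (b k) 0 (by rwa [add_zero])
      have h4 := (h3.clm_apply (hasDerivAt_const (0 : ℝ) (paramOp lam b l ε))).add_const
        (ε k • Pi.single k (1 : ℝ))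
      rw [map_zero, add_zero] at h4
      exact h4
    · have hkl : k ∈ l := by simpa [hki] using hk
      have hik := hl.1 k hkl
      have h1 : ∀ t : ℝ, paramOp lam (b + t • Pi.single k 1) (i :: l) ε =
          paramOp lam (b + t • Pi.single k 1) l ε + ε i • Pi.single i 1 := by
        intro t
        have : (b + t • Pi.single k (1 : ℝ) : Fin h → ℝ) i = 0 := by simp [hb i hik, hik.ne]
        rw [paramOp_cons, this, adExp_zero]
        rfl
      have h2 : (paramOp lam b (i :: l) ε - fun r => if r ∈ i :: l ∧ r ≤ k then ε r else 0) =
          paramOp lam b l ε - fun r => if r ∈ l ∧ r ≤ k then ε r else 0 := by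
        rw [paramOp_cons, hb i hik, adExp_zero]
        funext r
        by_cases hr : r = i
        · subst hr
          have : r ∉ l := fun hm => lt_irrefl _ (hl.1 _ hm)
          simp [this, hik.le]
        · simp [hr]
      rw [h2, funext h1]
      exact (ih hl.2 hkl).add_const _

/-- The linear map from the directions `ε` of the parameters to the coefficients of the
derivative of the inverse composed flow in the direction `-ε`. -/
noncomputable def coeffOp (b : Fin h → ℝ) : (Fin h → ℝ) →L[ℝ] (Fin h → ℝ) :=
  paramOp lam b (List.finRange h)

/-- The parameters at which the operator of the coefficients is invertible. -/
def coeffDomain : Set (Fin h → ℝ) := {b | IsUnit (coeffOp lam b)}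

/-- The direction of the parameters `(b^1, …, b^h)` that corresponds to the generator `G_i`. -/
noncomputable def genDir (i : Fin h) (b : Fin h → ℝ) : Fin h → ℝ :=
  -(Ring.inverse (coeffOp lam b) (Pi.single i 1))

/-- The coefficients `φ_i^l`. The coefficient of `∂_{a^0}` vanishes. -/
noncomputable def genCoeff (i : Fin h) (l : Fin (h + 1)) (b : Fin h → ℝ) : ℝ :=
  (Fin.cons 0 (genDir lam i b) : Fin (h + 1) → ℝ) l

theorem contDiff_coeffOp : ContDiff ℝ ∞ (coeffOp lam) := contDiff_paramOp lam _

theorem isOpen_coeffDomain : IsOpen (coeffDomain lam) :=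
  Units.isOpen.preimage (contDiff_coeffOp lam).continuous

theorem coeffOp_single {b : Fin h → ℝ} {i : Fin h} (hb : ∀ j < i, b j = 0) :
    coeffOp lam b (Pi.single i 1) = Pi.single i 1 :=
  paramOp_single lam (List.pairwise_lt_finRange h) (List.mem_finRange i) hb

theorem zero_mem_coeffDomain : (0 : Fin h → ℝ) ∈ coeffDomain lam := by
  have : coeffOp lam 0 = 1 := by
    refine ContinuousLinearMap.coe_injective (LinearMap.pi_ext' fun i => LinearMap.ext_ring ?_)
    exact coeffOp_single lam fun _ _ => rfl
  change IsUnit _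
  rw [this]
  exact isUnit_one

variable {lam} {b : Fin h → ℝ}

theorem coeffOp_injective (hb : b ∈ coeffDomain lam) : Function.Injective (coeffOp lam b) := by
  intro x y hxy
  have h1 := Ring.inverse_mul_cancel _ hb
  have h2 : ∀ x, Ring.inverse (coeffOp lam b) (coeffOp lam b x) = x := fun x =>
    congrArg (fun T : (Fin h → ℝ) →L[ℝ] (Fin h → ℝ) => T x) h1
  rw [← h2 x, hxy, h2]

theorem coeffOp_genDir (hb : b ∈ coeffDomain lam) (i : Fin h) :
    coeffOp lam b (genDir lam i b) = -Pi.single i 1 := by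
  have h1 := Ring.mul_inverse_cancel _ hb
  rw [genDir, map_neg]
  exact congrArg Neg.neg
    (congrArg (fun T : (Fin h → ℝ) →L[ℝ] (Fin h → ℝ) => T (Pi.single i 1)) h1)

theorem genDir_eq (hb : b ∈ coeffDomain lam) {i : Fin h} (hbi : ∀ j < i, b j = 0) :
    genDir lam i b = -Pi.single i 1 := by
  apply coeffOp_injective hb
  rw [coeffOp_genDir hb, map_neg, coeffOp_single lam hbi]

theorem contDiffAt_genDir (hb : b ∈ coeffDomain lam) (i : Fin h) :
    ContDiffAt ℝ ∞ (genDir lam i) b := by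
  obtain ⟨u, hu⟩ := hb
  have h1 : ContDiffAt ℝ ∞ (fun b => Ring.inverse (coeffOp lam b)) b :=
    ContDiffAt.comp (g := Ring.inverse) b (hu ▸ contDiffAt_ringInverse ℝ u)
      (contDiff_coeffOp lam).contDiffAt
  exact (h1.clm_apply contDiffAt_const).neg

theorem contDiffOn_genCoeff (i : Fin h) (l : Fin (h + 1)) :
    ContDiffOn ℝ ∞ (genCoeff lam i l) (coeffDomain lam) := by
  intro b hb
  refine ContDiffAt.contDiffWithinAt ?_
  refine Fin.cases ?_ (fun l => ?_) l
  · exact contDiffAt_const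
  · exact contDiffAt_pi.1 (contDiffAt_genDir hb i) l

theorem eq_neg_coeffOp_sum (hb : b ∈ coeffDomain lam) (x : Fin h → ℝ) :
    x = -coeffOp lam b (∑ p, x p • genDir lam p b) := by
  simp only [map_sum, map_smul, coeffOp_genDir hb, smul_neg, Finset.sum_neg_distrib, neg_neg]
  funext q
  simp [Finset.sum_apply, Pi.single_apply]

/-- The derivative with respect to `b^k` of the equation `coeffOp_genDir`, solved for the derivative of
`genDir lam i`. -/
theorem fderiv_genDir (hb : b ∈ coeffDomain lam) (i : Fin h) {k : Fin h} (hbk : ∀ j < k, b j = 0) :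
    fderiv ℝ (genDir lam i) b (Pi.single k 1) =
      -∑ p, (lam k i p + ∑ r ∈ Finset.Iic k, genDir lam i b r * lam k r p) • genDir lam p b := by
  set w := fderiv ℝ (genDir lam i) b (Pi.single k 1) with hw
  have hline : HasDerivAt (fun t : ℝ => b + t • Pi.single k (1 : ℝ)) (Pi.single k 1) 0 := by
    simpa using ((hasDerivAt_id (0 : ℝ)).smul_const (Pi.single k (1 : ℝ))).const_add b
  have hb0 : b + (0 : ℝ) • Pi.single k (1 : ℝ) = b := by simp
  have h1 : HasDerivAt (fun t : ℝ => genDir lam i (b + t • Pi.single k 1)) w 0 := by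
    refine HasFDerivAt.comp_hasDerivAt (l := genDir lam i) (0 : ℝ) ?_ hline
    rw [hb0]
    exact ((contDiffAt_genDir hb i).differentiableAt (by simp)).hasFDerivAt
  have h2 : HasDerivAt (fun t : ℝ => coeffOp lam (b + t • Pi.single k 1))
      (fderiv ℝ (coeffOp lam) b (Pi.single k 1)) 0 := by
    refine HasFDerivAt.comp_hasDerivAt (l := coeffOp lam) (0 : ℝ) ?_ hline
    rw [hb0]
    exact ((contDiff_coeffOp lam).contDiffAt.differentiableAt (by simp)).hasFDerivAt
  have h3 := h2.clm_apply h1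
  rw [hb0] at h3
  have h4 : fderiv ℝ (coeffOp lam) b (Pi.single k 1) (genDir lam i b) =
      adOp lam k (-Pi.single i 1 - fun r => if r ≤ k then genDir lam i b r else 0) := by
    have h5 := hasDerivAt_paramOp lam (List.pairwise_lt_finRange h) (List.mem_finRange k) hbk
      (genDir lam i b)
    simp only [List.mem_finRange, true_and] at h5
    change HasDerivAt (fun t : ℝ => coeffOp lam (b + t • Pi.single k 1) (genDir lam i b))
      (adOp lam k (coeffOp lam b (genDir lam i b) - _)) 0 at h5
    rw [coeffOp_genDir hb] at h5
    have h6 := h2.clm_apply (hasDerivAt_const (0 : ℝ) (genDir lam i b))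
    rw [map_zero, add_zero] at h6
    exact h6.unique h5
  have h7 : HasDerivAt (fun t : ℝ => coeffOp lam (b + t • Pi.single k 1)
      (genDir lam i (b + t • Pi.single k 1))) 0 0 := by
    refine (hasDerivAt_const (0 : ℝ) (-Pi.single i (1 : ℝ))).congr_of_eventuallyEq ?_
    have : ∀ᶠ t : ℝ in 𝓝 0, b + t • Pi.single k (1 : ℝ) ∈ coeffDomain lam :=
      hline.continuousAt.eventually ((isOpen_coeffDomain lam).mem_nhds (by simpa using hb))
    filter_upwards [this] with t ht using coeffOp_genDir ht i
  have h8 := h3.unique h7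
  rw [h4] at h8
  apply coeffOp_injective hb
  rw [map_neg, eq_neg_of_add_eq_zero_right h8, neg_inj]
  rw [eq_neg_coeffOp_sum hb (adOp lam k _), ← map_neg]
  congr 1
  rw [← Finset.sum_neg_distrib]
  refine Finset.sum_congr rfl fun p _ => ?_
  rw [← neg_smul]
  congr 1
  simp only [adOp_apply, Pi.sub_apply, Pi.neg_apply, sub_mul, neg_mul, Finset.sum_sub_distrib,
    Finset.sum_neg_distrib, neg_sub, ite_mul, zero_mul, Pi.single_apply, one_mul]
  rw [← Finset.sum_filter, ← Finset.sum_filter]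
  have e1 : Finset.univ.filter (fun r => r ≤ k) = Finset.Iic k := by ext; simp
  have e2 : Finset.univ.filter (fun r => r = i) = {i} := by ext; simp
  rw [e1, e2, Finset.sum_singleton]
  ring

theorem fderiv_genCoeff_succ (hb : b ∈ coeffDomain lam) (i l : Fin h) (v : Fin h → ℝ) :
    fderiv ℝ (genCoeff lam i l.succ) b v = fderiv ℝ (genDir lam i) b v l :=
  congrArg (fun T : (Fin h → ℝ) →L[ℝ] ℝ => T v)
    (hasFDerivAt_pi'.1
      ((contDiffAt_genDir hb i).differentiableAt (by simp)).hasFDerivAt l).fderiv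

theorem genCoeff_initial (hb : b ∈ coeffDomain lam) {i : Fin h} (hbi : ∀ j < i, b j = 0)
    (l : Fin (h + 1)) : genCoeff lam i l b = if l = i.succ then -1 else 0 := by
  rw [genCoeff, genDir_eq hb hbi]
  refine Fin.cases ?_ (fun l => ?_) l
  · simp [(Fin.succ_ne_zero i).symm]
  · simp only [Fin.cons_succ, Pi.neg_apply, Pi.single_apply, Fin.succ_inj]
    split_ifs <;> simp

/-- The sum over `Iic r` in `fderiv_genDir` vanishes here, as `genDir lam k b` is `-e_k`. -/
theorem fderiv_genDir_of_lt (hb : b ∈ coeffDomain lam) {r k : Fin h} (hrk : r < k)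
    (hbk : ∀ j < k, b j = 0) :
    fderiv ℝ (genDir lam k) b (Pi.single r 1) = -∑ p, lam r k p • genDir lam p b := by
  rw [fderiv_genDir hb k fun j hj => hbk j (hj.trans hrk), genDir_eq hb hbk]
  congr 1
  refine Finset.sum_congr rfl fun p _ => ?_
  rw [Finset.sum_eq_zero, add_zero]
  intro q hq
  have : q ≠ k := ((Finset.mem_Iic.1 hq).trans_lt hrk).ne
  simp [this]

theorem genCoeff_recursion (hanti : ∀ i j k, lam i j k = -lam j i k) (hb : b ∈ coeffDomain lam)
    (i : Fin h) {k : Fin h} (hbk : ∀ j < k, b j = 0) (l : Fin (h + 1)) :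
    fderiv ℝ (genCoeff lam i l) b (Pi.single k 1) =
      -(∑ p, lam k i p * genCoeff lam p l b) -
        ∑ r ∈ Finset.Iio k, genCoeff lam i r.succ b *
          fderiv ℝ (genCoeff lam k l) b (Pi.single r 1) := by
  refine Fin.cases ?_ (fun l => ?_) l
  · have : ∀ i, genCoeff lam i 0 = fun _ => 0 := fun i => rfl
    simp [this]
  · simp only [fderiv_genCoeff_succ hb]
    have h1 : ∀ r ∈ Finset.Iio k, genCoeff lam i r.succ b *
        fderiv ℝ (genDir lam k) b (Pi.single r 1) l =
        genDir lam i b r * ∑ p, lam k r p * genDir lam p b l := by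
      intro r hr
      rw [fderiv_genDir_of_lt hb (Finset.mem_Iio.1 hr) hbk]
      simp only [Pi.neg_apply, Finset.sum_apply, Pi.smul_apply, smul_eq_mul, hanti r k, neg_mul,
        Finset.sum_neg_distrib, neg_neg]
      rfl
    rw [Finset.sum_congr rfl h1, fderiv_genDir hb i hbk]
    -- the term with `r = k` of the sum over `r ≤ k` vanishes
    have hkk : ∀ p, lam k k p = 0 := fun p => by linarith [hanti k k p]
    have h2 : ∀ p, ∑ r ∈ Finset.Iic k, genDir lam i b r * lam k r p =
        ∑ r ∈ Finset.Iio k, genDir lam i b r * lam k r p := by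
      intro p
      rw [← Finset.Iio_insert, Finset.sum_insert (by simp), hkk, mul_zero, zero_add]
    simp only [h2, Pi.neg_apply, Finset.sum_apply, Pi.smul_apply, smul_eq_mul, add_mul,
      Finset.sum_add_distrib, neg_add, ← sub_eq_add_neg]
    congr 1
    simp only [Finset.sum_mul, Finset.mul_sum]
    rw [Finset.sum_comm]
    simp only [mul_assoc]

end Coefficients

/-! ### Implicit functions of finitely many coordinates -/

section Implicit

variable {Y X : Type} [NormedAddCommGroup Y] [NormedSpace ℝ Y] [FiniteDimensional ℝ Y]
  [NormedAddCommGroup X] [NormedSpace ℝ X] [FiniteDimensional ℝ X]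

/-- If the partial differential of `Q` in the direction of the first factor is injective, then
`(y, x) ↦ (Q(y, x), x)` is a local diffeomorphism. -/
theorem exists_local_diffeo {Q : Y × X → Y} {z₀ : Y × X}
    (hQ : ∀ᶠ z in 𝓝 z₀, ContDiffAt ℝ ∞ Q z) (hinj : ∀ v, fderiv ℝ Q z₀ (v, 0) = 0 → v = 0) :
    ∃ T : OpenPartialHomeomorph (Y × X) (Y × X), z₀ ∈ T.source ∧
      (∀ z ∈ T.source, T z = (Q z, z.2)) ∧ ContDiffOn ℝ ∞ T.symm T.target := by
  have : CompleteSpace Y := FiniteDimensional.complete ℝ Y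
  have : CompleteSpace X := FiniteDimensional.complete ℝ X
  set f : Y × X → Y × X := fun z => (Q z, z.2) with hf
  have hfs : ∀ᶠ z in 𝓝 z₀, ContDiffAt ℝ ∞ f z := by
    filter_upwards [hQ] with z hz using hz.prodMk contDiffAt_snd
  have hfd : HasFDerivAt f ((fderiv ℝ Q z₀).prod (.snd ℝ Y X)) z₀ :=
    ((hQ.self_of_nhds.differentiableAt (by simp)).hasFDerivAt).prodMk hasFDerivAt_snd
  have hker : Function.Injective ((fderiv ℝ Q z₀).prod (.snd ℝ Y X)) := by
    rw [injective_iff_map_eq_zero]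
    rintro ⟨v, w⟩ hvw
    simp only [ContinuousLinearMap.prod_apply, ContinuousLinearMap.coe_snd', Prod.mk_eq_zero] at hvw
    obtain ⟨h1, rfl⟩ := hvw
    rw [hinj v h1, Prod.mk_zero_zero]
  let e : (Y × X) ≃L[ℝ] (Y × X) := (LinearEquiv.ofInjectiveEndo
    ((fderiv ℝ Q z₀).prod (.snd ℝ Y X) : Y × X →ₗ[ℝ] Y × X) hker).toContinuousLinearEquiv
  have he : (e : Y × X →L[ℝ] Y × X) = (fderiv ℝ Q z₀).prod (.snd ℝ Y X) := by
    exact ContinuousLinearMap.ext fun v => rfl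
  have hunit : ∀ᶠ z in 𝓝 z₀, IsUnit (fderiv ℝ f z) := by
    have hc : ContinuousAt (fderiv ℝ f) z₀ :=
      (hfs.self_of_nhds.fderiv_right (m := ∞) (by simp)).continuousAt
    refine hc.eventually (Units.isOpen.mem_nhds ?_)
    change IsUnit _
    rw [hfd.fderiv, ← he]
    exact (ContinuousLinearEquiv.toUnit e).isUnit
  obtain ⟨U, hU, hUo, hzU⟩ := eventually_nhds_iff.1 (hfs.and hunit)
  have hfd' : HasFDerivAt f (e : Y × X →L[ℝ] Y × X) z₀ := by rw [he]; exact hfd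
  let T₀ := hfs.self_of_nhds.toOpenPartialHomeomorph f hfd' (by simp)
  have hT₀ : ∀ z, T₀ z = f z := fun _ => rfl
  refine ⟨T₀.restrOpen U hUo, ?_, fun z _ => rfl, ?_⟩
  · exact ⟨hfs.self_of_nhds.mem_toOpenPartialHomeomorph_source hfd' (by simp), hzU⟩
  · intro w hw
    have hs := (T₀.restrOpen U hUo).map_target hw
    have hsU : (T₀.restrOpen U hUo).symm w ∈ U := hs.2
    obtain ⟨u, hu⟩ := (hU _ hsU).2
    refine (OpenPartialHomeomorph.contDiffAt_symm (T₀.restrOpen U hUo)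
      (f₀' := ContinuousLinearEquiv.ofUnit u) hw ?_ (hU _ hsU).1).contDiffWithinAt
    have h1 := (((hU _ hsU).1).differentiableAt (by simp)).hasFDerivAt
    rw [← hu] at h1
    exact h1

variable {I : Type}

theorem CylAt.exists_finset_rep {Z P : Type} [NormedAddCommGroup Z] [NormedSpace ℝ Z]
    [NormedAddCommGroup P] [NormedSpace ℝ P] {Q : P × (I → ℝ) → Z} {z₀ : P × (I → ℝ)}
    (hQ : CylAt Q z₀) :
    ∃ (S : Finset I) (g : P × (S → ℝ) → Z),
      (∀ᶠ y in 𝓝 (z₀.1, S.restrict z₀.2), ContDiffAt ℝ ∞ g y) ∧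
      ∀ᶠ z in 𝓝 z₀, Q z = g (z.1, S.restrict z.2) := by
  classical
  obtain ⟨V, _, _, L, g, hg, hLg⟩ := hQ.exists_rep
  obtain ⟨S, hS⟩ := exists_finset_clm (L.comp (.inr ℝ P (I → ℝ)))
  let K : P × (S → ℝ) → V := fun y => L (y.1, 0) + ∑ c : S, y.2 c • L (0, Pi.single (c : I) 1)
  have hK : ContDiff ℝ ∞ K := by
    have h1 : ContDiff ℝ ∞ fun y : P × (S → ℝ) => (L.comp (.inl ℝ P (I → ℝ))) y.1 := by fun_prop
    refine ContDiff.add h1 (ContDiff.sum fun c _ => ContDiff.smul ?_ contDiff_const)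
    fun_prop
  have hKL : ∀ z : P × (I → ℝ), K (z.1, S.restrict z.2) = L z := by
    intro z
    have h1 := hS z.2
    rw [← Finset.sum_coe_sort] at h1
    have h2 : L z = L (z.1, 0) + L (0, z.2) := by rw [← map_add]; simp
    rw [h2]
    exact congrArg _ h1.symm
  refine ⟨S, fun y => g (K y), ?_, ?_⟩
  · rw [← hKL z₀] at hg
    filter_upwards [hK.continuous.continuousAt.eventually hg] with y hy
    exact hy.comp y hK.contDiffAt
  · filter_upwards [hLg] with z hz
    rw [hz, hKL]

/-- Implicit functions on the jet space: existence, and uniqueness near the given solution. -/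
theorem exists_implicit {m n : ℕ} {Q : Y × Jet m n → Y} {p₀ : Jet m n} (hQ : CylAt Q (0, p₀))
    (h0 : Q (0, p₀) = 0) {A : Y → Y} (hA : ∀ v, HasDerivAt (fun s : ℝ => Q (s • v, p₀)) (A v) 0)
    (hinj : ∀ v, A v = 0 → v = 0) :
    (∃ (U : Set (Jet m n)) (a : Jet m n → Y), IsOpen U ∧ p₀ ∈ U ∧ a p₀ = 0 ∧
      (∀ L : Y →L[ℝ] ℝ, (fun p => L (a p)) ∈ smoothFns U) ∧ ∀ p ∈ U, Q (a p, p) = 0) ∧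
    ∀ᶠ z : (Y × Y) × Jet m n in 𝓝 ((0, 0), p₀),
      Q (z.1.1, z.2) = 0 → Q (z.1.2, z.2) = 0 → z.1.1 = z.1.2 := by
  obtain ⟨S, g, hg, hQg⟩ := hQ.exists_finset_rep
  have hAg : ∀ v, fderiv ℝ g (0, S.restrict p₀) (v, 0) = A v := by
    intro v
    have hl : HasDerivAt (fun s : ℝ => (s • v, S.restrict p₀)) ((v, 0) : Y × (S → ℝ)) 0 := by
      have h1 : HasDerivAt (fun s : ℝ => s • v) v 0 := by
        simpa using (hasDerivAt_id (0 : ℝ)).smul_const v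
      exact h1.prodMk (hasDerivAt_const _ _)
    have h2 := HasFDerivAt.comp_hasDerivAt (l := g) (l' := fderiv ℝ g (0, S.restrict p₀)) (0 : ℝ)
      (by rw [zero_smul]; exact (hg.self_of_nhds.differentiableAt (by simp)).hasFDerivAt) hl
    refine h2.unique ((hA v).congr_of_eventuallyEq ?_)
    have hc : ContinuousAt (fun s : ℝ => (s • v, p₀)) 0 := by fun_prop
    have h3 := hc.eventually (p := fun z => Q z = g (z.1, S.restrict z.2)) (by simpa using hQg)
    filter_upwards [h3] with s hs using hs.symm
  obtain ⟨T, hT0, hT, hTs⟩ := exists_local_diffeo hg fun v hv => hinj v ((hAg v).symm.trans hv)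
  have hg0 : g (0, S.restrict p₀) = 0 := hQg.self_of_nhds.symm.trans h0
  have hTz : T (0, S.restrict p₀) = (0, S.restrict p₀) := by rw [hT _ hT0, hg0]
  have hSc : Continuous fun p : Jet m n => S.restrict p :=
    continuous_pi fun c => continuous_apply _
  constructor
  · let O : Set (S → ℝ) := {y | ((0 : Y), y) ∈ T.target}
    have hO : IsOpen O := T.open_target.preimage (by fun_prop)
    have hp0O : S.restrict p₀ ∈ O := by
      have := T.map_source hT0
      rwa [hTz] at this
    let α : (S → ℝ) → Y := fun y => (T.symm (0, y)).1
    have hα : ContDiffOn ℝ ∞ α O :=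
      contDiff_fst.comp_contDiffOn (hTs.comp (by fun_prop) fun y hy => hy)
    have hα0 : α (S.restrict p₀) = 0 := by
      have := T.left_inv hT0
      rw [hTz] at this
      simp only [α, this]
    have hca : ContinuousAt (fun p : Jet m n => (α (S.restrict p), p)) p₀ :=
      (ContinuousAt.comp (f := fun p : Jet m n => S.restrict p)
        (hα.continuousOn.continuousAt (hO.mem_nhds hp0O)) hSc.continuousAt).prodMk continuousAt_id
    have h1 : ∀ᶠ p in 𝓝 p₀, (S.restrict p : S → ℝ) ∈ O ∧
        Q (α (S.restrict p), p) = g (α (S.restrict p), S.restrict p) :=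
      Eventually.and (hSc.continuousAt.preimage_mem_nhds (hO.mem_nhds hp0O))
        (hca.eventually (p := fun z => Q z = g (z.1, S.restrict z.2)) (by
          change ∀ᶠ z in 𝓝 (α (S.restrict p₀), p₀), _
          rw [hα0]
          exact hQg))
    obtain ⟨U, hU, hUo, hpU⟩ := eventually_nhds_iff.1 h1
    refine ⟨U, fun p => α (S.restrict p), hUo, hpU, hα0, fun L => ?_, fun p hp => ?_⟩
    · refine ⟨S, fun y => L (α y), (L.contDiff.comp_contDiffOn hα).mono ?_, fun _ _ => rfl⟩
      rintro _ ⟨p, hp, rfl⟩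
      exact (hU p hp).1
    · rw [(hU p hp).2]
      have h2 := T.right_inv (hU p hp).1
      rw [hT _ (T.map_target (hU p hp).1)] at h2
      have h3 : T.symm (0, S.restrict p) = (α (S.restrict p), S.restrict p) :=
        Prod.ext rfl (by simpa using congrArg Prod.snd h2)
      rw [← h3]
      exact congrArg Prod.fst h2
  · have hc : ∀ K : Y × Y →L[ℝ] Y, ∀ᶠ z : (Y × Y) × Jet m n in 𝓝 ((0, 0), p₀),
        Q (K z.1, z.2) = g (K z.1, S.restrict z.2) ∧ (K z.1, S.restrict z.2) ∈ T.source := by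
      intro K
      have h1 : ContinuousAt (fun z : (Y × Y) × Jet m n => (K z.1, z.2)) ((0, 0), p₀) := by
        fun_prop
      have h2 : ContinuousAt (fun z : (Y × Y) × Jet m n => (K z.1, S.restrict z.2))
          ((0, 0), p₀) := by fun_prop
      refine Eventually.and (h1.eventually (p := fun z => Q z = g (z.1, S.restrict z.2)) ?_)
        (h2.preimage_mem_nhds (T.open_source.mem_nhds ?_))
      · simpa only [show K (0, 0) = 0 from map_zero K] using hQg
      · simpa only [show K (0, 0) = 0 from map_zero K] using hT0
    filter_upwards [hc (.fst ℝ Y Y), hc (.snd ℝ Y Y)] with z h1 h2 e1 e2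
    have e1' := h1.1.symm.trans e1
    have e2' := h2.1.symm.trans e2
    have := T.injOn h1.2 h2.2 (by rw [hT _ h1.2, hT _ h2.2, e1', e2'])
    exact congrArg Prod.fst this

end Implicit

/-! ### Compositions of characteristic flows -/

section Compositions

variable {m n h : ℕ} {Ω : Set (Jet m n)} {G : Fin h → Fin n → Jet m n → ℝ}
  {lam : Fin h → Fin h → Fin h → ℝ} {η : Fin h → Fin m → Jet m n → ℝ}
  {Φ : Fin h → ℝ → Jet m n → Jet m n} {D : Fin h → Set (ℝ × Jet m n)}

/-- Generators `G_i` that span a Lie algebra with structure constants `λ_{ij}^k` and that admit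
characteristic flows `Φ_i` with domains `D_i` and a common filtration. -/
structure IsCharSystem (Ω : Set (Jet m n)) (G : Fin h → Fin n → Jet m n → ℝ)
    (lam : Fin h → Fin h → Fin h → ℝ) (η : Fin h → Fin m → Jet m n → ℝ)
    (Φ : Fin h → ℝ → Jet m n → Jet m n) (D : Fin h → Set (ℝ × Jet m n)) : Prop where
  isOpen : IsOpen Ω
  gen : ∀ i j, G i j ∈ LocSmooth Ω
  lie : ∀ i j α, ∀ p ∈ Ω, bracket (G i) (G j) α p = ∑ k, lam i j k * G k α p
  eta : ∀ i r, η i r ∈ smoothFns Ω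
  flow : ∀ i, IsLocalFlow Ω (charField (G i) (η i)) (D i) (Φ i)
  filt : HasCommonFiltration Ω fun i => charField (G i) (η i)

/-- The composition of the flows with the indices of a list, the first one applied first. -/
def flowList (Φ : Fin h → ℝ → Jet m n → Jet m n) (l : List (Fin h)) (b : Fin h → ℝ)
    (p : Jet m n) : Jet m n := l.foldl (fun q i => Φ i (b i) q) p

/-- The composition of the flows in negative time in the opposite order. -/
def flowListInv (Φ : Fin h → ℝ → Jet m n → Jet m n) (l : List (Fin h)) (b : Fin h → ℝ)
    (p : Jet m n) : Jet m n := l.foldr (fun i q => Φ i (-b i) q) p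

theorem composedFlow_eq (b : Fin h → ℝ) (p : Jet m n) :
    composedFlow Φ b p = flowList Φ (List.finRange h) b p :=
  Fin.foldl_eq_foldl_finRange _ _

theorem IsCharSystem.cylAt_field (hS : IsCharSystem Ω G lam η Φ D) (i : Fin h) {p : Jet m n}
    (hp : p ∈ Ω) : CylAt (charField (G i) (η i)) p :=
  cylAt_charField (hS.gen i) (fun r => smoothFns_subset hS.isOpen (hS.eta i r)) hp

variable {p₀ : Jet m n}

theorem IsCharSystem.flowList_zero (hS : IsCharSystem Ω G lam η Φ D) (hp₀ : p₀ ∈ Ω)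
    (l : List (Fin h)) : flowList Φ l 0 p₀ = p₀ := by
  induction l with
  | nil => rfl
  | cons i l ih =>
    change flowList Φ l 0 (Φ i 0 p₀) = p₀
    rw [(hS.flow i).zero p₀ hp₀, ih]

theorem IsCharSystem.flowListInv_zero (hS : IsCharSystem Ω G lam η Φ D) (hp₀ : p₀ ∈ Ω)
    (l : List (Fin h)) : flowListInv Φ l 0 p₀ = p₀ := by
  induction l with
  | nil => rfl
  | cons i l ih =>
    change Φ i (-0) (flowListInv Φ l 0 p₀) = p₀
    rw [ih, neg_zero, (hS.flow i).zero p₀ hp₀]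

theorem IsCharSystem.cylAt_flow_zero (hS : IsCharSystem Ω G lam η Φ D) (hp₀ : p₀ ∈ Ω)
    (i : Fin h) : CylAt (fun z : ℝ × Jet m n => Φ i z.1 z.2) (0, p₀) :=
  (hS.flow i).cylAt ((hS.flow i).zero_mem p₀ hp₀)

theorem IsCharSystem.cylAt_flowList (hS : IsCharSystem Ω G lam η Φ D) (hp₀ : p₀ ∈ Ω)
    (l : List (Fin h)) :
    CylAt (fun z : (Fin h → ℝ) × Jet m n => flowList Φ l z.1 z.2) (0, p₀) := by
  induction l with
  | nil => exact (cylAt_id _).snd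
  | cons i l ih =>
    have h1 : CylAt (fun z : (Fin h → ℝ) × Jet m n => Φ i (z.1 i) z.2) (0, p₀) :=
      CylAt.comp (Q := fun z : (Fin h → ℝ) × Jet m n => (z.1 i, z.2))
        (R := fun z : ℝ × Jet m n => Φ i z.1 z.2) (p := (0, p₀)) (hS.cylAt_flow_zero hp₀ i)
        (((cylAt_id _).fst.apply i).prodMk (cylAt_id _).snd)
    refine CylAt.comp (Q := fun z : (Fin h → ℝ) × Jet m n => (z.1, Φ i (z.1 i) z.2))
      (R := fun z : (Fin h → ℝ) × Jet m n => flowList Φ l z.1 z.2) (p := (0, p₀)) ?_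
      ((cylAt_id _).fst.prodMk h1)
    simpa [(hS.flow i).zero p₀ hp₀] using ih

theorem IsCharSystem.cylAt_flowListInv (hS : IsCharSystem Ω G lam η Φ D) (hp₀ : p₀ ∈ Ω)
    (l : List (Fin h)) :
    CylAt (fun z : (Fin h → ℝ) × Jet m n => flowListInv Φ l z.1 z.2) (0, p₀) := by
  induction l with
  | nil => exact (cylAt_id _).snd
  | cons i l ih =>
    refine CylAt.comp (Q := fun z : (Fin h → ℝ) × Jet m n => (-z.1 i, flowListInv Φ l z.1 z.2))
      (R := fun z : ℝ × Jet m n => Φ i z.1 z.2) (p := (0, p₀)) ?_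
      (((cylAt_id _).fst.apply i).neg.prodMk ih)
    simpa [hS.flowListInv_zero hp₀] using hS.cylAt_flow_zero hp₀ i

theorem IsCharSystem.eventually_flowListInv_flowList (hS : IsCharSystem Ω G lam η Φ D)
    (hp₀ : p₀ ∈ Ω) (l : List (Fin h)) :
    ∀ᶠ z : (Fin h → ℝ) × Jet m n in 𝓝 (0, p₀),
      flowListInv Φ l z.1 (flowList Φ l z.1 z.2) = z.2 := by
  induction l with
  | nil => exact Eventually.of_forall fun _ => rfl
  | cons i l ih =>
    have h1 : ContinuousAt (fun z : (Fin h → ℝ) × Jet m n => (z.1 i, z.2)) (0, p₀) := by fun_prop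
    have h2 := h1.eventually ((hS.flow i).eventually_flow_neg_flow hS.isOpen hS.filt
      (fun p hp => hS.cylAt_field i hp) hp₀)
    have h3 : ContinuousAt (fun z : (Fin h → ℝ) × Jet m n => (z.1, Φ i (z.1 i) z.2)) (0, p₀) :=
      continuousAt_fst.prodMk (ContinuousAt.comp
        (f := fun z : (Fin h → ℝ) × Jet m n => (z.1 i, z.2)) (x := (0, p₀))
        (hS.cylAt_flow_zero hp₀ i).continuousAt h1)
    have h4 := h3.eventually (p := fun z => flowListInv Φ l z.1 (flowList Φ l z.1 z.2) = z.2)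
      (by simpa [(hS.flow i).zero p₀ hp₀] using ih)
    filter_upwards [h2, h4] with z hz hz'
    change Φ i (-z.1 i) (flowListInv Φ l z.1 (flowList Φ l z.1 (Φ i (z.1 i) z.2))) = z.2
    rw [hz', hz]

theorem IsCharSystem.eventually_flowList_flowListInv (hS : IsCharSystem Ω G lam η Φ D)
    (hp₀ : p₀ ∈ Ω) (l : List (Fin h)) :
    ∀ᶠ z : (Fin h → ℝ) × Jet m n in 𝓝 (0, p₀),
      flowList Φ l z.1 (flowListInv Φ l z.1 z.2) = z.2 := by
  induction l with
  | nil => exact Eventually.of_forall fun _ => rfl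
  | cons i l ih =>
    have h1 : ContinuousAt (fun z : (Fin h → ℝ) × Jet m n => (-z.1 i, flowListInv Φ l z.1 z.2))
        (0, p₀) :=
      (((cylAt_id _).fst.apply i).neg.prodMk (hS.cylAt_flowListInv hp₀ l)).continuousAt
    have h2 := h1.eventually (p := fun z => Φ i (-z.1) (Φ i z.1 z.2) = z.2) (by
      simpa [hS.flowListInv_zero hp₀] using (hS.flow i).eventually_flow_neg_flow hS.isOpen hS.filt
        (fun p hp => hS.cylAt_field i hp) hp₀)
    filter_upwards [h2, ih] with z hz hz'
    simp only [neg_neg] at hz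
    change flowList Φ l z.1 (Φ i (z.1 i) (Φ i (-z.1 i) (flowListInv Φ l z.1 z.2))) = z.2
    rw [hz, hz']

theorem IsCharSystem.flowList_single_of_notMem (hS : IsCharSystem Ω G lam η Φ D)
    {p : Jet m n} (hp : p ∈ Ω) {l : List (Fin h)} {i : Fin h} (hi : i ∉ l) (s : ℝ) :
    flowList Φ l (s • Pi.single i 1) p = p := by
  induction l with
  | nil => rfl
  | cons j l ih =>
    rw [List.mem_cons, not_or] at hi
    change flowList Φ l _ (Φ j (s • (Pi.single i 1 : Fin h → ℝ) j) p) = p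
    rw [Pi.single_eq_of_ne (Ne.symm hi.1), smul_zero, (hS.flow j).zero p hp, ih hi.2]

theorem IsCharSystem.flowList_single (hS : IsCharSystem Ω G lam η Φ D) {p : Jet m n} (hp : p ∈ Ω)
    {l : List (Fin h)} (hl : l.Nodup) {i : Fin h} (hi : i ∈ l) {s : ℝ} (hs : (s, p) ∈ D i) :
    flowList Φ l (s • Pi.single i 1) p = Φ i s p := by
  induction l with
  | nil => simp at hi
  | cons j l ih =>
    rw [List.nodup_cons] at hl
    change flowList Φ l _ (Φ j (s • (Pi.single i 1 : Fin h → ℝ) j) p) = _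
    rcases eq_or_ne i j with rfl | hij
    · rw [Pi.single_eq_same, smul_eq_mul, mul_one]
      exact hS.flowList_single_of_notMem ((hS.flow i).mapsTo s p hs).2 hl.1 s
    · have hil : i ∈ l := by simpa [hij] using hi
      rw [Pi.single_eq_of_ne (Ne.symm hij), smul_zero, (hS.flow j).zero p hp, ih hl.2 hil]

/-! ### The parametrization of the solution manifold -/

variable {f : (Fin m → ℝ) → ℝ → Fin n → ℝ} {W : Set ((Fin m → ℝ) × ℝ)}

/-- The image of the jet of `f(·, b^0)` at `x` under the inverse of the composed flow with the
parameters `(b^1, …, b^h)`, restricted to the flows of a list. -/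
noncomputable def paramMap (Φ : Fin h → ℝ → Jet m n → Jet m n) (f : (Fin m → ℝ) → ℝ → Fin n → ℝ)
    (l : List (Fin h)) (z : (Fin m → ℝ) × (Fin (h + 1) → ℝ)) : Jet m n :=
  flowListInv Φ l (Fin.tail z.2) (jetFam f (z.1, z.2 0))

/-- The directions tangent to the base and to the parameters `(b^1, …, b^h)` are mapped, modulo the
total derivatives, to combinations of the fields `V_{G_k}`, with coefficients that depend on
`(b^1, …, b^h)` only. -/
theorem IsCharSystem.eventually_paramMap (hS : IsCharSystem Ω G lam η Φ D) (hW : IsOpen W)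
    (hf : ContDiffOn ℝ ∞ (fun z : (Fin m → ℝ) × ℝ => f z.1 z.2) W)
    (hΩ : ∀ z ∈ W, jetFam f z ∈ Ω) {x₀ : Fin m → ℝ} (hx₀ : (x₀, (0 : ℝ)) ∈ W)
    (l : List (Fin h)) :
    ∀ᶠ z in 𝓝 ((x₀, 0) : (Fin m → ℝ) × (Fin (h + 1) → ℝ)), paramMap Φ f l z ∈ Ω ∧
      CylAt (paramMap Φ f l) z ∧ ∀ e : (Fin m → ℝ) × (Fin (h + 1) → ℝ), e.2 0 = 0 →
        ∃ v : Jet m n, (∀ c, HasDerivAt (fun s : ℝ => paramMap Φ f l (z + s • e) c) (v c) 0) ∧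
          vert (paramMap Φ f l z) v =
            ∑ k, (-paramOp lam (Fin.tail z.2) l (Fin.tail e.2)) k •
              evolField (G k) (paramMap Φ f l z) := by
  induction l with
  | nil =>
    have hc : ContinuousAt (fun z : (Fin m → ℝ) × (Fin (h + 1) → ℝ) => (z.1, z.2 0)) (x₀, 0) := by
      fun_prop
    filter_upwards [hc.eventually (hW.mem_nhds hx₀)] with z hz
    refine ⟨hΩ _ hz, ?_, fun e he => ?_⟩
    · exact CylAt.comp (Q := fun z : (Fin m → ℝ) × (Fin (h + 1) → ℝ) => (z.1, z.2 0))
        (R := jetFam f) (cylAt_jetFam hW hf hz) (cylAt_of_contDiff (by fun_prop))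
    · refine ⟨∑ i, e.1 i • totalField i (jetFam f (z.1, z.2 0)), fun c => ?_, ?_⟩
      · have hl : HasDerivAt (fun s : ℝ => ((z + s • e).1, (z + s • e).2 0)) (e.1, (0 : ℝ)) 0 := by
          have h1 : HasDerivAt (fun s : ℝ => (z + s • e).1) e.1 0 := by
            simpa using ((hasDerivAt_id (0 : ℝ)).smul_const e.1).const_add z.1
          have h2 : ∀ s : ℝ, (z + s • e).2 0 = z.2 0 := by simp [he]
          simp only [h2]
          exact h1.prodMk (hasDerivAt_const _ _)
        have h3 := HasFDerivAt.comp_hasDerivAt (l := fun z => jetFam f z c) (0 : ℝ)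
          (l' := fderiv ℝ (fun z => jetFam f z c) (z.1, z.2 0)) (by
            simpa using hasFDerivAt_of_contDiffOn hW (contDiffOn_jetFam hW hf c) hz) hl
        refine h3.congr_deriv ?_
        exact fderiv_jetFam_base hW hf hz e.1 c
      · have h1 : ∀ r, (∑ i, e.1 i • totalField i (jetFam f (z.1, z.2 0))) (Sum.inl r) = e.1 r := by
          intro r
          simp [totalField, Finset.sum_apply, Pi.single_apply]
        simp only [vert, paramMap, flowListInv, List.foldr_nil, h1, sub_self]
        simp [paramOp]
  | cons i l ih =>
    have hself := ih.self_of_nhds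
    have hz0 : paramMap Φ f l ((x₀, 0) : (Fin m → ℝ) × (Fin (h + 1) → ℝ)) = jetFam f (x₀, 0) :=
      hS.flowListInv_zero (hΩ _ hx₀) l
    have hD : ∀ᶠ z in 𝓝 ((x₀, 0) : (Fin m → ℝ) × (Fin (h + 1) → ℝ)),
        (-z.2 i.succ, paramMap Φ f l z) ∈ D i := by
      have hc : ContinuousAt (fun z : (Fin m → ℝ) × (Fin (h + 1) → ℝ) =>
          (-z.2 i.succ, paramMap Φ f l z)) (x₀, 0) :=
        ContinuousAt.prodMk (by fun_prop) hself.2.1.continuousAt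
      refine hc.eventually ((hS.flow i).isOpen.mem_nhds ?_)
      simpa [hz0] using (hS.flow i).zero_mem _ (hΩ _ hx₀)
    filter_upwards [ih, hD] with z hz hzD
    obtain ⟨hzΩ, hzc, hzt⟩ := hz
    have hΦ := hS.flow i
    have hcons : paramMap Φ f (i :: l) = fun z => Φ i (-z.2 i.succ) (paramMap Φ f l z) := rfl
    refine ⟨(hΦ.mapsTo _ _ hzD).2, ?_, fun e he => ?_⟩
    · exact CylAt.comp (Q := fun z => (-z.2 i.succ, paramMap Φ f l z))
        (R := fun z : ℝ × Jet m n => Φ i z.1 z.2) (hΦ.cylAt hzD)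
        (CylAt.prodMk (cylAt_of_contDiff (by fun_prop)) hzc)
    · obtain ⟨v, hv, hvv⟩ := hzt e he
      set b := z.2 i.succ with hb
      set q : ℝ → Jet m n := fun s => paramMap Φ f l (z + s • e) with hq
      have hq0 : q 0 = paramMap Φ f l z := by simp [hq]
      have hqc : CylAt q 0 := CylAt.comp (R := paramMap Φ f l) (Q := fun s : ℝ => z + s • e)
        (by simpa using hzc) (cylAt_of_contDiff (by fun_prop))
      have hqD : (-b, q 0) ∈ D i := by rw [hq0]; exact hzD
      -- the flow of `G_i` for the fixed time `-b` transports the vector `v`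
      have hpush := vert_pushDeriv hS.isOpen hS.gen hS.lie hS.eta hS.filt hΦ hqc hqD hv
        (c := fun τ => adExp lam i (-τ) (-paramOp lam (Fin.tail z.2) l (Fin.tail e.2)))
        (fun τ k => by
          have h1 : HasDerivAt (fun τ => adExp lam i (-τ)
              (-paramOp lam (Fin.tail z.2) l (Fin.tail e.2))) _ τ :=
            ((hasDerivAt_adExp lam i (-τ)).scomp τ (hasDerivAt_neg τ)).clm_apply
              (hasDerivAt_const τ (-paramOp lam (Fin.tail z.2) l (Fin.tail e.2)))
          rw [map_zero, add_zero] at h1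
          have h2 := hasDerivAt_pi.1 h1 k
          refine h2.congr_deriv ?_
          rw [neg_smul, one_smul]
          rfl)
        (by simp only [neg_zero, adExp_zero, hq0, hvv]; rfl)
      simp only [neg_neg] at hpush
      refine ⟨(-e.2 i.succ) • charField (G i) (η i) (Φ i (-b) (q 0)) + pushDeriv (Φ i) q (-b),
        fun c => ?_, ?_⟩
      -- the derivative of `Φ i` splits into the parts from the time and from the initial value
      · have hK : CylAt (fun y : ℝ × ℝ => Φ i (-b + y.1) (q y.2)) (0, 0) :=
          CylAt.comp (Q := fun y : ℝ × ℝ => (-b + y.1, q y.2))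
            (R := fun z : ℝ × Jet m n => Φ i z.1 z.2) (p := (0, 0))
            (hΦ.cylAt (by simpa using hqD)) (CylAt.prodMk (cylAt_of_contDiff (by fun_prop))
              (CylAt.comp (R := q) (Q := fun y : ℝ × ℝ => y.2) hqc (cylAt_id _).snd))
        have hd := (hK.apply c).contDiffAt.differentiableAt (by simp)
        set B := fderiv ℝ (fun y : ℝ × ℝ => Φ i (-b + y.1) (q y.2) c) (0, 0) with hB
        have e1 : B (1, 0) = charField (G i) (η i) (Φ i (-b) (q 0)) c := by
          have ho := hΦ.ode (-b + 0) (q 0) (by simpa using hqD) c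
          have h2 := (hasDerivAt_slice_fst hd).unique (ho.comp_const_add (-b) 0)
          rwa [add_zero] at h2
        have e2 : B (0, 1) = pushDeriv (Φ i) q (-b) c := by
          have ho := hΦ.hasDerivAt_push hqc hqD c
          have h2 := hasDerivAt_slice_snd hd
          simp only [add_zero] at h2
          exact h2.unique ho
        have hl : HasDerivAt (fun s : ℝ => (s * -e.2 i.succ, s))
            ((-e.2 i.succ, 1) : ℝ × ℝ) 0 :=
          (hasDerivAt_mul_const _).prodMk (hasDerivAt_id _)
        have h3 := HasFDerivAt.comp_hasDerivAt
          (l := fun y : ℝ × ℝ => Φ i (-b + y.1) (q y.2) c) (l' := B) (0 : ℝ)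
          (by simpa using hd.hasFDerivAt) hl
        have e3 : B (-e.2 i.succ, 1) =
            ((-e.2 i.succ) • charField (G i) (η i) (Φ i (-b) (q 0)) +
              pushDeriv (Φ i) q (-b)) c := by
          have : ((-e.2 i.succ, 1) : ℝ × ℝ) = (-e.2 i.succ) • (1, 0) + (0, 1) := by simp
          rw [this, map_add, map_smul, e1, e2]
          rfl
        rw [e3] at h3
        refine h3.congr_of_eventuallyEq (Eventually.of_forall fun s => ?_)
        have e4 : -(z + s • e).2 i.succ = -b + s * -e.2 i.succ := by
          simp [hb]
          ring
        simp only [hcons, e4]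
        rfl
      · have hqz : Φ i (-b) (q 0) = paramMap Φ f (i :: l) z := by
          rw [hq0, hcons]
        rw [hqz] at hpush ⊢
        rw [vert_add, vert_smul, vert_charField, hpush]
        have h1 : ∀ k, (-paramOp lam (Fin.tail z.2) (i :: l) (Fin.tail e.2)) k =
            adExp lam i b (-paramOp lam (Fin.tail z.2) l (Fin.tail e.2)) k +
              (-e.2 i.succ) * (Pi.single i (1 : ℝ) : Fin h → ℝ) k := by
          intro k
          rw [paramOp_cons, show Fin.tail z.2 i = b from rfl,
            show Fin.tail e.2 i = e.2 i.succ from rfl]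
          simp only [map_neg, Pi.neg_apply, Pi.add_apply, Pi.smul_apply, smul_eq_mul]
          ring
        simp only [h1, add_smul, Finset.sum_add_distrib]
        rw [add_comm]
        congr 1
        rw [Finset.sum_eq_single i]
        · simp
        · intro k _ hk
          simp [Pi.single_eq_of_ne hk]
        · simp

end Compositions

/-! ### The defining equations of the parameters -/

section Defect

variable {m n h : ℕ} {Ω : Set (Jet m n)} {G : Fin h → Fin n → Jet m n → ℝ}
  {lam : Fin h → Fin h → Fin h → ℝ} {η : Fin h → Fin m → Jet m n → ℝ}
  {Φ : Fin h → ℝ → Jet m n → Jet m n} {D : Fin h → Set (ℝ × Jet m n)}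
  {f : (Fin m → ℝ) → ℝ → Fin n → ℝ} {W : Set ((Fin m → ℝ) × ℝ)} {x₀ : Fin m → ℝ}
  {F : Fin n → Jet m n → ℝ}

theorem isOpen_jetSpace {M : Set (Fin m → ℝ)} {N : Set (Fin n → ℝ)} (hM : IsOpen M)
    (hN : IsOpen N) : IsOpen (jetSpace M N) :=
  (hM.preimage (continuous_pi fun _ => continuous_apply _)).inter
    (hN.preimage (continuous_pi fun _ => continuous_apply _))

theorem cylAt_xPart (p : Jet m n) : CylAt (xPart : Jet m n → Fin m → ℝ) p :=
  cylAt_pi fun i => cylAt_coord (Sum.inl i) p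

theorem defect_eq (b : Fin (h + 1) → ℝ) (p : Jet m n) (j : Fin n) (s : Fin m → ℕ) :
    defect Φ f b p j s = composedFlow Φ (Fin.tail b) p (Sum.inr (j, s)) -
      jetFam f (xPart (composedFlow Φ (Fin.tail b) p), b 0) (Sum.inr (j, s)) := rfl

theorem defect_eq_zero {b : Fin (h + 1) → ℝ} {p : Jet m n} {x : Fin m → ℝ}
    (hb : composedFlow Φ (Fin.tail b) p = jetFam f (x, b 0)) (j : Fin n) (s : Fin m → ℕ) :
    defect Φ f b p j s = 0 := by
  rw [defect_eq, hb]
  exact sub_self _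

theorem composedFlow_eq_of_defect {b : Fin (h + 1) → ℝ} {p : Jet m n}
    (hb : ∀ j s, defect Φ f b p j s = 0) :
    composedFlow Φ (Fin.tail b) p =
      jetFam f (xPart (composedFlow Φ (Fin.tail b) p), b 0) := by
  funext c
  rcases c with i | ⟨j, s⟩
  · rfl
  · exact sub_eq_zero.1 (hb j s)

theorem IsCharSystem.cylAt_composedFlow (hS : IsCharSystem Ω G lam η Φ D) {p₀ : Jet m n}
    (hp₀ : p₀ ∈ Ω) :
    CylAt (fun z : (Fin (h + 1) → ℝ) × Jet m n => composedFlow Φ (Fin.tail z.1) z.2) (0, p₀) := by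
  simp only [composedFlow_eq]
  refine CylAt.comp (Q := fun z : (Fin (h + 1) → ℝ) × Jet m n => (Fin.tail z.1, z.2))
    (R := fun z : (Fin h → ℝ) × Jet m n => flowList Φ (List.finRange h) z.1 z.2) (p := (0, p₀))
    (hS.cylAt_flowList hp₀ _) (CylAt.prodMk (cylAt_pi fun i => ?_) (cylAt_id _).snd)
  exact (cylAt_id ((0 : Fin (h + 1) → ℝ), p₀)).fst.apply i.succ

theorem IsCharSystem.composedFlow_zero (hS : IsCharSystem Ω G lam η Φ D) {p₀ : Jet m n}
    (hp₀ : p₀ ∈ Ω) : composedFlow Φ 0 p₀ = p₀ := by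
  rw [composedFlow_eq, hS.flowList_zero hp₀]

theorem IsCharSystem.cylAt_defect (hS : IsCharSystem Ω G lam η Φ D) (hW : IsOpen W)
    (hf : ContDiffOn ℝ ∞ (fun z : (Fin m → ℝ) × ℝ => f z.1 z.2) W)
    (hΩ : ∀ z ∈ W, jetFam f z ∈ Ω) (hx₀ : (x₀, (0 : ℝ)) ∈ W) (j : Fin n) (s : Fin m → ℕ) :
    CylAt (fun z : (Fin (h + 1) → ℝ) × Jet m n => defect Φ f z.1 z.2 j s)
      (0, jetFam f (x₀, 0)) := by
  have h1 := hS.cylAt_composedFlow (hΩ _ hx₀)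
  have h0 : composedFlow Φ (Fin.tail (0 : Fin (h + 1) → ℝ)) (jetFam f (x₀, 0)) =
      jetFam f (x₀, 0) := hS.composedFlow_zero (hΩ _ hx₀)
  have h2 : CylAt (fun z : (Fin (h + 1) → ℝ) × Jet m n =>
      (xPart (composedFlow Φ (Fin.tail z.1) z.2), z.1 0)) (0, jetFam f (x₀, 0)) :=
    CylAt.prodMk ((cylAt_xPart _).comp h1) ((cylAt_id _).fst.apply 0)
  have h3 : CylAt (fun z : (Fin (h + 1) → ℝ) × Jet m n =>
      jetFam f (xPart (composedFlow Φ (Fin.tail z.1) z.2), z.1 0)) (0, jetFam f (x₀, 0)) :=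
    CylAt.comp (R := jetFam f) (by rw [h0]; exact cylAt_jetFam hW hf hx₀) h2
  exact (h1.apply (Sum.inr (j, s))).sub (h3.apply (Sum.inr (j, s)))

theorem eq_sum_smul_single {ι : Type} [Fintype ι] [DecidableEq ι] (v : ι → ℝ) :
    v = ∑ l, v l • Pi.single l (1 : ℝ) := by
  funext j
  simp [Finset.sum_apply, Pi.single_apply]

/-- The derivative of the defining equations with respect to the parameters, at `0`: the parameter
`b^0` contributes `-V_F` by the evolution equation, and `b^i` contributes the vertical part `V_{G_i}` of
the characteristic field. -/
theorem IsCharSystem.hasDerivAt_defect (hS : IsCharSystem Ω G lam η Φ D) (hW : IsOpen W)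
    (hf : ContDiffOn ℝ ∞ (fun z : (Fin m → ℝ) × ℝ => f z.1 z.2) W)
    (hΩ : ∀ z ∈ W, jetFam f z ∈ Ω) (hx₀ : (x₀, (0 : ℝ)) ∈ W) (hF : ∀ j, F j ∈ LocSmooth Ω)
    (hevol : ∀ x t, (x, t) ∈ W → 0 ≤ t → ∀ j,
      HasDerivAt (fun s => f x s j) (F j (jetOf (fun y => f y t) x)) t)
    (j : Fin n) (s : Fin m → ℕ) (v : Fin (h + 1) → ℝ) :
    HasDerivAt (fun t : ℝ => defect Φ f (t • v) (jetFam f (x₀, 0)) j s)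
      (-v 0 * totalDeriv s (F j) (jetFam f (x₀, 0)) +
        ∑ i, v i.succ * totalDeriv s (G i j) (jetFam f (x₀, 0))) 0 := by
  set p₀ : Jet m n := jetFam f (x₀, 0) with hp₀
  have hp₀Ω : p₀ ∈ Ω := hΩ _ hx₀
  have hc : CylAt (fun b : Fin (h + 1) → ℝ => defect Φ f b p₀ j s) 0 :=
    CylAt.comp (Q := fun b => (b, p₀)) (R := fun z : (Fin (h + 1) → ℝ) × Jet m n =>
      defect Φ f z.1 z.2 j s) (hS.cylAt_defect hW hf hΩ hx₀ j s)
      ((cylAt_id _).prodMk (cylAt_const _ _))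
  have hd := (hc.contDiffAt.differentiableAt (by simp)).hasFDerivAt
  set B := fderiv ℝ (fun b : Fin (h + 1) → ℝ => defect Φ f b p₀ j s) 0 with hB
  have hBl : ∀ v, HasDerivAt (fun t : ℝ => defect Φ f (t • v) p₀ j s) (B v) 0 := by
    intro v
    have hl : HasDerivAt (fun t : ℝ => t • v) v 0 := by
      simpa using (hasDerivAt_id (0 : ℝ)).smul_const v
    exact HasFDerivAt.comp_hasDerivAt (l := fun b => defect Φ f b p₀ j s) (0 : ℝ)
      (by rwa [zero_smul]) hl
  have hJ := hasFDerivAt_of_contDiffOn hW (contDiffOn_jetFam hW hf (Sum.inr (j, s))) hx₀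
  have h0 : B (Pi.single 0 1) = -totalDeriv s (F j) p₀ := by
    refine (hBl _).unique ?_
    have h1 : ∀ t : ℝ, Fin.tail (t • (Pi.single 0 1 : Fin (h + 1) → ℝ)) = 0 := by
      intro t
      funext i
      simp [Fin.tail]
    simp only [defect_eq, h1, hS.composedFlow_zero hp₀Ω]
    have hl : HasDerivAt (fun t : ℝ => (x₀, (t • (Pi.single 0 1 : Fin (h + 1) → ℝ)) 0))
        ((0, 1) : (Fin m → ℝ) × ℝ) 0 := by
      simpa using (hasDerivAt_const (0 : ℝ) x₀).prodMk (hasDerivAt_id (0 : ℝ))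
    have h2 := HasFDerivAt.comp_hasDerivAt (l := fun z => jetFam f z (Sum.inr (j, s))) (0 : ℝ)
      (by simpa using hJ) hl
    rw [tDeriv_jetFam hW hf hΩ hF hevol hx₀] at h2
    exact h2.const_sub _
  have hi : ∀ i : Fin h, B (Pi.single i.succ 1) = totalDeriv s (G i j) p₀ := by
    intro i
    refine (hBl _).unique ?_
    have h1 : ∀ t : ℝ, Fin.tail (t • (Pi.single i.succ 1 : Fin (h + 1) → ℝ)) =
        t • Pi.single i 1 := by
      intro t
      funext k
      simp [Fin.tail, Pi.single_apply]
    have h2 : ∀ t : ℝ, (t • (Pi.single i.succ 1 : Fin (h + 1) → ℝ)) 0 = 0 := by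
      intro t
      simp [(Fin.succ_ne_zero i).symm]
    have hD0 := (hS.flow i).zero_mem p₀ hp₀Ω
    have hD : ∀ᶠ t in 𝓝 (0 : ℝ), (t, p₀) ∈ D i :=
      (show ContinuousAt (fun t : ℝ => (t, p₀)) 0 by fun_prop).eventually
        ((hS.flow i).isOpen.mem_nhds hD0)
    have ho := (hS.flow i).ode 0 p₀ hD0
    rw [(hS.flow i).zero p₀ hp₀Ω] at ho
    have hl : HasDerivAt (fun t : ℝ => (xPart (Φ i t p₀), (0 : ℝ)))
        ((fun r => charField (G i) (η i) p₀ (Sum.inl r), 0) : (Fin m → ℝ) × ℝ) 0 :=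
      (hasDerivAt_pi.2 fun r => ho (Sum.inl r)).prodMk (hasDerivAt_const _ _)
    have h3 := HasFDerivAt.comp_hasDerivAt (l := fun z => jetFam f z (Sum.inr (j, s))) (0 : ℝ)
      (by rw [(hS.flow i).zero p₀ hp₀Ω]; exact hJ) hl
    rw [fderiv_jetFam_base hW hf hx₀] at h3
    have h4 := (ho (Sum.inr (j, s))).sub h3
    have h5 : charField (G i) (η i) p₀ (Sum.inr (j, s)) -
        (∑ r, charField (G i) (η i) p₀ (Sum.inl r) • totalField r p₀) (Sum.inr (j, s)) =
        totalDeriv s (G i j) p₀ :=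
      congrFun (vert_charField (G i) (η i) p₀) (Sum.inr (j, s))
    rw [h5] at h4
    refine h4.congr_of_eventuallyEq ?_
    filter_upwards [hD] with t ht
    simp only [defect_eq, h1, h2, composedFlow_eq]
    rw [hS.flowList_single hp₀Ω (List.nodup_finRange h) (List.mem_finRange i) ht]
    rfl
  have hv : B v = -v 0 * totalDeriv s (F j) p₀ + ∑ i, v i.succ * totalDeriv s (G i j) p₀ := by
    conv_lhs => rw [eq_sum_smul_single v]
    rw [map_sum, Fin.sum_univ_succ]
    simp only [map_smul, h0, hi, smul_eq_mul]
    ring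
  rw [← hv]
  exact hBl v

/-- The matrix of the nondegeneracy condition. -/
noncomputable def genMatrix (F : Fin n → Jet m n → ℝ) (G : Fin h → Fin n → Jet m n → ℝ)
    (idx : Fin (h + 1) → Fin n) (mi : Fin (h + 1) → Fin m → ℕ) (p : Jet m n) :
    Matrix (Fin (h + 1)) (Fin (h + 1)) ℝ :=
  Matrix.of fun k l : Fin (h + 1) => totalDeriv (mi k)
    ((Fin.cons F G : Fin (h + 1) → Fin n → Jet m n → ℝ) l (idx k)) p

variable {idx : Fin (h + 1) → Fin n} {mi : Fin (h + 1) → Fin m → ℕ}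

theorem genMatrix_mulVec (p : Jet m n) (v : Fin (h + 1) → ℝ) (k : Fin (h + 1)) :
    (genMatrix F G idx mi p).mulVec v k = v 0 * totalDeriv (mi k) (F (idx k)) p +
      ∑ i, v i.succ * totalDeriv (mi k) (G i (idx k)) p := by
  simp only [Matrix.mulVec, dotProduct, genMatrix, Matrix.of_apply, Fin.sum_univ_succ,
    Fin.cons_zero, Fin.cons_succ, mul_comm]

/-- The nondegeneracy condition makes the `G_i` linearly independent, hence the structure constants
are determined by the bracket, and antisymmetric. -/
theorem lam_antisymm (hΩ : IsOpen Ω) (hG : ∀ i j, G i j ∈ LocSmooth Ω)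
    (hLie : ∀ i j α, ∀ p ∈ Ω, bracket (G i) (G j) α p = ∑ k, lam i j k * G k α p)
    {p₀ : Jet m n} (hp₀ : p₀ ∈ Ω) (hdet : (genMatrix F G idx mi p₀).det ≠ 0) (i j k : Fin h) :
    lam i j k = -lam j i k := by
  have h1 := Matrix.eq_zero_of_mulVec_eq_zero hdet
    (v := Fin.cons 0 fun p => lam i j p + lam j i p) (by
      funext r
      rw [genMatrix_mulVec]
      simp only [Fin.cons_zero, Fin.cons_succ, zero_mul, zero_add, Pi.zero_apply]
      have h2 : EqOn (fun p => ∑ k, (lam i j k + lam j i k) * G k (idx r) p)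
          (fun p => ∑ k, (fun _ : Fin h => (0 : ℝ)) k * G k (idx r) p) Ω := by
        intro p hp
        simp only [add_mul, Finset.sum_add_distrib, zero_mul, Finset.sum_const_zero]
        rw [← hLie i j _ p hp, ← hLie j i _ p hp]
        simp only [bracket]
        ring
      have h3 := totalDeriv_congr hΩ (mi r) h2 hp₀
      rw [totalDeriv_sum hΩ (fun k => lam i j k + lam j i k) (mi r) (fun k => hG k (idx r)) hp₀,
        totalDeriv_sum hΩ (fun _ => 0) (mi r) (fun k => hG k (idx r)) hp₀] at h3
      simpa using h3)
  have h2 := congrFun h1 k.succ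
  simp only [Fin.cons_succ, Pi.zero_apply] at h2
  linarith

/-- Existence and uniqueness of the functions `a^0, …, a^h`, by the implicit function theorem. The
solution is unique near `(0, p₀)`, among all parameters and not only among functions of the jet. -/
theorem IsCharSystem.exists_paramSystem (hS : IsCharSystem Ω G lam η Φ D) (hW : IsOpen W)
    (hf : ContDiffOn ℝ ∞ (fun z : (Fin m → ℝ) × ℝ => f z.1 z.2) W)
    (hΩ : ∀ z ∈ W, jetFam f z ∈ Ω) (hx₀ : (x₀, (0 : ℝ)) ∈ W) (hF : ∀ j, F j ∈ LocSmooth Ω)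
    (hevol : ∀ x t, (x, t) ∈ W → 0 ≤ t → ∀ j,
      HasDerivAt (fun s => f x s j) (F j (jetOf (fun y => f y t) x)) t)
    (hdet : (genMatrix F G idx mi (jetFam f (x₀, 0))).det ≠ 0) :
    (∃ U a, IsParamSystem Φ f idx mi (jetFam f (x₀, 0)) U a) ∧
      ∀ᶠ z : ((Fin (h + 1) → ℝ) × (Fin (h + 1) → ℝ)) × Jet m n in 𝓝 ((0, 0), jetFam f (x₀, 0)),
        (∀ k, defect Φ f z.1.1 z.2 (idx k) (mi k) = 0) →
        (∀ k, defect Φ f z.1.2 z.2 (idx k) (mi k) = 0) → z.1.1 = z.1.2 := by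
  set p₀ : Jet m n := jetFam f (x₀, 0) with hp₀
  have h1 := exists_implicit (p₀ := p₀)
    (Q := fun z : (Fin (h + 1) → ℝ) × Jet m n => fun k => defect Φ f z.1 z.2 (idx k) (mi k))
    (A := fun v => (genMatrix F G idx mi p₀).mulVec (Fin.cons (-v 0) (Fin.tail v)))
    (cylAt_pi fun k => hS.cylAt_defect hW hf hΩ hx₀ _ _)
    (funext fun k => defect_eq_zero (x := x₀) (hS.composedFlow_zero (hΩ _ hx₀)) _ _)
    (fun v => hasDerivAt_pi.2 fun k => by
      rw [genMatrix_mulVec]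
      exact hS.hasDerivAt_defect hW hf hΩ hx₀ hF hevol _ _ v)
    (fun v hv => by
      have h2 := Matrix.eq_zero_of_mulVec_eq_zero hdet hv
      funext l
      refine Fin.cases ?_ (fun i => ?_) l
      · simpa using congrFun h2 0
      · simpa [Fin.tail] using congrFun h2 i.succ)
  obtain ⟨⟨U, a, hU, hpU, ha0, has, haQ⟩, huniq⟩ := h1
  refine ⟨⟨U, a, hU, hpU, fun l => has (.proj l), ha0, fun p hp k => congrFun (haQ p hp) k⟩, ?_⟩
  filter_upwards [huniq] with z hz e1 e2 using hz (funext e1) (funext e2)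

end Defect

/-! ### The solution manifold -/

section Manifold

variable {m n h : ℕ} {Ω : Set (Jet m n)} {G : Fin h → Fin n → Jet m n → ℝ}
  {lam : Fin h → Fin h → Fin h → ℝ} {η : Fin h → Fin m → Jet m n → ℝ}
  {Φ : Fin h → ℝ → Jet m n → Jet m n} {D : Fin h → Set (ℝ × Jet m n)}
  {f : (Fin m → ℝ) → ℝ → Fin n → ℝ} {W : Set ((Fin m → ℝ) × ℝ)} {x₀ : Fin m → ℝ}
  {idx : Fin (h + 1) → Fin n} {mi : Fin (h + 1) → Fin m → ℕ}
  {U : Set (Jet m n)} {a : Jet m n → Fin (h + 1) → ℝ}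

theorem hasDerivAt_add_smul {E : Type} [NormedAddCommGroup E] [NormedSpace ℝ E] (w e : E) :
    HasDerivAt (fun s : ℝ => w + s • e) e 0 := by
  simpa using ((hasDerivAt_id (0 : ℝ)).smul_const e).const_add w

theorem continuous_tail : Continuous fun b : Fin (h + 1) → ℝ => (Fin.tail b : Fin h → ℝ) :=
  continuous_pi fun i => continuous_apply i.succ

theorem IsParamSystem.cylAt {p₀ : Jet m n} (hP : IsParamSystem Φ f idx mi p₀ U a) {p : Jet m n}
    (hp : p ∈ U) : CylAt a p :=
  cylAt_pi fun l => smoothFns_subset hP.isOpen (hP.smooth l) p hp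

theorem IsCharSystem.paramMap_base (hS : IsCharSystem Ω G lam η Φ D)
    (hΩ : ∀ z ∈ W, jetFam f z ∈ Ω) {x : Fin m → ℝ} (hx : (x, (0 : ℝ)) ∈ W) (l : List (Fin h)) :
    paramMap Φ f l (x, 0) = jetFam f (x, 0) :=
  hS.flowListInv_zero (hΩ _ hx) l

/-- All defects vanish on the image of the parametrization. -/
theorem IsCharSystem.eventually_composedFlow_paramMap (hS : IsCharSystem Ω G lam η Φ D)
    (hW : IsOpen W) (hf : ContDiffOn ℝ ∞ (fun z : (Fin m → ℝ) × ℝ => f z.1 z.2) W)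
    (hΩ : ∀ z ∈ W, jetFam f z ∈ Ω) (hx₀ : (x₀, (0 : ℝ)) ∈ W) :
    ∀ᶠ z in 𝓝 ((x₀, 0) : (Fin m → ℝ) × (Fin (h + 1) → ℝ)),
      composedFlow Φ (Fin.tail z.2) (paramMap Φ f (List.finRange h) z) =
        jetFam f (z.1, z.2 0) := by
  have h1 : ContinuousAt (fun z : (Fin m → ℝ) × (Fin (h + 1) → ℝ) => (z.1, z.2 0)) (x₀, 0) := by
    fun_prop
  have h2 : ContinuousAt (fun z : (Fin m → ℝ) × (Fin (h + 1) → ℝ) =>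
      (Fin.tail z.2, jetFam f (z.1, z.2 0))) (x₀, 0) :=
    (continuous_tail.comp continuous_snd).continuousAt.prodMk
      (ContinuousAt.comp (g := jetFam f) (cylAt_jetFam hW hf hx₀).continuousAt h1)
  filter_upwards [h2.eventually
    (hS.eventually_flowList_flowListInv (hΩ _ hx₀) (List.finRange h))] with z hz
  rw [composedFlow_eq]
  exact hz

/-- On the image of the parametrization the functions `a` are the parameters: both satisfy the
defining equations. -/
theorem IsCharSystem.eventually_param_eq (hS : IsCharSystem Ω G lam η Φ D)
    (hW : IsOpen W) (hf : ContDiffOn ℝ ∞ (fun z : (Fin m → ℝ) × ℝ => f z.1 z.2) W)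
    (hΩ : ∀ z ∈ W, jetFam f z ∈ Ω) (hx₀ : (x₀, (0 : ℝ)) ∈ W)
    (huniq : ∀ᶠ z : ((Fin (h + 1) → ℝ) × (Fin (h + 1) → ℝ)) × Jet m n in
      𝓝 ((0, 0), jetFam f (x₀, 0)),
        (∀ k, defect Φ f z.1.1 z.2 (idx k) (mi k) = 0) →
        (∀ k, defect Φ f z.1.2 z.2 (idx k) (mi k) = 0) → z.1.1 = z.1.2)
    (hP : IsParamSystem Φ f idx mi (jetFam f (x₀, 0)) U a) :
    ∀ᶠ z in 𝓝 ((x₀, 0) : (Fin m → ℝ) × (Fin (h + 1) → ℝ)),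
      paramMap Φ f (List.finRange h) z ∈ U ∧ a (paramMap Φ f (List.finRange h) z) = z.2 := by
  have h0 : paramMap Φ f (List.finRange h) (x₀, 0) = jetFam f (x₀, 0) := hS.paramMap_base hΩ hx₀ _
  have hc := (hS.eventually_paramMap hW hf hΩ hx₀ (List.finRange h)).self_of_nhds.2.1.continuousAt
  have hU : ∀ᶠ z in 𝓝 ((x₀, 0) : (Fin m → ℝ) × (Fin (h + 1) → ℝ)),
      paramMap Φ f (List.finRange h) z ∈ U :=
    hc.eventually (hP.isOpen.mem_nhds (by rw [h0]; exact hP.mem))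
  have hac : ContinuousAt (fun z => ((a (paramMap Φ f (List.finRange h) z), z.2),
      paramMap Φ f (List.finRange h) z)) ((x₀, 0) : (Fin m → ℝ) × (Fin (h + 1) → ℝ)) := by
    refine ContinuousAt.prodMk (ContinuousAt.prodMk ?_ continuousAt_snd) hc
    exact ContinuousAt.comp (g := a) (by rw [h0]; exact (hP.cylAt hP.mem).continuousAt) hc
  have hu := hac.eventually (p := fun z => (∀ k, defect Φ f z.1.1 z.2 (idx k) (mi k) = 0) →
        (∀ k, defect Φ f z.1.2 z.2 (idx k) (mi k) = 0) → z.1.1 = z.1.2)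
    (by simpa only [h0, hP.base] using huniq)
  filter_upwards [hU, hu, hS.eventually_composedFlow_paramMap hW hf hΩ hx₀] with z h1 h2 h3
  exact ⟨h1, h2 (hP.eqns _ h1) fun k => defect_eq_zero h3 _ _⟩

theorem IsCharSystem.fderiv_xPart_paramMap (hS : IsCharSystem Ω G lam η Φ D)
    (hW : IsOpen W) (hΩ : ∀ z ∈ W, jetFam f z ∈ Ω) (hx₀ : (x₀, (0 : ℝ)) ∈ W) {l : List (Fin h)}
    (hd : DifferentiableAt ℝ (fun z : (Fin m → ℝ) × (Fin (h + 1) → ℝ) =>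
      xPart (paramMap Φ f l z)) (x₀, 0)) (v : Fin m → ℝ) :
    fderiv ℝ (fun z : (Fin m → ℝ) × (Fin (h + 1) → ℝ) => xPart (paramMap Φ f l z)) (x₀, 0) (v, 0) =
      v := by
  have h1 : HasDerivAt (fun s : ℝ => ((x₀ + s • v, 0) : (Fin m → ℝ) × (Fin (h + 1) → ℝ)))
      (v, 0) 0 :=
    (hasDerivAt_add_smul x₀ v).prodMk (hasDerivAt_const _ _)
  have h2 := HasFDerivAt.comp_hasDerivAt
    (l := fun z : (Fin m → ℝ) × (Fin (h + 1) → ℝ) => xPart (paramMap Φ f l z)) (0 : ℝ)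
    (by simpa using hd.hasFDerivAt) h1
  refine h2.unique ((hasDerivAt_add_smul x₀ v).congr_of_eventuallyEq ?_)
  have h3 : ∀ᶠ s : ℝ in 𝓝 0, (x₀ + s • v, (0 : ℝ)) ∈ W :=
    (show ContinuousAt (fun s : ℝ => (x₀ + s • v, (0 : ℝ))) 0 by fun_prop).eventually
      (hW.mem_nhds (by simpa using hx₀))
  filter_upwards [h3] with s hs
  simp only [Function.comp_apply, hS.paramMap_base hΩ hs]
  rfl

/-- The coordinates on the solution manifold. The derivatives of the inverse chart `κ` at constant
`a^0` are combinations of the total derivatives and of the fields `V_{G_k}`. -/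
theorem IsCharSystem.exists_chart (hS : IsCharSystem Ω G lam η Φ D)
    (hW : IsOpen W) (hf : ContDiffOn ℝ ∞ (fun z : (Fin m → ℝ) × ℝ => f z.1 z.2) W)
    (hΩ : ∀ z ∈ W, jetFam f z ∈ Ω) (hx₀ : (x₀, (0 : ℝ)) ∈ W)
    (huniq : ∀ᶠ z : ((Fin (h + 1) → ℝ) × (Fin (h + 1) → ℝ)) × Jet m n in
      𝓝 ((0, 0), jetFam f (x₀, 0)),
        (∀ k, defect Φ f z.1.1 z.2 (idx k) (mi k) = 0) →
        (∀ k, defect Φ f z.1.2 z.2 (idx k) (mi k) = 0) → z.1.1 = z.1.2)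
    (hP : IsParamSystem Φ f idx mi (jetFam f (x₀, 0)) U a) :
    ∃ U' ⊆ U, IsOpen U' ∧ jetFam f (x₀, 0) ∈ U' ∧ ∃ C κ,
      IsCoordSystem (manifoldK Φ f U' a) a C κ ∧ (x₀, (0 : Fin (h + 1) → ℝ)) ∈ C ∧
      ∀ w ∈ C, (Fin.tail w.2 : Fin h → ℝ) ∈ coeffDomain lam ∧ CylAt κ w ∧
        ∀ e : (Fin m → ℝ) × (Fin (h + 1) → ℝ), e.2 0 = 0 → ∀ c,
          HasDerivAt (fun s : ℝ => κ (w + s • e) c)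
            ((∑ k, (-coeffOp lam (Fin.tail w.2) (Fin.tail e.2)) k • evolField (G k) (κ w) +
              ∑ i, e.1 i • totalField i (κ w)) c) 0 := by
  set p₀ : Jet m n := jetFam f (x₀, 0) with hp₀
  have hp₀Ω : p₀ ∈ Ω := hΩ _ hx₀
  set ψ : (Fin m → ℝ) × (Fin (h + 1) → ℝ) → Jet m n := paramMap Φ f (List.finRange h) with hψ
  have hψ0 : ψ (x₀, 0) = p₀ := hS.paramMap_base hΩ hx₀ _
  have hpar := hS.eventually_paramMap hW hf hΩ hx₀ (List.finRange h)
  have hcoeff : ∀ᶠ z in 𝓝 ((x₀, 0) : (Fin m → ℝ) × (Fin (h + 1) → ℝ)),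
      (Fin.tail z.2 : Fin h → ℝ) ∈ coeffDomain lam :=
    (continuous_tail.comp continuous_snd).continuousAt.eventually
      ((isOpen_coeffDomain lam).mem_nhds (zero_mem_coeffDomain lam))
  obtain ⟨O, hO, hOo, hzO⟩ := eventually_nhds_iff.1
    (((hpar.and (hS.eventually_composedFlow_paramMap hW hf hΩ hx₀)).and
      (hS.eventually_param_eq hW hf hΩ hx₀ huniq hP)).and hcoeff)
  have hQ : ∀ᶠ z in 𝓝 ((x₀, 0) : (Fin m → ℝ) × (Fin (h + 1) → ℝ)),
      ContDiffAt ℝ ∞ (fun z => xPart (ψ z)) z := by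
    filter_upwards [hpar] with z hz using ((cylAt_xPart _).comp hz.2.1).contDiffAt
  obtain ⟨T₀, hT₀0, hT₀, hT₀s⟩ := exists_local_diffeo hQ fun v hv => by
    rwa [hS.fderiv_xPart_paramMap hW hΩ hx₀ (hQ.self_of_nhds.differentiableAt (by simp))] at hv
  -- the local diffeomorphism `(x, b) ↦ (x(ψ(x, b)), b)` near `(x₀, 0)`
  let T := T₀.restrOpen O hOo
  have hTsource : T.source = T₀.source ∩ O := T₀.restrOpen_source O hOo
  have hT : ∀ z ∈ T.source, T z = (xPart (ψ z), z.2) := fun z hz =>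
    hT₀ z (hTsource ▸ hz).1
  have hTO : ∀ w ∈ T.target, T.symm w ∈ O := fun w hw => by
    have := T.map_target hw
    rw [hTsource] at this
    exact this.2
  have hTs : ContDiffOn ℝ ∞ T.symm T.target := hT₀s.mono fun w hw => hw.1
  have hT0 : (x₀, 0) ∈ T.source := hTsource ▸ ⟨hT₀0, hzO⟩
  have hT0e : T (x₀, 0) = (x₀, 0) := by rw [hT _ hT0, hψ0]; rfl
  have hTinv : ∀ w ∈ T.target, xPart (ψ (T.symm w)) = w.1 ∧ (T.symm w).2 = w.2 := by
    intro w hw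
    have h1 := (hT _ (T.map_target hw)).symm.trans (T.right_inv hw)
    exact Prod.ext_iff.1 h1
  -- `U'` is so small that the inverse flow brings `p` back, and that `ψ` is applicable to the pair of
  -- the base point of the image of `p` under the composed flow and of the parameters `a(p)`
  have hac := (hP.cylAt hP.mem).continuousAt
  have hta : ContinuousAt (fun p => ((Fin.tail (a p) : Fin h → ℝ), p)) p₀ :=
    (continuous_tail.continuousAt.comp hac).prodMk continuousAt_id
  have hta0 : ((Fin.tail (a p₀) : Fin h → ℝ), p₀) = (0, p₀) := by rw [hP.base]; rfl
  have hζ : ContinuousAt (fun p => (xPart (composedFlow Φ (Fin.tail (a p)) p), a p)) p₀ := by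
    refine ContinuousAt.prodMk ?_ hac
    refine ContinuousAt.comp (g := fun z : (Fin h → ℝ) × Jet m n => xPart (composedFlow Φ z.1 z.2))
      (f := fun p => ((Fin.tail (a p) : Fin h → ℝ), p)) ?_ hta
    rw [hta0]
    simp only [composedFlow_eq]
    exact ((cylAt_xPart _).comp (hS.cylAt_flowList hp₀Ω _)).continuousAt
  have hζ0 : (xPart (composedFlow Φ (Fin.tail (a p₀)) p₀), a p₀) = (x₀, 0) := by
    rw [hP.base]
    exact Prod.ext (by rw [show Fin.tail (0 : Fin (h + 1) → ℝ) = 0 from rfl,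
      hS.composedFlow_zero hp₀Ω]; rfl) rfl
  have hU' : ∀ᶠ p in 𝓝 p₀, (p ∈ U ∧
      flowListInv Φ (List.finRange h) (Fin.tail (a p))
        (flowList Φ (List.finRange h) (Fin.tail (a p)) p) = p) ∧
      (xPart (composedFlow Φ (Fin.tail (a p)) p), a p) ∈ T.source := by
    refine Eventually.and (Eventually.and (hP.isOpen.mem_nhds hP.mem) ?_)
      (hζ.eventually (T.open_source.mem_nhds (by simp only [hζ0]; exact hT0)))
    exact hta.eventually (p := fun z => flowListInv Φ (List.finRange h) z.1
        (flowList Φ (List.finRange h) z.1 z.2) = z.2)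
      (by simp only [hta0]; exact hS.eventually_flowListInv_flowList hp₀Ω _)
  obtain ⟨U', hU', hU'o, hpU'⟩ := eventually_nhds_iff.1 hU'
  have hκc : ∀ w ∈ T.target, CylAt (fun w => ψ (T.symm w)) w := by
    intro w hw
    refine CylAt.comp (R := ψ) (hO _ (hTO w hw)).1.1.1.2.1 (cylAt_of_contDiffAt ?_)
    filter_upwards [T.open_target.mem_nhds hw] with y hy
    exact hTs.contDiffAt (T.open_target.mem_nhds hy)
  have hCo : IsOpen (T.target ∩ (fun w => ψ (T.symm w)) ⁻¹' U') :=
    ContinuousOn.isOpen_inter_preimage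
      (fun w hw => (hκc w hw).continuousAt.continuousWithinAt) T.open_target hU'o
  refine ⟨U', fun p hp => (hU' p hp).1.1, hU'o, hpU',
    T.target ∩ (fun w => ψ (T.symm w)) ⁻¹' U', fun w => ψ (T.symm w),
    ⟨hCo, ?_, ?_, ?_⟩, ?_, ?_⟩
  · ext p
    constructor
    · rintro ⟨w, ⟨hw, hwU⟩, rfl⟩
      obtain ⟨⟨⟨-, h1⟩, -, h2⟩, -⟩ := hO _ (hTO w hw)
      refine ⟨hwU, fun j s => ?_⟩
      exact defect_eq_zero (x := (T.symm w).1) (by rw [h2]; exact h1) j s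
    · rintro ⟨hp, hd⟩
      obtain ⟨⟨-, h1⟩, h2⟩ := hU' p hp
      have h3 := composedFlow_eq_of_defect hd
      have h4 : ψ (xPart (composedFlow Φ (Fin.tail (a p)) p), a p) = p := by
        change flowListInv Φ (List.finRange h) (Fin.tail (a p)) (jetFam f (_, a p 0)) = p
        rw [← h3, composedFlow_eq, h1]
      have h5 : ψ (T.symm (T (xPart (composedFlow Φ (Fin.tail (a p)) p), a p))) = p := by
        rw [T.left_inv h2, h4]
      exact ⟨_, ⟨T.map_source h2, mem_preimage.2 (by simp only [h5]; exact hp)⟩, h5⟩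
  · intro w hw
    refine ⟨(hTinv w hw.1).1, ?_⟩
    exact (hO _ (hTO w hw.1)).1.2.2.trans (hTinv w hw.1).2
  · exact fun c w hw => ((hκc w hw.1).apply c).contDiffAt.contDiffWithinAt
  · have h1 : T.symm (x₀, 0) = (x₀, 0) := by
      have := T.left_inv hT0
      rwa [hT0e] at this
    have h2 := T.map_source hT0
    rw [hT0e] at h2
    exact ⟨h2, show ψ (T.symm (x₀, 0)) ∈ U' by rwa [h1, hψ0]⟩
  · rintro w ⟨hw, -⟩
    obtain ⟨⟨⟨⟨hzΩ, hzc, hzt⟩, -⟩, -⟩, hzd⟩ := hO _ (hTO w hw)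
    have hw2 := (hTinv w hw).2
    rw [hw2] at hzd hzt
    refine ⟨hzd, hκc w hw, fun e he c => ?_⟩
    have hTd := ((hTs.contDiffAt (T.open_target.mem_nhds hw)).differentiableAt
      (by simp)).hasFDerivAt
    set e' := fderiv ℝ T.symm w e with he'
    have hTe : HasDerivAt (fun s : ℝ => T.symm (w + s • e)) e' 0 :=
      HasFDerivAt.comp_hasDerivAt (l := T.symm) (0 : ℝ) (by simpa using hTd)
        (hasDerivAt_add_smul w e)
    have hwn : ∀ᶠ s : ℝ in 𝓝 0, w + s • e ∈ T.target :=
      (hasDerivAt_add_smul w e).continuousAt.eventually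
        (T.open_target.mem_nhds (by simpa using hw))
    have he2 : e'.2 = e.2 := by
      have h1 : HasDerivAt (fun s : ℝ => (T.symm (w + s • e)).2) e'.2 0 :=
        (ContinuousLinearMap.snd ℝ (Fin m → ℝ) (Fin (h + 1) → ℝ)).hasFDerivAt.comp_hasDerivAt
          (0 : ℝ) hTe
      refine h1.unique ((hasDerivAt_add_smul w.2 e.2).congr_of_eventuallyEq ?_)
      filter_upwards [hwn] with s hs using (hTinv _ hs).2
    -- the inverse chart moves the base point `x` along, which does not matter modulo the `D_i`
    obtain ⟨v, hv, hvert⟩ := hzt e' (by rw [he2, he])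
    have hκv : ∀ c, HasDerivAt (fun s : ℝ => ψ (T.symm (w + s • e)) c) (v c) 0 := by
      intro c
      have hd := ((hzc.apply c).contDiffAt.differentiableAt (by simp)).hasFDerivAt
      have h1 : HasDerivAt (fun s : ℝ => ψ (T.symm w + s • e') c)
          (fderiv ℝ (fun z => ψ z c) (T.symm w) e') 0 :=
        HasFDerivAt.comp_hasDerivAt (l := fun z => ψ z c) (0 : ℝ) (by simpa using hd)
          (hasDerivAt_add_smul _ e')
      rw [(hv c).unique h1]
      exact HasFDerivAt.comp_hasDerivAt (l := fun z => ψ z c) (0 : ℝ) (by simpa using hd) hTe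
    -- in the new coordinates the base components are determined
    have hve : ∀ i, v (Sum.inl i) = e.1 i := by
      intro i
      refine (hκv (Sum.inl i)).unique ?_
      refine (hasDerivAt_pi.1 (hasDerivAt_add_smul w.1 e.1) i).congr_of_eventuallyEq ?_
      filter_upwards [hwn] with s hs using congrFun (hTinv _ hs).1 i
    have hvv : v = ∑ k, (-coeffOp lam (Fin.tail w.2) (Fin.tail e.2)) k •
        evolField (G k) (ψ (T.symm w)) + ∑ i, e.1 i • totalField i (ψ (T.symm w)) := by
      rw [he2] at hvert
      simp only [vert, hve] at hvert
      exact eq_add_of_sub_eq hvert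
    rw [← hvv]
    exact hκv c

end Manifold

end JetSPDE

theorem theorem5 {m n h : ℕ}
    (M : Set (Fin m → ℝ)) (N : Set (Fin n → ℝ)) (hM : IsOpen M) (hN : IsOpen N)
    -- the generators, with `[G_i, G_j] = ∑ lam i j k • G_k`
    (F : Fin n → JetSPDE.Jet m n → ℝ)
    (hF : ∀ j, F j ∈ JetSPDE.smoothFns (JetSPDE.jetSpace M N))
    (G : Fin h → Fin n → JetSPDE.Jet m n → ℝ)
    (hG : ∀ i j, G i j ∈ JetSPDE.smoothFns (JetSPDE.jetSpace M N))
    (lam : Fin h → Fin h → Fin h → ℝ)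
    (hLie : ∀ i j α, ∀ p ∈ JetSPDE.jetSpace M N,
      JetSPDE.bracket (G i) (G j) α p = ∑ k, lam i j k * G k α p)
    -- each `G_i` admits characteristics, with characteristic flow `Φ_i`
    (η : Fin h → Fin m → JetSPDE.Jet m n → ℝ)
    (hη : ∀ i r, η i r ∈ JetSPDE.smoothFns (JetSPDE.jetSpace M N))
    (Φ : Fin h → ℝ → JetSPDE.Jet m n → JetSPDE.Jet m n)
    (hΦ : ∀ i, ∃ D, JetSPDE.IsLocalFlow (JetSPDE.jetSpace M N)
      (JetSPDE.charField (G i) (η i)) D (Φ i))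
    (hfilt : JetSPDE.HasCommonFiltration (JetSPDE.jetSpace M N)
      (fun i => JetSPDE.charField (G i) (η i)))
    -- the solution `f` of the evolution equation of `F`, for nonnegative times
    (f : (Fin m → ℝ) → ℝ → Fin n → ℝ) (W : Set ((Fin m → ℝ) × ℝ)) (hW : IsOpen W)
    (hW0 : ∀ x ∈ M, (x, (0 : ℝ)) ∈ W)
    (hWMN : ∀ x t, (x, t) ∈ W → x ∈ M ∧ f x t ∈ N)
    (hf : ContDiffOn ℝ ∞ (fun z : (Fin m → ℝ) × ℝ => f z.1 z.2) W)
    (hevol : ∀ x t, (x, t) ∈ W → 0 ≤ t → ∀ j,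
      HasDerivAt (fun s => f x s j) (F j (JetSPDE.jetOf (fun y => f y t) x)) t)
    -- nondegeneracy at the point `x₀`
    (x₀ : Fin m → ℝ) (hx₀ : x₀ ∈ M)
    (idx : Fin (h + 1) → Fin n) (mi : Fin (h + 1) → Fin m → ℕ)
    (hdet : (Matrix.of fun k l : Fin (h + 1) =>
      JetSPDE.totalDeriv (mi k) ((Fin.cons F G : Fin (h + 1) → Fin n → JetSPDE.Jet m n → ℝ) l (idx k))
        (JetSPDE.jetOf (fun y => f y 0) x₀)).det ≠ 0) :
    -- the functions `a^0, …, a^h` exist near the jet of `f(·, 0)` at `x₀`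
    (∃ U a, JetSPDE.IsParamSystem Φ f idx mi (JetSPDE.jetOf (fun y => f y 0) x₀) U a) ∧
    ∀ U a, JetSPDE.IsParamSystem Φ f idx mi (JetSPDE.jetOf (fun y => f y 0) x₀) U a →
      ∃ U' ⊆ U, IsOpen U' ∧ JetSPDE.jetOf (fun y => f y 0) x₀ ∈ U' ∧
        -- `D_i(a^j) = 0` on `𝒦`
        (∀ p ∈ JetSPDE.manifoldK Φ f U' a, ∀ i j,
          JetSPDE.act (JetSPDE.totalField i) (fun q => a q j) p = 0) ∧
        -- `(x, a)` are coordinates of `𝒦`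
        ∃ C κ, JetSPDE.IsCoordSystem (JetSPDE.manifoldK Φ f U' a) a C κ ∧
          (x₀, (0 : Fin (h + 1) → ℝ)) ∈ C ∧
          ∃ (B : Set (Fin h → ℝ)) (φ : Fin h → Fin (h + 1) → (Fin h → ℝ) → ℝ),
            IsOpen B ∧ (∀ z ∈ C, Fin.tail z.2 ∈ B) ∧
            (∀ i l, ContDiffOn ℝ ∞ (φ i l) B) ∧
            -- `V_{G_i} = ∑_{l = 0}^h φ_i^l(a^1, …, a^h) ∂_{a^l}` on `𝒦`
            (∀ i, ∀ g ∈ JetSPDE.smoothFns U', ∀ z ∈ C,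
              JetSPDE.act (JetSPDE.evolField (G i)) g (κ z) =
                ∑ l, φ i l (Fin.tail z.2) *
                  fderiv ℝ (fun w => g (κ w)) z (0, Pi.single l 1)) ∧
            -- the initial conditions
            (∀ i l, ∀ b ∈ B, (∀ j < i, b j = 0) →
              φ i l b = if l = i.succ then -1 else 0) ∧
            -- the recursive equations
            (∀ i k l, ∀ b ∈ B, (∀ j < k, b j = 0) →
              fderiv ℝ (φ i l) b (Pi.single k 1) =
                -(∑ p, lam k i p * φ p l b) -
                  ∑ r ∈ Finset.Iio k, φ i r.succ b * fderiv ℝ (φ k l) b (Pi.single r 1)) := by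
  have hΩo : IsOpen (JetSPDE.jetSpace M N) := JetSPDE.isOpen_jetSpace hM hN
  choose D hD using hΦ
  have hGl : ∀ i j, G i j ∈ JetSPDE.LocSmooth (JetSPDE.jetSpace M N) :=
    fun i j => JetSPDE.smoothFns_subset hΩo (hG i j)
  have hS : JetSPDE.IsCharSystem (JetSPDE.jetSpace M N) G lam η Φ D :=
    ⟨hΩo, hGl, hLie, hη, hD, hfilt⟩
  have hΩ : ∀ z ∈ W, JetSPDE.jetFam f z ∈ JetSPDE.jetSpace M N :=
    fun z hz => JetSPDE.jetFam_mem hWMN hz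
  have hx₀W := hW0 x₀ hx₀
  have hanti := JetSPDE.lam_antisymm hΩo hGl hLie (hΩ _ hx₀W) hdet
  obtain ⟨hex, huniq⟩ := hS.exists_paramSystem hW hf hΩ hx₀W
    (fun j => JetSPDE.smoothFns_subset hΩo (hF j)) hevol hdet
  refine ⟨hex, fun U a hP => ?_⟩
  obtain ⟨U', hU'U, hU'o, hpU', C, κ, hκ, hC0, htan⟩ := hS.exists_chart hW hf hΩ hx₀W huniq hP
  have hκU : ∀ w ∈ C, κ w ∈ U' := fun w hw => (hκ.image_eq ▸ mem_image_of_mem κ hw).1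
  refine ⟨U', hU'U, hU'o, hpU', ?_, C, κ, hκ, hC0, JetSPDE.coeffDomain lam,
    JetSPDE.genCoeff lam, JetSPDE.isOpen_coeffDomain lam, fun z hz => (htan z hz).1,
    JetSPDE.contDiffOn_genCoeff, ?_, fun i l b hb hbi => JetSPDE.genCoeff_initial hb hbi l,
    fun i k l b hb hbk => JetSPDE.genCoeff_recursion hanti hb i hbk l⟩
  · rw [← hκ.image_eq]
    rintro _ ⟨w, hw, rfl⟩ i j
    have ha : JetSPDE.CylAt (fun q => a q j) (κ w) := (hP.cylAt (hU'U (hκU w hw))).apply j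
    have h1 := JetSPDE.CylAt.hasDerivAt_comp (F := fun q => a q j) (s := (0 : ℝ))
      (q := fun s : ℝ => κ (w + s • ((Pi.single i 1, 0) : (Fin m → ℝ) × (Fin (h + 1) → ℝ))))
      (by simpa using ha) ((htan w hw).2.2 (Pi.single i 1, 0) rfl)
    -- the direction of `x^i` in the coordinates `(x, a)` is `D_i`
    have h2 : ∑ k, (-JetSPDE.coeffOp lam (Fin.tail w.2) (Fin.tail (0 : Fin (h + 1) → ℝ))) k •
        JetSPDE.evolField (G k) (κ w) + ∑ r, (Pi.single i (1 : ℝ) : Fin m → ℝ) r •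
        JetSPDE.totalField r (κ w) = JetSPDE.totalField i (κ w) := by
      rw [show (Fin.tail (0 : Fin (h + 1) → ℝ) : Fin h → ℝ) = 0 from rfl, map_zero]
      simp [Pi.single_apply]
    rw [h2] at h1
    have h3 : ∀ᶠ s : ℝ in 𝓝 0,
        w + s • ((Pi.single i 1, 0) : (Fin m → ℝ) × (Fin (h + 1) → ℝ)) ∈ C :=
      (JetSPDE.hasDerivAt_add_smul w _).continuousAt.eventually
        (hκ.isOpen.mem_nhds (by simpa using hw))
    have h4 := h1.unique ((hasDerivAt_const (0 : ℝ) (w.2 j)).congr_of_eventuallyEq (by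
      filter_upwards [h3] with s hs
      rw [(hκ.left_inv _ hs).2]
      simp))
    simpa [JetSPDE.act] using h4
  · intro i g hg w hw
    have hgc : JetSPDE.CylAt g (κ w) := JetSPDE.smoothFns_subset hU'o hg _ (hκU w hw)
    have hb := (htan w hw).1
    set e : (Fin m → ℝ) × (Fin (h + 1) → ℝ) :=
      (0, Fin.cons 0 (JetSPDE.genDir lam i (Fin.tail w.2))) with he
    have h1 := JetSPDE.CylAt.hasDerivAt_comp (F := g) (s := (0 : ℝ))
      (q := fun s : ℝ => κ (w + s • e)) (by simpa using hgc) ((htan w hw).2.2 e rfl)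
    -- the direction `e` in the coordinates `(x, a)` is `V_{G_i}`
    have h2 : ∑ k, (-JetSPDE.coeffOp lam (Fin.tail w.2) (Fin.tail e.2)) k •
        JetSPDE.evolField (G k) (κ w) + ∑ r, e.1 r • JetSPDE.totalField r (κ w) =
        JetSPDE.evolField (G i) (κ w) := by
      rw [show (Fin.tail e.2 : Fin h → ℝ) = JetSPDE.genDir lam i (Fin.tail w.2) from rfl,
        JetSPDE.coeffOp_genDir hb, neg_neg]
      simp [he, Pi.single_apply]
    rw [h2] at h1
    have hd := (JetSPDE.CylAt.comp (R := g) hgc (htan w hw).2.1).contDiffAt.differentiableAt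
      (by simp)
    have h3 : HasDerivAt (fun s : ℝ => g (κ (w + s • e))) (fderiv ℝ (fun w => g (κ w)) w e) 0 :=
      HasFDerivAt.comp_hasDerivAt (l := fun w => g (κ w)) (0 : ℝ) (by simpa using hd.hasFDerivAt)
        (JetSPDE.hasDerivAt_add_smul w e)
    have h4 := h1.unique h3
    have h5 : e = ∑ l, JetSPDE.genCoeff lam i l (Fin.tail w.2) •
        ((0, Pi.single l 1) : (Fin m → ℝ) × (Fin (h + 1) → ℝ)) := by
      refine Prod.ext ?_ ?_
      · simp [he, Prod.fst_sum]
      · simp only [Prod.snd_sum, Prod.smul_snd]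
        exact JetSPDE.eq_sum_smul_single _
    rw [h5, map_sum] at h4
    simp only [map_smul, smul_eq_mul] at h4
    simpa [JetSPDE.act] using h4
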